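/- Let $N$ be a complete (connected) Riemannian manifold, let $x_0\in N$ and $\kappa\in\mathbb{R}$, and suppose that the radial sectional curvatures of $N$ along the geodesics issuing from $x_0$ are at most $\kappa$: for every unit-speed geodesic $\gamma$ with $\gamma(0)=x_0$, every $t>0$ and every unit vector $v\in T_{\gamma(t)}N$ with $v\perp\gamma'(t)$, one has $K(\gamma'(t),v)\le\kappa$. Let $M$ be a complete (connected) Riemannian manifold of dimension $m\ge 3$ and let $\varphi:M\to N\times\mathbb{R}$ be an isometric immersion into the Riemannian product, with second fundamental form $\alpha$ and mean curvature vector $H=\sum_{i=1}^m\alpha(e_i,e_i)$ (the trace of $\alpha$, $\{e_i\}$ an orthonormal basis of the tangent space). Write $B_N(p,r)$ for the open geodesic ball and $$h(p,r)=\sup\{|H(x)| : x\in M,\ \varphi(x)\in B_N(p,r)\times\mathbb{R}\}$$ (with $\sup\emptyset=0$). Suppose that $\varphi$ has locally bounded mean curvature, i.e. $h(p,r)<\infty$ for all $p\in N$, $r>0$. Let $S_\kappa(t)=\sin(\sqrt{\kappa}\,t)/\sqrt{\kappa}$, $t$, or $\sinh(\sqrt{-\kappa}\,t)/\sqrt{-\kappa}$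 according as $\kappa>0$, $\kappa=0$ or $\kappa<0$, and $C_\kappa=S_\kappa'$. Let $(C_\kappa/S_\kappa)^{-1}$ be the inverse of the strictly decreasing function $C_\kappa/S_\kappa$ on $(0,\pi/\sqrt\kappa)$ ($=(0,\infty)$ if $\kappa\le 0$), with value $\infty$ at those $s$ that lie below all values of $C_\kappa/S_\kappa$. Let $0<r<\infty$ satisfy $r\le\min\{\mathrm{inj}_N(x_0),\pi/(2\sqrt{\kappa})\}$ (where $\pi/(2\sqrt\kappa)=\infty$ if $\kappa\le0$). Suppose in addition that one of the following holds: (a) $h(x_0,r)<\Lambda^2$ and $r\le (C_\kappa/S_\kappa)^{-1}\big(\Lambda^2/(m-2)\big)$ for some real number $\Lambda$; or (b) $\lim_{t\to\infty}h(x_0,t)=\infty$ and $r<(C_\kappa/S_\kappa)^{-1}\big(h(x_0,r_0)/(m-2)\big)$ for some $r_0$ in the domain of $C_\kappa/S_\kappa$ with $(m-2)\frac{C_\kappa}{S_\kappa}(r_0)-h(x_0,r_0)=0$. Then every connected component $\Omega(r)$ of $\varphi^{-1}(B_N(x_0,r)\times\mathbb{R})$ satisfies $$\lambda^*(\Omega(r))\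 \ge\ \left[\frac{(m-2)\frac{C_\kappa}{S_\kappa}(r)-h(x_0,r)}{2}\right]^2>0,$$ where $\lambda^*(\Omega)=\inf\big\{\int_\Omega|\mathrm{grad} f|^2\big/\int_\Omega f^2 : f\in H_0^1(\Omega)\setminus\{0\}\big\}$ is the fundamental tone of $\Omega$. -/

import Mathlib

open Set Filter MeasureTheory Bundle
open scoped Manifold ContDiff Bundle ENNReal Topology

noncomputable section

namespace CylTone

/-! ### Metric fields, Levi-Civita connection and curvature in charts -/

section Metric

variable {E : Type*} [NormedAddCommGroup E] [NormedSpace ℝ E]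
  {H : Type*} [TopologicalSpace H] (I : ModelWithCorners ℝ E H)
  {M : Type*} [TopologicalSpace M] [ChartedSpace H M]
  {E' : Type*} [NormedAddCommGroup E'] [NormedSpace ℝ E']
  {H' : Type*} [TopologicalSpace H'] (J : ModelWithCorners ℝ E' H')
  {W : Type*} [TopologicalSpace W] [ChartedSpace H' W]

/-- A field of bilinear forms on the tangent spaces. -/
abbrev MetricField (M : Type*) [TopologicalSpace M] [ChartedSpace H M] :=
  Π x : M, TangentSpace I x →L[ℝ] TangentSpace I x →L[ℝ] ℝ

/-- The metric tensor of a Riemannian manifold. -/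
def riemMetric (M : Type*) [TopologicalSpace M] [ChartedSpace H M]
    [h : RiemannianBundle (fun x : M => TangentSpace I x)] : MetricField I M :=
  fun x => h.g.inner x

/-- The composition of a bilinear form with a linear map in both arguments. -/
def bilinPullback {E F : Type*} [NormedAddCommGroup E] [NormedSpace ℝ E]
    [NormedAddCommGroup F] [NormedSpace ℝ F] (b : F →L[ℝ] F →L[ℝ] ℝ) (D : E →L[ℝ] F) :
    E →L[ℝ] E →L[ℝ] ℝ :=
  b.bilinearComp D D

variable {I J} in
/-- The pull-back `f^* g` of a metric field: `(f^* g) x u v = g (f x) (df u) (df v)`. -/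
def pullback (I : ModelWithCorners ℝ E H) (g : MetricField J W) (f : M → W) : MetricField I M :=
  fun x => bilinPullback (E := E) (F := E') (g (f x)) (mfderiv I J f x)

/-- The metric `g` read in the chart at `p`, as a function on the model space. -/
def chartMetric {I : ModelWithCorners ℝ E H} (g : MetricField I M) (p : M) (y : E) :
    E →L[ℝ] E →L[ℝ] ℝ :=
  pullback 𝓘(ℝ, E) g (extChartAt I p).symm y

/-- The Christoffel form of a metric `G` on (an open subset of) the model space:
`G y (Γ y u v) w = (D_u G (v, w) + D_v G (u, w) - D_w G (u, v)) / 2` for all `w`. -/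
def christoffel (G : E → E →L[ℝ] E →L[ℝ] ℝ) (y u v : E) : E :=
  (G y).inverse ((1 / 2 : ℝ) •
    (fderiv ℝ G y u v + fderiv ℝ G y v u - ((fderiv ℝ G y).flip u).flip v))

/-- The Riemann curvature `R(u, v) w = ∇_u ∇_v w - ∇_v ∇_u w` for constant fields `u, v, w`. -/
def curvatureForm (G : E → E →L[ℝ] E →L[ℝ] ℝ) (y u v w : E) : E :=
  fderiv ℝ (fun z => christoffel G z v w) y u - fderiv ℝ (fun z => christoffel G z u w) y v
    + christoffel G y u (christoffel G y v w) - christoffel G y v (christoffel G y u w)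

/-- The sectional curvature of the plane spanned by the tangent vectors `u`, `v` at `p`. -/
def sectionalCurvature {I : ModelWithCorners ℝ E H} (g : MetricField I M) (p : M)
    (u v : TangentSpace I p) : ℝ :=
  let G := chartMetric g p
  let y : E := extChartAt I p p
  let u' : E := mfderiv I 𝓘(ℝ, E) (extChartAt I p) p u
  let v' : E := mfderiv I 𝓘(ℝ, E) (extChartAt I p) p v
  G y (curvatureForm G y u' v' v') u' / (G y u' u' * G y v' v' - G y u' v' ^ 2)

/-- The velocity `γ'(t)`. -/
def velocity (γ : ℝ → M) (t : ℝ) : TangentSpace I (γ t) := mfderiv 𝓘(ℝ, ℝ) I γ t (1 : ℝ)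

/-- Geodesics defined on the whole real line: `c'' + Γ(c', c') = 0` in charts. -/
def IsGeodesic {I : ModelWithCorners ℝ E H} (g : MetricField I M) (γ : ℝ → M) : Prop :=
  ContMDiff 𝓘(ℝ, ℝ) I ∞ γ ∧
    ∀ t : ℝ, let c : ℝ → E := fun s => extChartAt I (γ t) (γ s)
      deriv (deriv c) t + christoffel (chartMetric g (γ t)) (c t) (deriv c t) (deriv c t) = 0

/-- The second fundamental form `∇dφ (X, Y) = ∇_X (dφ Y) - dφ (∇_X Y)` of a map
`φ : (M, g) → (W, k)` at `x`, computed in the charts at `x` and `φ x`. -/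
def secondFundamentalForm {I : ModelWithCorners ℝ E H} {J : ModelWithCorners ℝ E' H'}
    (g : MetricField I M) (k : MetricField J W) (φ : M → W) (x : M)
    (X Y : TangentSpace I x) : TangentSpace J (φ x) :=
  let F : E → E' := fun y => extChartAt J (φ x) (φ ((extChartAt I x).symm y))
  let y : E := extChartAt I x x
  let X' : E := mfderiv I 𝓘(ℝ, E) (extChartAt I x) x X
  let Y' : E := mfderiv I 𝓘(ℝ, E) (extChartAt I x) x Y
  (mfderiv J 𝓘(ℝ, E') (extChartAt J (φ x)) (φ x)).inverse
    (fderiv ℝ (fderiv ℝ F) y X' Y'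
      + christoffel (chartMetric k (φ x)) (F y) (fderiv ℝ F y X') (fderiv ℝ F y Y')
      - fderiv ℝ F y (christoffel (chartMetric g x) y X' Y') : E')

/-- `φ` is an isometric immersion: it is smooth and `φ^* k = g`. -/
def IsIsometricImmersion {I : ModelWithCorners ℝ E H} {J : ModelWithCorners ℝ E' H'}
    (g : MetricField I M) (k : MetricField J W) (φ : M → W) : Prop :=
  ContMDiff I J ∞ φ ∧ ∀ (x : M) (u v : TangentSpace I x), pullback I k φ x u v = g x u v

/-- The product metric on `N × ℝ`. -/
def cylMetric (N : Type*) [TopologicalSpace N] [ChartedSpace H N]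
    [RiemannianBundle (fun x : N => TangentSpace I x)] : MetricField (I.prod 𝓘(ℝ, ℝ)) (N × ℝ) :=
  fun x => pullback (I.prod 𝓘(ℝ, ℝ)) (riemMetric I N) (Prod.fst : N × ℝ → N) x
    + pullback (I.prod 𝓘(ℝ, ℝ)) (riemMetric 𝓘(ℝ, ℝ) ℝ) (Prod.snd : N × ℝ → ℝ) x

end Metric

/-! ### Exponential map and injectivity radius -/

section Exp

variable {E : Type*} [NormedAddCommGroup E] [NormedSpace ℝ E]
  {H : Type*} [TopologicalSpace H] (I : ModelWithCorners ℝ E H)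
  {N : Type*} [TopologicalSpace N] [ChartedSpace H N]
  [RiemannianBundle (fun x : N => TangentSpace I x)]

open Classical in
/-- The exponential map of a complete Riemannian manifold: `exp_p v = γ 1`, where `γ` is the
geodesic with `γ 0 = p` and `γ' 0 = v`. -/
def expMap (p : N) (v : TangentSpace I p) : N :=
  if h : ∃ γ : ℝ → N, IsGeodesic (riemMetric I N) γ ∧
      (⟨γ 0, velocity I γ 0⟩ : TangentBundle I N) = ⟨p, v⟩
  then h.choose 1 else p

/-- The injectivity radius at `p`: the supremum of the `ρ > 0` for which `exp_p` is a
diffeomorphism from the open ball of radius `ρ` in `T_p N` onto its image. -/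
def injRadius (p : N) : ℝ≥0∞ :=
  ⨆ (ρ : ℝ) (_ : 0 < ρ ∧ InjOn (expMap I p) (Metric.ball (0 : TangentSpace I p) ρ) ∧
    IsLocalDiffeomorphOn 𝓘(ℝ, TangentSpace I p) I ∞ (expMap I p)
      (Metric.ball (0 : TangentSpace I p) ρ)), ENNReal.ofReal ρ

/-- The radial sectional curvatures of `N` along the geodesics issuing from `x₀` are at most `κ`. -/
def RadialCurvatureLE (x₀ : N) (κ : ℝ) : Prop :=
  ∀ γ : ℝ → N, IsGeodesic (riemMetric I N) γ → γ 0 = x₀ → (∀ t, ‖velocity I γ t‖ = 1) →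
    ∀ t : ℝ, 0 < t → ∀ v : TangentSpace I (γ t), ‖v‖ = 1 → inner ℝ (velocity I γ t) v = 0 →
      sectionalCurvature (riemMetric I N) (γ t) (velocity I γ t) v ≤ κ

end Exp

/-! ### Riemannian volume and fundamental tone -/

section Tone

variable {m : ℕ} {M : Type*} [TopologicalSpace M] [ChartedSpace (EuclideanSpace ℝ (Fin m)) M]
  [RiemannianBundle (fun x : M => TangentSpace (𝓡 m) x)]

instance (x : M) : FiniteDimensional ℝ (TangentSpace (𝓡 m) x) :=
  inferInstanceAs (FiniteDimensional ℝ (EuclideanSpace ℝ (Fin m)))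

instance (x : M) : CompleteSpace (TangentSpace (𝓡 m) x) :=
  FiniteDimensional.complete ℝ _

/-- The density `√(det (g_ij))` of the Riemannian volume in the chart at `p`. -/
def volumeDensity (p : M) (y : EuclideanSpace ℝ (Fin m)) : ℝ :=
  Real.sqrt (Matrix.det (Matrix.of fun i j : Fin m =>
    chartMetric (riemMetric (𝓡 m) M) p y (EuclideanSpace.single i 1) (EuclideanSpace.single j 1)))

/-- The Riemannian volume of the domain of the chart at `p`. -/
def chartVolume [MeasurableSpace M] (p : M) : Measure M :=
  (((volume : Measure (EuclideanSpace ℝ (Fin m))).restrict (extChartAt (𝓡 m) p).target).withDensity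
    (fun y => ENNReal.ofReal (volumeDensity p y))).map (extChartAt (𝓡 m) p).symm

/-- The Riemannian volume measure: the measures `chartVolume p` agree on the overlaps of the
charts, and their supremum is the measure obtained by gluing them. -/
def riemVolume (m : ℕ) (M : Type*) [TopologicalSpace M] [ChartedSpace (EuclideanSpace ℝ (Fin m)) M]
    [RiemannianBundle (fun x : M => TangentSpace (𝓡 m) x)] [MeasurableSpace M] : Measure M :=
  ⨆ p : M, chartVolume (m := m) p

/-- The gradient of a real function. -/
def grad (m : ℕ) {M : Type*} [TopologicalSpace M] [ChartedSpace (EuclideanSpace ℝ (Fin m)) M]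
    [RiemannianBundle (fun x : M => TangentSpace (𝓡 m) x)] (f : M → ℝ) (x : M) :
    TangentSpace (𝓡 m) x :=
  (InnerProductSpace.toDual ℝ (TangentSpace (𝓡 m) x)).symm (mvfderiv (𝓡 m) f x)

/-- Smooth functions with compact support in `Ω`. -/
def IsTestFunction (m : ℕ) {M : Type*} [TopologicalSpace M]
    [ChartedSpace (EuclideanSpace ℝ (Fin m)) M] (Ω : Set M) (f : M → ℝ) : Prop :=
  ContMDiff (𝓡 m) 𝓘(ℝ, ℝ) ∞ f ∧ HasCompactSupport f ∧ tsupport f ⊆ Ω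

/-- `f` belongs to `H₀¹(Ω)` with (weak) gradient `V`: the pair `(f, V)` is the limit in `L²(Ω)` of
`(f_k, grad f_k)` for a sequence of smooth functions `f_k` with compact support in `Ω`. -/
def IsH01 [IsManifold (𝓡 m) ∞ M] [MeasurableSpace M] (Ω : Set M) (f : M → ℝ) (V : Π x : M, TangentSpace (𝓡 m) x) : Prop :=
  Measurable f ∧
  Measurable[_, borel (TangentBundle (𝓡 m) M)]
    (fun x => (⟨x, V x⟩ : TangentBundle (𝓡 m) M)) ∧
  ∃ F : ℕ → M → ℝ, (∀ k, IsTestFunction m Ω (F k)) ∧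
    Tendsto (fun k => ∫⁻ x in Ω, ‖F k x - f x‖ₑ ^ 2 ∂(riemVolume m M)) atTop (𝓝 0) ∧
    Tendsto (fun k => ∫⁻ x in Ω, ‖grad m (F k) x - V x‖ₑ ^ 2 ∂(riemVolume m M)) atTop (𝓝 0)

/-- The fundamental tone `λ*(Ω) = inf { ∫_Ω |grad f|² / ∫_Ω f² ; f ∈ H₀¹(Ω) \ {0} }`. -/
def fundamentalTone (m : ℕ) {M : Type*} [TopologicalSpace M]
    [ChartedSpace (EuclideanSpace ℝ (Fin m)) M]
    [IsManifold (𝓡 m) ∞ M] [RiemannianBundle (fun x : M => TangentSpace (𝓡 m) x)]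
    [MeasurableSpace M] (Ω : Set M) : ℝ≥0∞ :=
  ⨅ (f : M → ℝ) (V : Π x : M, TangentSpace (𝓡 m) x)
    (_ : IsH01 Ω f V ∧ ∫⁻ x in Ω, ‖f x‖ₑ ^ 2 ∂(riemVolume m M) ≠ 0),
    (∫⁻ x in Ω, ‖V x‖ₑ ^ 2 ∂(riemVolume m M)) / (∫⁻ x in Ω, ‖f x‖ₑ ^ 2 ∂(riemVolume m M))

/-! ### Mean curvature of submanifolds of `N × ℝ` -/

variable {n : ℕ} {N : Type*} [MetricSpace N] [ChartedSpace (EuclideanSpace ℝ (Fin n)) N]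
  [RiemannianBundle (fun x : N => TangentSpace (𝓡 n) x)]

/-- The mean curvature vector `H = ∑ α(e_i, e_i)` of `φ` at `x`, for an orthonormal basis `e_i`
of `T_x M`. -/
def meanCurvature (φ : M → N × ℝ) (x : M) : TangentSpace ((𝓡 n).prod 𝓘(ℝ, ℝ)) (φ x) :=
  ∑ i, secondFundamentalForm (riemMetric (𝓡 m) M) (cylMetric (𝓡 n) N) φ x
    (stdOrthonormalBasis ℝ (TangentSpace (𝓡 m) x) i)
    (stdOrthonormalBasis ℝ (TangentSpace (𝓡 m) x) i)

/-- The length `|H|` of the mean curvature vector. -/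
def meanCurvatureNorm (m n : ℕ) {M : Type*} [TopologicalSpace M]
    [ChartedSpace (EuclideanSpace ℝ (Fin m)) M]
    [RiemannianBundle (fun x : M => TangentSpace (𝓡 m) x)]
    {N : Type*} [MetricSpace N] [ChartedSpace (EuclideanSpace ℝ (Fin n)) N]
    [RiemannianBundle (fun x : N => TangentSpace (𝓡 n) x)] (φ : M → N × ℝ) (x : M) : ℝ :=
  Real.sqrt (cylMetric (𝓡 n) N (φ x) (meanCurvature (m := m) φ x) (meanCurvature (m := m) φ x))

/-- The preimage `φ⁻¹(B_N(p, r) × ℝ)` of a cylinder. -/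
def cylPreimage {M N : Type*} [MetricSpace N] (φ : M → N × ℝ) (p : N) (r : ℝ) : Set M :=
  φ ⁻¹' (Metric.ball p r ×ˢ (univ : Set ℝ))

/-- The values of `|H|` on `φ(M) ∩ (B_N(p, r) × ℝ)`. -/
def meanCurvatureValues (m n : ℕ) {M : Type*} [TopologicalSpace M]
    [ChartedSpace (EuclideanSpace ℝ (Fin m)) M]
    [RiemannianBundle (fun x : M => TangentSpace (𝓡 m) x)]
    {N : Type*} [MetricSpace N] [ChartedSpace (EuclideanSpace ℝ (Fin n)) N]
    [RiemannianBundle (fun x : N => TangentSpace (𝓡 n) x)] (φ : M → N × ℝ) (p : N) (r : ℝ) :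
    Set ℝ :=
  meanCurvatureNorm m n φ '' cylPreimage φ p r

/-- `φ` has locally bounded mean curvature: `h(p, r) < ∞` for all `p` and `r > 0`. -/
def LocallyBoundedMeanCurvature (m n : ℕ) {M : Type*} [TopologicalSpace M]
    [ChartedSpace (EuclideanSpace ℝ (Fin m)) M]
    [RiemannianBundle (fun x : M => TangentSpace (𝓡 m) x)]
    {N : Type*} [MetricSpace N] [ChartedSpace (EuclideanSpace ℝ (Fin n)) N]
    [RiemannianBundle (fun x : N => TangentSpace (𝓡 n) x)] (φ : M → N × ℝ) : Prop :=
  ∀ (p : N) (r : ℝ), 0 < r → BddAbove (meanCurvatureValues m n φ p r)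

/-- `h(p, r) = sup { |H(x)| ; x ∈ φ(M) ∩ (B_N(p, r) × ℝ) }` (and `0` if there is no such `x`). -/
def meanCurvatureSup (m n : ℕ) {M : Type*} [TopologicalSpace M]
    [ChartedSpace (EuclideanSpace ℝ (Fin m)) M]
    [RiemannianBundle (fun x : M => TangentSpace (𝓡 m) x)]
    {N : Type*} [MetricSpace N] [ChartedSpace (EuclideanSpace ℝ (Fin n)) N]
    [RiemannianBundle (fun x : N => TangentSpace (𝓡 n) x)] (φ : M → N × ℝ) (p : N) (r : ℝ) : ℝ :=
  sSup (meanCurvatureValues m n φ p r)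

end Tone

/-! ### The comparison functions -/

/-- `S_κ`. -/
def compS (κ t : ℝ) : ℝ :=
  if 0 < κ then Real.sin (√κ * t) / √κ
  else if κ = 0 then t
  else Real.sinh (√(-κ) * t) / √(-κ)

/-- `C_κ = S_κ'`. -/
def compC (κ t : ℝ) : ℝ := deriv (compS κ) t

/-- The interval `(0, π/√κ)`, or `(0, ∞)` if `κ ≤ 0`, on which `C_κ / S_κ` is strictly
decreasing. -/
def compDomain (κ : ℝ) : Set ℝ := {t | 0 < t ∧ (0 < κ → t < Real.pi / √κ)}

/-- `(C_κ / S_κ)⁻¹`, with the convention that the value is `∞` at those `s` that lie below all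
values of `C_κ / S_κ`. -/
def compRatioInv (κ s : ℝ) : ℝ≥0∞ :=
  ⨆ (t : ℝ) (_ : t ∈ compDomain κ ∧ s ≤ compC κ t / compS κ t), ENNReal.ofReal t

end CylTone

end

noncomputable section

set_option maxSynthPendingDepth 3
set_option linter.unusedSectionVars false

/-! The estimate is of Barta type. If `U` is smooth on `Ω` with `|grad U| ≤ 1` and `ΔU ≥ c > 0`,
then for a test function `F` the divergence of `F² grad U` integrates to zero, so `c ∫ F² ≤ 2 ∫ |F|
|grad F|`, and completing a square gives `(c/2)² ∫ F² ≤ ∫ |grad F|²`. This is `integral_sq_le`, it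
rests on `green`, and it passes to `H₀¹` in `IsH01.mul_lintegral_le`.

The natural `U` is the distance `ρ` from `x₀` in `N`, composed with `φ` and the projection to `N`.
The Hessian comparison theorem gives `Hess ρ ≥ (C_κ/S_κ)(g - dρ²)`. Tracing it over an orthonormal
basis of a tangent space of `M` loses at most one for the vertical direction `dt` and at most one
for `dρ`, since both restrict to covectors of norm at most one. The second fundamental form
contributes `⟨grad ρ, H⟩ ≥ -|H|`. As `C_κ/S_κ` is nonnegative and decreasing up to `r`, this yields
`ΔU ≥ (m-2)(C_κ/S_κ)(r) - h(x₀, r)`; `drift_pos` shows that either alternative makes this number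
positive.

The distance is not smooth on the axis. It is replaced by `√(ρ² + ε²)`, for which
`IsNormalParam.le_lapM_smoothRadius` gives the lower bound `((m-2) ρ C_κ/S_κ - ρ|H|) / √(ρ² + ε²)`.
The numerator stays positive near `ρ = 0`, so a small `ε` makes the quotient exceed any prescribed
`c' < c` (`exists_smoothing_scale`), and then `c'` tends to `c`.

The geometry is done in coordinates. Christoffel form, Hessian and curvature are shown to be natural
under local isometries; the exponential map supplies normal coordinates; there the Gauss lemma
holds, and Sturm comparison applied to the length of the Jacobi field `t w` gives the Hessian
comparison (`IsNormalMetric.le_hess_sq`). Finally `IsNormalParam.ball_subset_image` shows that the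
metric ball lies in the domain of these coordinates. -/

namespace CylTone

/-! ### Christoffel form and curvature of a metric on an open subset of a vector space. -/

section Calculus

variable {E : Type*} [NormedAddCommGroup E] [NormedSpace ℝ E]
  {V : Type*} [NormedAddCommGroup V] [NormedSpace ℝ V]

/-- `G` is a smooth Riemannian metric on the open set `s` of the vector space `E`. -/
structure IsMetricOn (G : E → E →L[ℝ] E →L[ℝ] ℝ) (s : Set E) : Prop where
  isOpen : IsOpen s
  contDiffOn : ContDiffOn ℝ ∞ G s
  symm : ∀ y ∈ s, ∀ u v, G y u v = G y v u
  pos : ∀ y ∈ s, ∀ u, u ≠ 0 → 0 < G y u u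

/-- The Christoffel form as a field of continuous bilinear maps. -/
def christoffelL (G : E → E →L[ℝ] E →L[ℝ] ℝ) (y : E) : E →L[ℝ] E →L[ℝ] E :=
  (ContinuousLinearMap.compL ℝ E (E →L[ℝ] ℝ) E (G y).inverse) ∘L
    ((1 / 2 : ℝ) • (fderiv ℝ G y + (fderiv ℝ G y).flip
      - ((ContinuousLinearMap.flipₗᵢ ℝ E E ℝ).toContinuousLinearEquiv :
          (E →L[ℝ] E →L[ℝ] ℝ) →L[ℝ] (E →L[ℝ] E →L[ℝ] ℝ)) ∘L (fderiv ℝ G y).flip))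

theorem christoffel_eq (G : E → E →L[ℝ] E →L[ℝ] ℝ) (y u v : E) :
    christoffel G y u v = christoffelL G y u v := by
  simp [christoffel, christoffelL]

/-- `ContinuousLinearMap.inverse` is zero on maps that are not invertible, so `christoffel` has its
intended meaning only through this fact. -/
theorem isInvertible_of_pos [FiniteDimensional ℝ E] (b : E →L[ℝ] E →L[ℝ] ℝ)
    (h : ∀ u, u ≠ 0 → 0 < b u u) : b.IsInvertible := by
  have hinj : Function.Injective b := by
    rw [injective_iff_map_eq_zero]
    intro u hu
    by_contra hne
    have := h u hne
    simp [hu] at this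
  have hfin : Module.finrank ℝ E = Module.finrank ℝ (E →L[ℝ] ℝ) := by
    rw [← LinearEquiv.finrank_eq (LinearMap.toContinuousLinearMap (𝕜 := ℝ) (E := E) (F' := ℝ))]
    exact (Subspace.dual_finrank_eq (K := ℝ) (V := E)).symm
  exact ⟨(LinearEquiv.ofInjectiveOfFinrankEq (b : E →ₗ[ℝ] (E →L[ℝ] ℝ)) hinj
    hfin).toContinuousLinearEquiv, by ext; rfl⟩

/-- The covariant Hessian of a function with respect to the metric `G`. -/
def hess (G : E → E →L[ℝ] E →L[ℝ] ℝ) (f : E → ℝ) (y u v : E) : ℝ :=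
  fderiv ℝ (fderiv ℝ f) y u v - fderiv ℝ f y (christoffel G y u v)

namespace IsMetricOn

variable {G : E → E →L[ℝ] E →L[ℝ] ℝ} {s : Set E} (hG : IsMetricOn G s)
include hG

theorem mono {t : Set E} (ht : IsOpen t) (hts : t ⊆ s) : IsMetricOn G t :=
  ⟨ht, hG.contDiffOn.mono hts, fun y hy => hG.symm y (hts hy), fun y hy => hG.pos y (hts hy)⟩

theorem mem_nhds {y : E} (hy : y ∈ s) : s ∈ 𝓝 y := hG.isOpen.mem_nhds hy

theorem contDiffAt {y : E} (hy : y ∈ s) : ContDiffAt ℝ ∞ G y :=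
  hG.contDiffOn.contDiffAt (hG.mem_nhds hy)

theorem differentiableAt {y : E} (hy : y ∈ s) : DifferentiableAt ℝ G y :=
  (hG.contDiffAt hy).differentiableAt (by simp)

theorem fderiv_symm {y : E} (hy : y ∈ s) (a u v : E) :
    fderiv ℝ G y a u v = fderiv ℝ G y a v u := by
  have h1 := ((hG.differentiableAt hy).hasFDerivAt.clm_apply (hasFDerivAt_const u y)).clm_apply
    (hasFDerivAt_const v y)
  have h2 := ((hG.differentiableAt hy).hasFDerivAt.clm_apply (hasFDerivAt_const v y)).clm_apply
    (hasFDerivAt_const u y)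
  have h3 : (fun z => G z u v) =ᶠ[𝓝 y] fun z => G z v u := by
    filter_upwards [hG.mem_nhds hy] with z hz using hG.symm z hz u v
  have := (h1.congr_of_eventuallyEq h3.symm).unique h2
  simpa using DFunLike.congr_fun this a

/-- Vector identities below are proved by pairing both sides with an arbitrary `w`, where the Koszul
formula `christoffel_spec` applies. -/
theorem ext_left {y : E} (hy : y ∈ s) {a b : E} (h : ∀ w, G y a w = G y b w) : a = b := by
  have : G y (a - b) (a - b) = 0 := by simp [h]
  by_contra hne
  exact (hG.pos y hy _ (sub_ne_zero.2 hne)).ne' this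

variable [FiniteDimensional ℝ E]

theorem isInvertible {y : E} (hy : y ∈ s) : (G y).IsInvertible :=
  isInvertible_of_pos _ (hG.pos y hy)

theorem apply_inverse {y : E} (hy : y ∈ s) (l : E →L[ℝ] ℝ) : G y ((G y).inverse l) = l :=
  (hG.isInvertible hy).self_apply_inverse l

theorem christoffel_spec {y : E} (hy : y ∈ s) (u v w : E) :
    G y (christoffel G y u v) w =
      (1 / 2 : ℝ) * (fderiv ℝ G y u v w + fderiv ℝ G y v u w - fderiv ℝ G y w u v) := by
  rw [christoffel, hG.apply_inverse hy]
  simp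

theorem christoffel_symm {y : E} (hy : y ∈ s) (u v : E) :
    christoffel G y u v = christoffel G y v u := by
  refine hG.ext_left hy fun w => ?_
  rw [hG.christoffel_spec hy, hG.christoffel_spec hy, hG.fderiv_symm hy w u v]
  ring

/-- Compatibility of the Christoffel form with the metric. -/
theorem fderiv_apply {y : E} (hy : y ∈ s) (a u v : E) :
    fderiv ℝ G y a u v = G y (christoffel G y a u) v + G y u (christoffel G y a v) := by
  rw [hG.symm y hy u, hG.christoffel_spec hy, hG.christoffel_spec hy, hG.fderiv_symm hy a v u,
    hG.fderiv_symm hy v a u, hG.fderiv_symm hy u a v]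
  ring

theorem contDiffOn_inverse : ContDiffOn ℝ ∞ (fun y => (G y).inverse) s := fun y hy =>
  ((hG.isInvertible hy).contDiffAt_map_inverse.comp y (hG.contDiffAt hy)).contDiffWithinAt

set_option synthInstance.maxHeartbeats 200000 in
theorem contDiffOn_christoffelL : ContDiffOn ℝ ∞ (christoffelL G) s := by
  have h0 := hG.contDiffOn.fderiv_of_isOpen hG.isOpen (m := ∞) (by simp)
  have h1 : ContDiffOn ℝ ∞ (fun y => (fderiv ℝ G y).flip) s :=
    (ContinuousLinearMap.flipₗᵢ ℝ E E (E →L[ℝ] ℝ)).contDiff.comp_contDiffOn h0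
  unfold christoffelL
  refine ContDiffOn.clm_comp ?_ ?_
  · exact (ContinuousLinearMap.compL ℝ E (E →L[ℝ] ℝ) E).contDiff.comp_contDiffOn
      hG.contDiffOn_inverse
  · exact (((h0.add h1).sub (contDiffOn_const.clm_comp h1))).const_smul _

theorem differentiableAt_christoffelL {y : E} (hy : y ∈ s) :
    DifferentiableAt ℝ (christoffelL G) y :=
  (hG.contDiffOn_christoffelL.contDiffAt (hG.mem_nhds hy)).differentiableAt (by simp)

theorem fderiv_christoffel {y : E} (hy : y ∈ s) (a u v : E) :
    fderiv ℝ (fun z => christoffel G z u v) y a = fderiv ℝ (christoffelL G) y a u v := by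
  simp only [christoffel_eq]
  have := ((hG.differentiableAt_christoffelL hy).hasFDerivAt.clm_apply
    (hasFDerivAt_const u y)).clm_apply (hasFDerivAt_const v y)
  rw [this.fderiv]
  simp

theorem curvatureForm_eq {y : E} (hy : y ∈ s) (u v w : E) :
    curvatureForm G y u v w = fderiv ℝ (christoffelL G) y u v w
      - fderiv ℝ (christoffelL G) y v u w
      + christoffelL G y u (christoffelL G y v w) - christoffelL G y v (christoffelL G y u w) := by
  rw [curvatureForm, hG.fderiv_christoffel hy, hG.fderiv_christoffel hy]
  simp only [christoffel_eq]

/-- The endomorphism `R(a, b)` is skew-symmetric. -/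
theorem curvatureForm_apply_self {y : E} (hy : y ∈ s) (a b w : E) :
    G y (curvatureForm G y a b w) w = 0 := by
  -- Differentiating `G(Γ(b, w), w) = ½ D_b G(w, w)` in the direction `a`. The right-hand side is
  -- symmetric in `a` and `b`, so it disappears on antisymmetrizing.
  have key : ∀ a b : E, G y (fderiv ℝ (christoffelL G) y a b w) w
      + G y (christoffelL G y a (christoffelL G y b w)) w
      = (1 / 2 : ℝ) * fderiv ℝ (fderiv ℝ G) y a b w w
        - G y (christoffelL G y b w) (christoffelL G y a w) := by
    intro a b
    have h1 : HasFDerivAt (fun z => G z (christoffelL G z b w) w) _ y :=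
      ((hG.differentiableAt hy).hasFDerivAt.clm_apply
        (((hG.differentiableAt_christoffelL hy).hasFDerivAt.clm_apply
          (hasFDerivAt_const b y)).clm_apply (hasFDerivAt_const w y))).clm_apply
        (hasFDerivAt_const w y)
    have hd : DifferentiableAt ℝ (fderiv ℝ G) y :=
      ((hG.contDiffAt hy).fderiv_right (m := ∞) (by simp)).differentiableAt (by simp)
    have h2 : HasFDerivAt (fun z => (1 / 2 : ℝ) * fderiv ℝ G z b w w) _ y :=
      (((hd.hasFDerivAt.clm_apply (hasFDerivAt_const b y)).clm_apply
        (hasFDerivAt_const w y)).clm_apply (hasFDerivAt_const w y)).const_mul (1 / 2 : ℝ)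
    have h3 : (fun z => G z (christoffelL G z b w) w) =ᶠ[𝓝 y]
        fun z => (1 / 2 : ℝ) * fderiv ℝ G z b w w := by
      filter_upwards [hG.mem_nhds hy] with z hz
      rw [hG.fderiv_apply hz b w w, hG.symm z hz w, christoffel_eq]
      ring
    have h4 := DFunLike.congr_fun ((h1.congr_of_eventuallyEq h3.symm).unique h2) a
    simp at h4
    have h5 := hG.fderiv_apply hy a (christoffelL G y b w) w
    simp only [christoffel_eq] at h5
    linarith
  have hsym : fderiv ℝ (fderiv ℝ G) y a b = fderiv ℝ (fderiv ℝ G) y b a :=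
    ((hG.contDiffAt hy).isSymmSndFDerivAt (by simpa using ENat.LEInfty.out)).eq a b
  have k1 := key a b
  have k2 := key b a
  rw [hG.symm y hy (christoffelL G y a w), ← hsym] at k2
  rw [hG.curvatureForm_eq hy]
  simp only [map_add, map_sub, add_apply, sub_apply]
  linarith

/-- Polarization of the skew-symmetry of `R(a, b)` at `a + b`, together with the antisymmetry in
`a`, `b` that is visible in the formula. The Bianchi identity is not needed. -/
theorem curvatureForm_swap {y : E} (hy : y ∈ s) (a b : E) :
    G y (curvatureForm G y a b b) a = G y (curvatureForm G y b a a) b := by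
  have h1 := hG.curvatureForm_apply_self hy a b (a + b)
  have h2 := hG.curvatureForm_apply_self hy a b a
  have h3 := hG.curvatureForm_apply_self hy a b b
  rw [hG.curvatureForm_eq hy] at h1 h2 h3
  rw [hG.curvatureForm_eq hy, hG.curvatureForm_eq hy]
  simp only [map_add, map_sub, add_apply, sub_apply] at h1 h2 h3 ⊢
  linarith

end IsMetricOn

/-! ### Naturality of Christoffel form, Hessian and curvature under isometric maps. -/

section Pullback

variable {G : E → E →L[ℝ] E →L[ℝ] ℝ} {s : Set E} {K : V → V →L[ℝ] V →L[ℝ] ℝ} {t : Set V}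
  {Φ : V → E}

/-- `Φ` is a smooth map which pulls the metric `G` back to the metric `K`. -/
structure IsMetricMap (K : V → V →L[ℝ] V →L[ℝ] ℝ) (t : Set V) (G : E → E →L[ℝ] E →L[ℝ] ℝ)
    (s : Set E) (Φ : V → E) : Prop where
  metric_source : IsMetricOn K t
  metric_target : IsMetricOn G s
  contDiffOn : ContDiffOn ℝ ∞ Φ t
  mapsTo : MapsTo Φ t s
  eq : ∀ y ∈ t, ∀ u v, K y u v = G (Φ y) (fderiv ℝ Φ y u) (fderiv ℝ Φ y v)

namespace IsMetricMap

variable (h : IsMetricMap K t G s Φ)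
include h

theorem contDiffAt {y : V} (hy : y ∈ t) : ContDiffAt ℝ ∞ Φ y :=
  h.contDiffOn.contDiffAt (h.metric_source.mem_nhds hy)

theorem differentiableAt {y : V} (hy : y ∈ t) : DifferentiableAt ℝ Φ y :=
  (h.contDiffAt hy).differentiableAt (by simp)

theorem differentiableAt_fderiv {y : V} (hy : y ∈ t) : DifferentiableAt ℝ (fderiv ℝ Φ) y :=
  ((h.contDiffAt hy).fderiv_right (m := ∞) (by simp)).differentiableAt (by simp)

theorem fderiv_fderiv_symm {y : V} (hy : y ∈ t) (u v : V) :
    fderiv ℝ (fderiv ℝ Φ) y u v = fderiv ℝ (fderiv ℝ Φ) y v u :=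
  ((h.contDiffAt hy).isSymmSndFDerivAt (by simpa using ENat.LEInfty.out)).eq u v

theorem fderiv_metric {y : V} (hy : y ∈ t) (a u v : V) :
    fderiv ℝ K y a u v = fderiv ℝ G (Φ y) (fderiv ℝ Φ y a) (fderiv ℝ Φ y u) (fderiv ℝ Φ y v)
      + G (Φ y) (fderiv ℝ (fderiv ℝ Φ) y a u) (fderiv ℝ Φ y v)
      + G (Φ y) (fderiv ℝ Φ y u) (fderiv ℝ (fderiv ℝ Φ) y a v) := by
  have hK := ((h.metric_source.differentiableAt hy).hasFDerivAt.clm_apply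
    (hasFDerivAt_const u y)).clm_apply (hasFDerivAt_const v y)
  have hD := (h.differentiableAt_fderiv hy).hasFDerivAt
  have hGΦ : HasFDerivAt (fun z => G (Φ z)) _ y :=
    (h.metric_target.differentiableAt (h.mapsTo hy)).hasFDerivAt.comp y
      (h.differentiableAt hy).hasFDerivAt
  have hR := (hGΦ.clm_apply (hD.clm_apply (hasFDerivAt_const u y))).clm_apply
    (hD.clm_apply (hasFDerivAt_const v y))
  have he : (fun z => K z u v) =ᶠ[𝓝 y]
      fun z => G (Φ z) (fderiv ℝ Φ z u) (fderiv ℝ Φ z v) := by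
    filter_upwards [h.metric_source.mem_nhds hy] with z hz using h.eq z hz u v
  have := DFunLike.congr_fun ((hK.congr_of_eventuallyEq he.symm).unique hR) a
  simp at this
  linarith

variable [FiniteDimensional ℝ E] [FiniteDimensional ℝ V]

/-- The second fundamental form of an isometric immersion is normal. -/
theorem christoffel_normal {y : V} (hy : y ∈ t) (u v w : V) :
    G (Φ y) (fderiv ℝ (fderiv ℝ Φ) y u v
      + christoffel G (Φ y) (fderiv ℝ Φ y u) (fderiv ℝ Φ y v)
      - fderiv ℝ Φ y (christoffel K y u v)) (fderiv ℝ Φ y w) = 0 := by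
  have hs := h.mapsTo hy
  have hg := h.metric_target
  simp only [map_add, map_sub, add_apply, sub_apply]
  rw [← h.eq y hy, h.metric_source.christoffel_spec hy, hg.christoffel_spec hs,
    h.fderiv_metric hy, h.fderiv_metric hy, h.fderiv_metric hy,
    h.fderiv_fderiv_symm hy v u, h.fderiv_fderiv_symm hy w u, h.fderiv_fderiv_symm hy w v,
    hg.symm _ hs (fderiv ℝ Φ y u), hg.symm _ hs (fderiv ℝ Φ y v)]
  rw [hg.symm _ hs (fderiv ℝ (fderiv ℝ Φ) y u w)]
  ring

variable (hsurj : ∀ y ∈ t, Function.Surjective (fderiv ℝ Φ y))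
include hsurj

/-- Transformation law of the Christoffel form under a local isometry. -/
theorem map_christoffel {y : V} (hy : y ∈ t) (u v : V) :
    fderiv ℝ Φ y (christoffel K y u v) = fderiv ℝ (fderiv ℝ Φ) y u v
      + christoffel G (Φ y) (fderiv ℝ Φ y u) (fderiv ℝ Φ y v) := by
  symm
  refine h.metric_target.ext_left (h.mapsTo hy) fun w => ?_
  obtain ⟨w, rfl⟩ := hsurj y hy w
  -- A surjective differential leaves no normal direction, so the second fundamental form vanishes.
  have := h.christoffel_normal hy u v w
  simp only [map_sub, sub_apply] at this
  linarith

/-- The chain rule produces a term in the second derivative of `Φ`, which is exactly what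
`map_christoffel` absorbs. -/
theorem hess_comp {y : V} (hy : y ∈ t) {f : E → ℝ} (hf : ContDiffAt ℝ ∞ f (Φ y)) (u v : V) :
    hess K (fun z => f (Φ z)) y u v = hess G f (Φ y) (fderiv ℝ Φ y u) (fderiv ℝ Φ y v) := by
  have h1 : ∀ᶠ z in 𝓝 y, fderiv ℝ (fun z => f (Φ z)) z = (fderiv ℝ f (Φ z)).comp (fderiv ℝ Φ z) := by
    have : ∀ᶠ x in 𝓝 (Φ y), ContDiffAt ℝ 2 f x :=
      (hf.of_le ENat.LEInfty.out).eventually (by simp)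
    filter_upwards [h.metric_source.mem_nhds hy,
      (h.differentiableAt hy).continuousAt.eventually this] with z hz hfz
    exact fderiv_comp z (hfz.differentiableAt (by simp)) (h.differentiableAt hz)
  have hdf : HasFDerivAt (fun z => fderiv ℝ f (Φ z)) _ y :=
    ((hf.fderiv_right (m := ∞) (by simp)).differentiableAt (by simp)).hasFDerivAt.comp y
      (h.differentiableAt hy).hasFDerivAt
  have h2 := (hdf.clm_comp (h.differentiableAt_fderiv hy).hasFDerivAt).congr_of_eventuallyEq h1
  rw [hess, hess, h2.fderiv, h1.self_of_nhds]
  simp [h.map_christoffel hsurj hy]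

/-- Transformation law of the curvature under a local isometry. -/
theorem map_curvatureForm {y : V} (hy : y ∈ t) (u v w : V) :
    fderiv ℝ Φ y (curvatureForm K y u v w) = curvatureForm G (Φ y) (fderiv ℝ Φ y u)
      (fderiv ℝ Φ y v) (fderiv ℝ Φ y w) := by
  have hs := h.mapsTo hy
  have hD := (h.differentiableAt_fderiv hy).hasFDerivAt
  have hC : ContDiffAt ℝ ∞ (fun z => fderiv ℝ Φ z w) y :=
    ((h.contDiffAt hy).fderiv_right (m := ∞) (by simp)).clm_apply contDiffAt_const
  have hC' : DifferentiableAt ℝ (fderiv ℝ (fun z => fderiv ℝ Φ z w)) y :=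
    (hC.fderiv_right (m := ∞) (by simp)).differentiableAt (by simp)
  have hw : ∀ v, ∀ z ∈ t, fderiv ℝ (fun z => fderiv ℝ Φ z w) z v = fderiv ℝ (fderiv ℝ Φ) z v w := by
    intro v z hz
    rw [((h.differentiableAt_fderiv hz).hasFDerivAt.clm_apply (hasFDerivAt_const w z)).fderiv]
    simp
  -- The derivative in the direction `u` of the transformation law for `Γ(v, w)`. The third
  -- derivatives of `Φ`, written as second derivatives of `z ↦ DΦ z w`, are symmetric in `u` and `v`
  -- and cancel in the curvature.
  have key : ∀ u v : V, fderiv ℝ Φ y (fderiv ℝ (christoffelL K) y u v w)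
      + fderiv ℝ (fderiv ℝ Φ) y u (christoffelL K y v w)
      = fderiv ℝ (fderiv ℝ (fun z => fderiv ℝ Φ z w)) y u v
        + fderiv ℝ (christoffelL G) (Φ y) (fderiv ℝ Φ y u) (fderiv ℝ Φ y v) (fderiv ℝ Φ y w)
        + christoffelL G (Φ y) (fderiv ℝ (fderiv ℝ Φ) y u v) (fderiv ℝ Φ y w)
        + christoffelL G (Φ y) (fderiv ℝ Φ y v) (fderiv ℝ (fderiv ℝ Φ) y u w) := by
    intro u v
    have hL := hD.clm_apply (((h.metric_source.differentiableAt_christoffelL hy).hasFDerivAt.clm_apply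
      (hasFDerivAt_const v y)).clm_apply (hasFDerivAt_const w y))
    have hΓΦ : HasFDerivAt (fun z => christoffelL G (Φ z)) _ y :=
      (h.metric_target.differentiableAt_christoffelL hs).hasFDerivAt.comp y
        (h.differentiableAt hy).hasFDerivAt
    have hR := (hC'.hasFDerivAt.clm_apply (hasFDerivAt_const v y)).add
      ((hΓΦ.clm_apply (hD.clm_apply (hasFDerivAt_const v y))).clm_apply
        (hD.clm_apply (hasFDerivAt_const w y)))
    have he : (fun z => fderiv ℝ Φ z (christoffelL K z v w)) =ᶠ[𝓝 y]
        (fun z => fderiv ℝ (fun z => fderiv ℝ Φ z w) z v) + fun z =>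
          christoffelL G (Φ z) (fderiv ℝ Φ z v) (fderiv ℝ Φ z w) := by
      filter_upwards [h.metric_source.mem_nhds hy] with z hz
      have := h.map_christoffel hsurj hz v w
      simp only [christoffel_eq] at this
      simp [this, hw v z hz]
    have h4 := DFunLike.congr_fun ((hL.congr_of_eventuallyEq he.symm).unique hR) u
    simp at h4
    rw [h4]
    abel
  have hsym : fderiv ℝ (fderiv ℝ (fun z => fderiv ℝ Φ z w)) y u v =
      fderiv ℝ (fderiv ℝ (fun z => fderiv ℝ Φ z w)) y v u :=
    (hC.isSymmSndFDerivAt (by simpa using ENat.LEInfty.out)).eq u v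
  have k1 := key u v
  have k2 := key v u
  have hΓ : ∀ a b : V, fderiv ℝ Φ y (christoffelL K y a b) = fderiv ℝ (fderiv ℝ Φ) y a b
      + christoffelL G (Φ y) (fderiv ℝ Φ y a) (fderiv ℝ Φ y b) := by
    intro a b
    have := h.map_christoffel hsurj hy a b
    simpa only [christoffel_eq] using this
  rw [h.metric_source.curvatureForm_eq hy, h.metric_target.curvatureForm_eq hs]
  simp only [map_add, map_sub, hΓ]
  rw [← hsym, h.fderiv_fderiv_symm hy v u] at k2
  rw [eq_sub_of_add_eq k1, eq_sub_of_add_eq k2]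
  abel

end IsMetricMap

end Pullback

end Calculus

/-! ### The functions `S_κ`, `C_κ` and Sturm comparison. -/

section Comparison

theorem hasDerivAt_compS (κ t : ℝ) : HasDerivAt (compS κ) (compC κ t) t := by
  have : DifferentiableAt ℝ (compS κ) t := by
    unfold compS
    split_ifs <;> fun_prop
  exact this.hasDerivAt

theorem compC_eq (κ t : ℝ) : compC κ t =
    if 0 < κ then Real.cos (√κ * t) else if κ = 0 then 1 else Real.cosh (√(-κ) * t) := by
  unfold compC compS
  have hlin : ∀ c : ℝ, HasDerivAt (fun t : ℝ => c * t) c t := fun c => by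
    simpa using (hasDerivAt_id t).const_mul c
  split_ifs with h1 h2
  · have hs : √κ ≠ 0 := (Real.sqrt_pos.2 h1).ne'
    have := ((hlin √κ).sin).div_const √κ
    rw [this.deriv]
    field_simp
  · exact (hasDerivAt_id t).deriv
  · have hs : √(-κ) ≠ 0 := (Real.sqrt_pos.2 (by
      have := lt_of_le_of_ne (not_lt.1 h1) h2; linarith)).ne'
    have := ((hlin √(-κ)).sinh).div_const √(-κ)
    rw [this.deriv]
    field_simp

theorem hasDerivAt_compC (κ t : ℝ) : HasDerivAt (compC κ) (-κ * compS κ t) t := by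
  have hfun : compC κ = fun t => if 0 < κ then Real.cos (√κ * t) else if κ = 0 then 1 else
      Real.cosh (√(-κ) * t) := funext (compC_eq κ)
  have hlin : ∀ c : ℝ, HasDerivAt (fun t : ℝ => c * t) c t := fun c => by
    simpa using (hasDerivAt_id t).const_mul c
  rw [hfun]
  unfold compS
  split_ifs with h1 h2
  · have hs : √κ ≠ 0 := (Real.sqrt_pos.2 h1).ne'
    refine (hlin √κ).cos.congr_deriv ?_
    have := Real.mul_self_sqrt h1.le
    field_simp
    linear_combination (-Real.sin (√κ * t)) * this
  · simpa [h2] using hasDerivAt_const t (1 : ℝ)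
  · have hneg : 0 < -κ := by
      have := lt_of_le_of_ne (not_lt.1 h1) h2; linarith
    have hs : √(-κ) ≠ 0 := (Real.sqrt_pos.2 hneg).ne'
    refine (hlin √(-κ)).cosh.congr_deriv ?_
    have := Real.mul_self_sqrt hneg.le
    field_simp
    linear_combination (Real.sinh (√(-κ) * t)) * this

@[simp] theorem compS_zero (κ : ℝ) : compS κ 0 = 0 := by
  unfold compS; split_ifs <;> simp

@[simp] theorem compC_zero (κ : ℝ) : compC κ 0 = 1 := by
  rw [compC_eq]; split_ifs <;> simp

theorem compS_pos {κ t : ℝ} (ht : t ∈ compDomain κ) : 0 < compS κ t := by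
  obtain ⟨h0, hπ⟩ := ht
  unfold compS
  split_ifs with h1 h2
  · have hs : 0 < √κ := Real.sqrt_pos.2 h1
    refine div_pos (Real.sin_pos_of_pos_of_lt_pi (by positivity) ?_) hs
    have := hπ h1
    rwa [lt_div_iff₀ hs, mul_comm] at this
  · exact h0
  · have hneg : 0 < -κ := by
      have := lt_of_le_of_ne (not_lt.1 h1) h2; linarith
    have hs : 0 < √(-κ) := Real.sqrt_pos.2 hneg
    exact div_pos (Real.sinh_pos_iff.2 (by positivity)) hs

theorem compC_nonneg {κ t : ℝ} (h0 : 0 ≤ t) (hπ : 0 < κ → t ≤ Real.pi / (2 * √κ)) :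
    0 ≤ compC κ t := by
  rw [compC_eq]
  split_ifs with h1 h2
  · have hs : 0 < √κ := Real.sqrt_pos.2 h1
    have := hπ h1
    rw [le_div_iff₀ (by positivity)] at this
    have h3 : 0 ≤ √κ * t := by positivity
    exact Real.cos_nonneg_of_neg_pi_div_two_le_of_le (by linarith [Real.pi_pos]) (by linarith)
  · exact zero_le_one
  · exact (Real.cosh_pos _).le

/-- The left-hand side is a first integral of `S'' = -κ S`. It turns the derivative of `C_κ/S_κ`
into `-1/S_κ²`, whence the strict monotonicity. -/
theorem compC_sq_add (κ t : ℝ) : compC κ t ^ 2 + κ * compS κ t ^ 2 = 1 := by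
  have h : ∀ x, HasDerivAt (fun t => compC κ t ^ 2 + κ * compS κ t ^ 2) 0 x := by
    intro x
    refine (((hasDerivAt_compC κ x).fun_pow 2).fun_add
      (((hasDerivAt_compS κ x).fun_pow 2).const_mul κ)).congr_deriv ?_
    simp; ring
  have := is_const_of_deriv_eq_zero (fun x => (h x).differentiableAt) (fun x => (h x).deriv) t 0
  simpa using this

theorem mem_compDomain_of_le {κ s t : ℝ} (hs : 0 < s) (hst : s ≤ t) (ht : t ∈ compDomain κ) :
    s ∈ compDomain κ := ⟨hs, fun h => hst.trans_lt (ht.2 h)⟩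

theorem hasDerivAt_compRatio {κ t : ℝ} (ht : t ∈ compDomain κ) :
    HasDerivAt (fun t => compC κ t / compS κ t) (-1 / compS κ t ^ 2) t := by
  refine ((hasDerivAt_compC κ t).fun_div (hasDerivAt_compS κ t) (compS_pos ht).ne').congr_deriv ?_
  rw [← compC_sq_add κ t]
  ring

theorem compRatio_lt {κ s t : ℝ} (hs : 0 < s) (hst : s < t) (ht : t ∈ compDomain κ) :
    compC κ t / compS κ t < compC κ s / compS κ s := by
  have hmem : ∀ x ∈ Icc s t, x ∈ compDomain κ := fun x hx =>
    mem_compDomain_of_le (hs.trans_le hx.1) hx.2 ht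
  refine strictAntiOn_of_deriv_neg (f := fun t => compC κ t / compS κ t) (convex_Icc s t) ?_ ?_ (left_mem_Icc.2 hst.le)
    (right_mem_Icc.2 hst.le) hst
  · exact fun x hx => (hasDerivAt_compRatio (hmem x hx)).continuousAt.continuousWithinAt
  · intro x hx
    rw [interior_Icc] at hx
    have hx' := hmem x (Ioo_subset_Icc_self hx)
    rw [(hasDerivAt_compRatio hx').deriv]
    have := compS_pos hx'
    exact div_neg_of_neg_of_pos (by norm_num) (by positivity)

/-- One-dimensional Sturm comparison. -/
theorem sturm_comparison {κ ρ : ℝ} {f f' f'' : ℝ → ℝ} (hρ : 0 < ρ) (hdom : ρ ∈ compDomain κ)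
    (h0 : f 0 = 0) (hf : ∀ t ∈ Icc 0 ρ, HasDerivAt f (f' t) t)
    (hf' : ∀ t ∈ Icc 0 ρ, HasDerivAt f' (f'' t) t)
    (h : ∀ t ∈ Ioo 0 ρ, -κ * f t ≤ f'' t) : f ρ * compC κ ρ ≤ f' ρ * compS κ ρ := by
  -- The Wronskian of `f` and `S_κ` vanishes at `0` and has nonnegative derivative wherever `f'' ≥
  -- -κ f`.
  have hd : ∀ t ∈ Icc 0 ρ, HasDerivAt (fun t => f' t * compS κ t - f t * compC κ t)
      ((f'' t + κ * f t) * compS κ t) t := by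
    intro t ht
    refine (((hf' t ht).fun_mul (hasDerivAt_compS κ t)).fun_sub
      ((hf t ht).fun_mul (hasDerivAt_compC κ t))).congr_deriv ?_
    ring
  have hm := monotoneOn_of_deriv_nonneg (convex_Icc 0 ρ)
    (fun t ht => (hd t ht).continuousAt.continuousWithinAt)
    (fun t ht => (hd t (interior_subset ht)).differentiableAt.differentiableWithinAt)
    (fun t ht => by
      rw [interior_Icc] at ht
      rw [(hd t (Ioo_subset_Icc_self ht)).deriv]
      have := compS_pos (mem_compDomain_of_le ht.1 ht.2.le hdom)
      have := h t ht
      exact mul_nonneg (by linarith) (by linarith)) (left_mem_Icc.2 hρ.le)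
    (right_mem_Icc.2 hρ.le) hρ.le
  simp [h0] at hm
  exact hm

end Comparison

/-! ### Gauss lemma and Hessian comparison in normal coordinates. -/

section NormalCoordinates

variable {V : Type*} [NormedAddCommGroup V] [InnerProductSpace ℝ V] [FiniteDimensional ℝ V]

open scoped RealInnerProductSpace

/-- `K` is a metric on the ball of radius `r`, written in normal coordinates: the rays from the
origin are geodesics. -/
structure IsNormalMetric (K : V → V →L[ℝ] V →L[ℝ] ℝ) (r : ℝ) : Prop where
  isMetricOn : IsMetricOn K (Metric.ball 0 r)
  inner_zero : ∀ u v, K 0 u v = ⟪u, v⟫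
  ray : ∀ y ∈ Metric.ball (0 : V) r, christoffel K y y y = 0

namespace IsNormalMetric

variable {K : V → V →L[ℝ] V →L[ℝ] ℝ} {r : ℝ} (h : IsNormalMetric K r)
include h

theorem smul_mem {y : V} (hy : y ∈ Metric.ball (0 : V) r) {t : ℝ} (ht : t ∈ Icc (0 : ℝ) 1) :
    t • y ∈ Metric.ball (0 : V) r := by
  rw [mem_ball_zero_iff] at *
  rw [norm_smul, Real.norm_of_nonneg ht.1]
  nlinarith [norm_nonneg y, ht.2]

/-- For `t ≠ 0` the ray condition at `t • v` reads `t² Γ(v, v) = 0`; the value at `t = 0` follows by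
continuity. -/
theorem christoffel_smul {v : V} {t : ℝ} (ht : t • v ∈ Metric.ball (0 : V) r) :
    christoffelL K (t • v) v v = 0 := by
  have hne : ∀ t : ℝ, t ≠ 0 → t • v ∈ Metric.ball (0 : V) r → christoffelL K (t • v) v v = 0 := by
    intro t h0 ht
    have := h.ray _ ht
    rw [christoffel_eq] at this
    simpa [h0] using this
  by_cases h0 : t = 0
  · subst h0
    have hc : ContinuousAt (fun t : ℝ => christoffelL K (t • v) v v) 0 := by
      have h1 : ContinuousAt (fun t : ℝ => t • v) 0 := by fun_prop
      have h2 : ContinuousAt (christoffelL K) ((0 : ℝ) • v) :=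
        (h.isMetricOn.differentiableAt_christoffelL ht).continuousAt
      exact ((h2.comp_of_eq h1 rfl).clm_apply continuousAt_const).clm_apply continuousAt_const
    have hmem : ∀ᶠ t : ℝ in 𝓝 0, t • v ∈ Metric.ball (0 : V) r := by
      have h1 : ContinuousAt (fun t : ℝ => t • v) 0 := by fun_prop
      exact h1.eventually (Metric.isOpen_ball.mem_nhds ht)
    have hl : Tendsto (fun t : ℝ => christoffelL K (t • v) v v) (𝓝[≠] 0) (𝓝 0) := by
      refine tendsto_const_nhds.congr' ?_
      filter_upwards [self_mem_nhdsWithin, hmem.filter_mono nhdsWithin_le_nhds] with t h1 h2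
      exact (hne t h1 h2).symm
    exact tendsto_nhds_unique (hc.tendsto.mono_left nhdsWithin_le_nhds) hl
  · exact hne t h0 ht

theorem hasDerivAt_metric {v : V} {t : ℝ} (ht : t • v ∈ Metric.ball (0 : V) r) (a b : V) :
    HasDerivAt (fun t : ℝ => K (t • v) a b) (fderiv ℝ K (t • v) v a b) t := by
  have h1 : HasDerivAt (fun t : ℝ => t • v) v t := by simpa using (hasDerivAt_id t).smul_const v
  have h2 : HasDerivAt (fun t : ℝ => K (t • v)) (fderiv ℝ K (t • v) v) t :=
    (h.isMetricOn.differentiableAt ht).hasFDerivAt.comp_hasDerivAt t h1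
  simpa using (h2.clm_apply (hasDerivAt_const t a)).clm_apply (hasDerivAt_const t b)

/-- Along the ray, `K(y, y)` has derivative `2 K(Γ(y, y), y) = 0`, and at the origin it is the inner
product. -/
theorem apply_self {y : V} (hy : y ∈ Metric.ball (0 : V) r) : K y y y = ⟪y, y⟫ := by
  have := constant_of_has_deriv_right_zero (f := fun t : ℝ => K (t • y) y y) (a := 0) (b := 1)
    (fun t ht => (h.hasDerivAt_metric (h.smul_mem hy ht) y y).continuousAt.continuousWithinAt)
    (fun t ht => by
      have hm := h.smul_mem hy (Ico_subset_Icc_self ht)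
      convert (h.hasDerivAt_metric hm y y).hasDerivWithinAt using 1
      have h1 := h.christoffel_smul hm
      rw [h.isMetricOn.fderiv_apply hm, christoffel_eq, h1]
      simp) 1 (by simp)
  simpa [h.inner_zero] using this

/-- Compares the derivative of `K_z(z, z) = ⟨z, z⟩` in the direction `w` with the Koszul formula for
`Γ(y, y) = 0`. The result is a linear equation along rays for `K(y, w)`, which the Gauss lemma
integrates. -/
theorem fderiv_radial {y : V} (hy : y ∈ Metric.ball (0 : V) r) (w : V) :
    fderiv ℝ K y y y w = ⟪y, w⟫ - K y y w := by
  have hm := h.isMetricOn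
  have h1 : HasFDerivAt (fun z => K z z z) _ y :=
    ((hm.differentiableAt hy).hasFDerivAt.clm_apply (hasFDerivAt_id y)).clm_apply (hasFDerivAt_id y)
  have h2 : HasFDerivAt (fun z : V => ⟪z, z⟫) _ y := (hasFDerivAt_id y).inner ℝ (hasFDerivAt_id y)
  have h3 : (fun z => K z z z) =ᶠ[𝓝 y] fun z => ⟪z, z⟫ := by
    filter_upwards [hm.mem_nhds hy] with z hz using h.apply_self hz
  have h4 := DFunLike.congr_fun ((h1.congr_of_eventuallyEq h3.symm).unique h2) w
  simp at h4
  have h5 := hm.christoffel_spec hy y y w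
  rw [h.ray y hy] at h5
  simp at h5
  rw [hm.symm y hy w y, real_inner_comm y w] at h4
  linarith

/-- The Gauss lemma. -/
theorem gauss {y : V} (hy : y ∈ Metric.ball (0 : V) r) (w : V) : K y y w = ⟪y, w⟫ := by
  -- The factor `t` is the integrating factor of the equation in `fderiv_radial`; it also makes the
  -- constant vanish at the origin.
  have hd : ∀ t ∈ Icc (0 : ℝ) 1, HasDerivAt (fun t : ℝ => t * (K (t • y) y w - ⟪y, w⟫)) 0 t := by
    intro t ht
    have hm := h.smul_mem hy ht
    refine ((hasDerivAt_id' t).fun_mul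
      ((h.hasDerivAt_metric hm y w).sub_const ⟪y, w⟫)).congr_deriv ?_
    by_cases h0 : t = 0
    · subst h0
      simp [h.inner_zero]
    · have := h.fderiv_radial hm w
      simp only [map_smul, smul_apply, smul_eq_mul, inner_smul_left] at this
      apply mul_left_cancel₀ h0
      simp at this
      linarith
  have := constant_of_has_deriv_right_zero (a := 0) (b := 1)
    (fun t ht => (hd t ht).continuousAt.continuousWithinAt)
    (fun t ht => (hd t (Ico_subset_Icc_self ht)).hasDerivWithinAt) 1 (by simp)
  simp at this
  linarith

/-- The Hessian of half the squared distance to the origin. -/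
theorem hess_sq {y : V} (hy : y ∈ Metric.ball (0 : V) r) (w : V) :
    hess K (fun z => (1 / 2 : ℝ) * ⟪z, z⟫) y w w
      = K y w w + (1 / 2 : ℝ) * fderiv ℝ K y y w w := by
  have hm := h.isMetricOn
  have h1 : ∀ y : V, HasFDerivAt (fun z : V => (1 / 2 : ℝ) * ⟪z, z⟫) (innerSL ℝ y) y := by
    intro y
    refine (((hasFDerivAt_id y).inner ℝ (hasFDerivAt_id y)).const_mul (1 / 2 : ℝ)).congr_fderiv ?_
    ext w
    simp [real_inner_comm]
    ring
  have h2 : fderiv ℝ (fun z : V => (1 / 2 : ℝ) * ⟪z, z⟫) = innerSL ℝ := by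
    ext1 y; exact (h1 y).fderiv
  have h3 : HasFDerivAt (fun z => K z z w) _ y :=
    ((hm.differentiableAt hy).hasFDerivAt.clm_apply (hasFDerivAt_id y)).clm_apply
      (hasFDerivAt_const w y)
  have h4 : HasFDerivAt (fun z : V => ⟪z, w⟫) _ y :=
    (hasFDerivAt_id y).inner ℝ (hasFDerivAt_const w y)
  have h5 : (fun z => K z z w) =ᶠ[𝓝 y] fun z => ⟪z, w⟫ := by
    filter_upwards [hm.mem_nhds hy] with z hz using h.gauss hz w
  have h6 := DFunLike.congr_fun ((h3.congr_of_eventuallyEq h5.symm).unique h4) w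
  simp at h6
  -- By the Gauss lemma `⟨y, Γ(w, w)⟩ = K(y, Γ(w, w))`, which the Koszul formula evaluates; the
  -- derivative of the Gauss lemma in the direction `w` removes the remaining term `D_w K(y, w)`.
  have h7 := hm.christoffel_spec hy w w y
  rw [hm.symm y hy, h.gauss hy, hm.fderiv_symm hy w w y] at h7
  rw [hess, h2, (innerSL ℝ (E := V)).fderiv]
  simp only [innerSL_apply_apply]
  change ⟪w, w⟫ - _ = _
  rw [h7, real_inner_self_eq_norm_sq, ← h6]
  ring

/-- Hessian comparison in a direction orthogonal to the ray. -/
theorem hess_sq_orthogonal {κ ρ : ℝ} {θ w : V} (hρ : 0 < ρ) (hdom : ρ ∈ compDomain κ)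
    (hθ : ‖θ‖ = 1) (hρr : ρ < r)
    (hcurv : ∀ t ∈ Ioo 0 ρ, K (t • θ) (curvatureForm K (t • θ) w θ θ) w ≤ κ * K (t • θ) w w)
    (hw : w ≠ 0) :
    ρ * compC κ ρ * K (ρ • θ) w w
      ≤ compS κ ρ * hess K (fun z => (1 / 2 : ℝ) * ⟪z, z⟫) (ρ • θ) w w := by
  have hm := h.isMetricOn
  have hmem : ∀ t ∈ Icc 0 ρ, t • θ ∈ Metric.ball (0 : V) r := by
    intro t ht
    rw [mem_ball_zero_iff, norm_smul, hθ, Real.norm_of_nonneg ht.1]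
    linarith [ht.2]
  -- Varying the rays through the origin gives the Jacobi field `Y(t) = t w` along `t θ`. Here `J`
  -- is its covariant derivative, `b = |w|²` and `a = ⟨Y', w⟩`, so `|Y| = t √b` and `|Y|' = a / √b`.
  -- The Hessian to be estimated equals `a ρ`.
  let b : ℝ → ℝ := fun t => K (t • θ) w w
  let Γ : ℝ → V := fun t => christoffelL K (t • θ) θ w
  let J : ℝ → V := fun t => w + t • Γ t
  let a : ℝ → ℝ := fun t => K (t • θ) (J t) w
  have hbpos : ∀ t ∈ Icc 0 ρ, 0 < b t := fun t ht => hm.pos _ (hmem t ht) w hw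
  have hb : ∀ t ∈ Icc 0 ρ, HasDerivAt b (2 * K (t • θ) (Γ t) w) t := by
    intro t ht
    convert h.hasDerivAt_metric (hmem t ht) w w using 1
    rw [hm.fderiv_apply (hmem t ht), hm.symm _ (hmem t ht) w, christoffel_eq]
    ring
  have hΓ : ∀ t ∈ Icc 0 ρ, HasDerivAt Γ (fderiv ℝ (christoffelL K) (t • θ) θ θ w) t := by
    intro t ht
    have h1 : HasDerivAt (fun t : ℝ => t • θ) θ t := by simpa using (hasDerivAt_id t).smul_const θ
    have h0 := (hm.differentiableAt_christoffelL (hmem t ht)).hasFDerivAt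
    have h2 : HasDerivAt (fun t : ℝ => christoffelL K (t • θ))
        (fderiv ℝ (christoffelL K) (t • θ) θ) t := 
      HasFDerivAt.comp_hasDerivAt (l := christoffelL K) (f := fun t : ℝ => t • θ) t h0 h1
    simpa using (h2.clm_apply (hasDerivAt_const t θ)).clm_apply (hasDerivAt_const t w)
  have hJ : ∀ t ∈ Icc 0 ρ, HasDerivAt J
      (t • fderiv ℝ (christoffelL K) (t • θ) θ θ w + Γ t) t := by
    intro t ht
    exact (((hasDerivAt_id' t).fun_smul (hΓ t ht)).const_add w).congr_deriv (by simp)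
  have ha : ∀ t ∈ Icc 0 ρ, HasDerivAt a (fderiv ℝ K (t • θ) θ (J t) w
      + K (t • θ) (t • fderiv ℝ (christoffelL K) (t • θ) θ θ w + Γ t) w) t := by
    intro t ht
    have h1 : HasDerivAt (fun t : ℝ => t • θ) θ t := by simpa using (hasDerivAt_id t).smul_const θ
    have h2 : HasDerivAt (fun t : ℝ => K (t • θ)) (fderiv ℝ K (t • θ) θ) t :=
      (hm.differentiableAt (hmem t ht)).hasFDerivAt.comp_hasDerivAt t h1
    simpa using (h2.clm_apply (hJ t ht)).clm_apply (hasDerivAt_const t w)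
  -- Since `t a = ⟨Y', Y⟩`, this is `⟨Y', Y⟩' = |Y'|² - ⟨R(Y, θ)θ, Y⟩`, the Jacobi equation paired
  -- with `Y`. It comes from differentiating `Γ_z(z, z) = 0`, the geodesic equation of the
  -- neighbouring rays, in the direction `w`.
  have hjac : ∀ t ∈ Ioo 0 ρ, t * (fderiv ℝ K (t • θ) θ (J t) w
      + K (t • θ) (t • fderiv ℝ (christoffelL K) (t • θ) θ θ w + Γ t) w)
      = - t ^ 2 * K (t • θ) (curvatureForm K (t • θ) w θ θ) w
        + K (t • θ) (J t) (J t) - a t := by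
    intro t ht
    have hy := hmem t (Ioo_subset_Icc_self ht)
    have h1 : HasFDerivAt (fun z => christoffelL K z z z) _ (t • θ) :=
      ((hm.differentiableAt_christoffelL hy).hasFDerivAt.clm_apply (hasFDerivAt_id _)).clm_apply
        (hasFDerivAt_id _)
    have h2 : (fun z => christoffelL K z z z) =ᶠ[𝓝 (t • θ)] fun z => 0 := by
      filter_upwards [hm.mem_nhds hy] with z hz
      rw [← christoffel_eq]; exact h.ray z hz
    have h3 := DFunLike.congr_fun
      ((h1.congr_of_eventuallyEq h2.symm).unique (hasFDerivAt_const (0 : V) (t • θ))) w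
    have hsym : ∀ u v, christoffelL K (t • θ) u v = christoffelL K (t • θ) v u := by
      intro u v
      have := hm.christoffel_symm hy u v
      rwa [christoffel_eq, christoffel_eq] at this
    simp only [add_apply, ContinuousLinearMap.flip_apply, map_smul, smul_apply, id,
      ContinuousLinearMap.comp_apply, ContinuousLinearMap.coe_id', zero_apply] at h3
    rw [hsym w θ, ← smul_add, smul_eq_zero_iff_right ht.1.ne'] at h3
    have h3' : t • fderiv ℝ (christoffelL K) (t • θ) w θ θ = - (Γ t + Γ t) := by
      rw [eq_neg_iff_add_eq_zero, ← h3]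
      simp only [Γ]; abel
    have h4 := h.christoffel_smul hy
    have hR : t • curvatureForm K (t • θ) w θ θ = - (Γ t + Γ t)
        - t • fderiv ℝ (christoffelL K) (t • θ) θ θ w
        - t • christoffelL K (t • θ) θ (Γ t) := by
      have hsf : fderiv ℝ (christoffelL K) (t • θ) θ w θ =
          fderiv ℝ (christoffelL K) (t • θ) θ θ w := by
        rw [← hm.fderiv_christoffel hy, ← hm.fderiv_christoffel hy]
        congr 1
        apply Filter.EventuallyEq.fderiv_eq
        filter_upwards [hm.mem_nhds hy] with z hz using hm.christoffel_symm hz _ _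
      rw [hm.curvatureForm_eq hy, h4, hsf, hsym w θ]
      simp only [smul_sub, h3', map_zero, add_zero]
      rfl
    have h5 : t • (t • fderiv ℝ (christoffelL K) (t • θ) θ θ w) = -(t • (Γ t + Γ t))
        - t • t • christoffelL K (t • θ) θ (Γ t) - t • t • curvatureForm K (t • θ) w θ θ := by
      rw [hR]
      simp only [smul_sub, smul_neg]
      abel
    have h6 : fderiv ℝ K (t • θ) θ (J t) w = K (t • θ) (Γ t) w
        + t * K (t • θ) (christoffelL K (t • θ) θ (Γ t)) w + K (t • θ) (J t) (Γ t) := by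
      rw [hm.fderiv_apply hy, christoffel_eq, christoffel_eq]
      simp [J, Γ]
    have h7 : t * K (t • θ) (t • fderiv ℝ (christoffelL K) (t • θ) θ θ w) w =
        - (2 * t * K (t • θ) (Γ t) w) - t ^ 2 * K (t • θ) (christoffelL K (t • θ) θ (Γ t)) w
        - t ^ 2 * K (t • θ) (curvatureForm K (t • θ) w θ θ) w := by
      have := congrArg (fun x => K (t • θ) x w) h5
      simp only [map_sub, map_neg, map_smul, map_add, sub_apply, neg_apply,
        smul_apply, add_apply, smul_eq_mul] at this
      simp only [map_smul, smul_apply, smul_eq_mul]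
      rw [this]; ring
    have h8 : t * K (t • θ) (J t) (Γ t) = K (t • θ) (J t) (J t) - a t := by
      simp only [a]
      conv_rhs => rw [show J t = w + t • Γ t from rfl]
      simp only [map_add, map_smul, add_apply, smul_apply, smul_eq_mul]
      simp [J]
    have h9 : K (t • θ) (t • fderiv ℝ (christoffelL K) (t • θ) θ θ w + Γ t) w =
        K (t • θ) (t • fderiv ℝ (christoffelL K) (t • θ) θ θ w) w + K (t • θ) (Γ t) w := by
      rw [map_add, add_apply]
    rw [h6, h9]
    linear_combination h7 + h8
  -- Sturm comparison for the length `|Y| = t √b`, which satisfies `|Y|'' ≥ -κ |Y|`.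
  have key := sturm_comparison (κ := κ) (ρ := ρ) (f := fun t => t * √(b t))
    (f' := fun t => a t / √(b t)) (f'' := fun t => ((fderiv ℝ K (t • θ) θ (J t) w
      + K (t • θ) (t • fderiv ℝ (christoffelL K) (t • θ) θ θ w + Γ t) w) * √(b t)
        - a t * (2 * K (t • θ) (Γ t) w / (2 * √(b t)))) / √(b t) ^ 2) hρ hdom (by simp) ?_ ?_ ?_
  · have hbρ := hbpos ρ (right_mem_Icc.2 hρ.le)
    have hs := Real.sqrt_pos.2 hbρ
    have hss := Real.mul_self_sqrt hbρ.le
    have hh : hess K (fun z => (1 / 2 : ℝ) * ⟪z, z⟫) (ρ • θ) w w = a ρ := by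
      have hy := hmem ρ (right_mem_Icc.2 hρ.le)
      rw [h.hess_sq hy, hm.fderiv_apply hy, christoffel_eq]
      simp [a, J, Γ]
      rw [hm.symm _ hy w (christoffelL K (ρ • θ) θ w)]
      ring
    rw [hh]
    change ρ * compC κ ρ * b ρ ≤ _
    have := mul_le_mul_of_nonneg_right key hs.le
    have e1 : a ρ / √(b ρ) * compS κ ρ * √(b ρ) = compS κ ρ * a ρ := by field_simp
    rw [e1] at this
    have e2 : ρ * √(b ρ) * compC κ ρ * √(b ρ) = ρ * compC κ ρ * b ρ := by
      linear_combination (ρ * compC κ ρ) * hss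
    rwa [e2] at this
  · intro t ht
    have hs := Real.sqrt_pos.2 (hbpos t ht)
    have hss := Real.mul_self_sqrt (hbpos t ht).le
    refine ((hasDerivAt_id' t).fun_mul ((hb t ht).sqrt (hbpos t ht).ne')).congr_deriv ?_
    have : a t = b t + t * K (t • θ) (Γ t) w := by simp [a, J, b]
    simp only [this]
    field_simp
    rw [Real.sq_sqrt (hbpos t ht).le]
  · intro t ht
    exact (ha t ht).fun_div ((hb t ht).sqrt (hbpos t ht).ne') (Real.sqrt_pos.2 (hbpos t ht)).ne'
  · intro t ht
    have ht' := Ioo_subset_Icc_self ht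
    have hbt := hbpos t ht'
    have hs := Real.sqrt_pos.2 hbt
    have hss := Real.sq_sqrt hbt.le
    have hj := hjac t ht
    have hc := hcurv t ht
    -- Cauchy–Schwarz for `⟨J, w⟩`, read off from the nonnegativity of `K` at `b J - a w`. It
    -- accounts for the difference between `|Y'|²` and `(|Y|')²`.
    have hcs : a t ^ 2 ≤ K (t • θ) (J t) (J t) * b t := by
      have hy := hmem t ht'
      have hnn : ∀ x, 0 ≤ K (t • θ) x x := by
        intro x
        by_cases hx : x = 0
        · simp [hx]
        · exact (hm.pos _ hy x hx).le
      have := hnn (b t • J t - a t • w)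
      simp only [map_sub, map_smul, sub_apply, smul_apply, smul_eq_mul] at this
      rw [hm.symm _ hy w (J t)] at this
      change 0 ≤ b t * (b t * K (t • θ) (J t) (J t) - a t * a t)
        - a t * (b t * a t - a t * b t) at this
      have h9 : 0 ≤ b t * (K (t • θ) (J t) (J t) * b t - a t ^ 2) := by linarith
      have := pos_of_mul_pos_left (a := b t) (b := 1) (by linarith) (by norm_num)
      nlinarith [nonneg_of_mul_nonneg_right h9 hbt]
    have hA : a t = b t + t * K (t • θ) (Γ t) w := by simp [a, J, b]
    set D := fderiv ℝ K (t • θ) θ (J t) w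
      + K (t • θ) (t • fderiv ℝ (christoffelL K) (t • θ) θ θ w + Γ t) w with hD
    have e : (D * √(b t) - a t * (2 * K (t • θ) (Γ t) w / (2 * √(b t)))) / √(b t) ^ 2
        = (D * b t - a t * K (t • θ) (Γ t) w) / (b t * √(b t)) := by
      generalize √(b t) = s at hs hss
      rw [← hss]; field_simp
    rw [e, le_div_iff₀ (by positivity)]
    have ht0 := ht.1
    apply le_of_mul_le_mul_left _ ht0
    have e2 : t * (D * b t - a t * K (t • θ) (Γ t) w) = (t * D) * b t - a t * (a t - b t) := by
      rw [hA]; ring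
    have e3 : t * (-κ * (t * √(b t)) * (b t * √(b t))) = - (t ^ 2 * (κ * b t) * b t) := by
      generalize √(b t) = s at hs hss
      rw [← hss]; ring
    rw [e2, e3, hj]
    have h10 : t ^ 2 * (K (t • θ) (curvatureForm K (t • θ) w θ θ) w) * b t
        ≤ t ^ 2 * (κ * b t) * b t := by gcongr
    nlinarith

/-- Hessian comparison for half the squared distance to the origin. -/
theorem le_hess_sq {κ ρ : ℝ} {θ : V} (hρ : 0 < ρ) (hdom : ρ ∈ compDomain κ)
    (hθ : ‖θ‖ = 1) (hρr : ρ < r)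
    (hcurv : ∀ t ∈ Ioo 0 ρ, ∀ w, ⟪θ, w⟫ = 0 →
      K (t • θ) (curvatureForm K (t • θ) w θ θ) w ≤ κ * K (t • θ) w w) (w : V) :
    ρ * (compC κ ρ / compS κ ρ) * (K (ρ • θ) w w - ⟪θ, w⟫ ^ 2) + ⟪θ, w⟫ ^ 2
      ≤ hess K (fun z => (1 / 2 : ℝ) * ⟪z, z⟫) (ρ • θ) w w := by
  have hm := h.isMetricOn
  have hy : ρ • θ ∈ Metric.ball (0 : V) r := by
    rw [mem_ball_zero_iff, norm_smul, hθ, Real.norm_of_nonneg hρ.le]; linarith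
  have hθθ : ⟪θ, θ⟫ = 1 := by rw [real_inner_self_eq_norm_sq, hθ]; norm_num
  have hg : ∀ x, K (ρ • θ) θ x = ⟪θ, x⟫ := by
    intro x
    have := h.gauss hy x
    simpa [inner_smul_left, hρ.ne'] using this
  have hrad : ∀ x, ρ * fderiv ℝ K (ρ • θ) θ θ x = 0 := by
    intro x
    have := h.fderiv_radial hy x
    rw [h.gauss hy x] at this
    simpa [hρ.ne'] using this
  set c := ⟪θ, w⟫ with hc
  set w' := w - c • θ with hw'
  have hort : ⟪θ, w'⟫ = 0 := by simp [hw', inner_sub_right, inner_smul_right, hθ, hc]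
  have hw : w = w' + c • θ := by simp [hw']
  have hKw : K (ρ • θ) w w = K (ρ • θ) w' w' + c ^ 2 := by
    rw [hw]
    simp only [map_add, map_smul, add_apply, smul_apply, smul_eq_mul]
    rw [hm.symm _ hy w' θ, hg, hg, hort, hθθ]
    ring
  have hH : hess K (fun z => (1 / 2 : ℝ) * ⟪z, z⟫) (ρ • θ) w w
      = hess K (fun z => (1 / 2 : ℝ) * ⟪z, z⟫) (ρ • θ) w' w' + c ^ 2 := by
    rw [h.hess_sq hy, h.hess_sq hy, hKw]
    have e : fderiv ℝ K (ρ • θ) (ρ • θ) w w = fderiv ℝ K (ρ • θ) (ρ • θ) w' w' := by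
      rw [hw]
      simp only [map_add, map_smul, add_apply, smul_apply, smul_eq_mul]
      have h1 := hrad w'
      have h2 := hrad θ
      rw [hm.fderiv_symm hy θ w' θ]
      linear_combination (2 * c) * h1 + c ^ 2 * h2
    rw [e]; ring
  have hS := compS_pos hdom
  rw [hH, hKw, add_sub_cancel_right]
  gcongr
  by_cases h0 : w' = 0
  · rw [h.hess_sq hy, h0]; simp
  · have := h.hess_sq_orthogonal hρ hdom hθ hρr (fun t ht => hcurv t ht w' hort) h0
    rw [← mul_le_mul_iff_right₀ hS]
    refine le_trans (le_of_eq ?_) this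
    field_simp

theorem hess_sq_zero (hr : 0 < r) (w : V) :
    hess K (fun z => (1 / 2 : ℝ) * ⟪z, z⟫) 0 w w = ⟪w, w⟫ := by
  rw [h.hess_sq (Metric.mem_ball_self hr), h.inner_zero]
  simp

end IsNormalMetric

end NormalCoordinates

/-! ### Traces, volume density and the divergence theorem in a chart. -/

section Divergence

/-- The form is made into an inner product inside the proof only, so that the existence of
orthonormal bases can be used without changing the norm of the ambient space. -/
theorem exists_basis_orthonormal {F : Type*} [AddCommGroup F] [Module ℝ F]
    [FiniteDimensional ℝ F] (β : F →ₗ[ℝ] F →ₗ[ℝ] ℝ) (hsymm : ∀ u v, β u v = β v u)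
    (hpos : ∀ u, u ≠ 0 → 0 < β u u) {m : ℕ} (hm : Module.finrank ℝ F = m) :
    ∃ b : Module.Basis (Fin m) ℝ F, ∀ i j, β (b i) (b j) = if i = j then 1 else 0 := by
  let core : InnerProductSpace.Core ℝ F :=
    { inner := fun u v => β u v
      conj_inner_symm := fun u v => hsymm v u
      re_inner_nonneg := fun u => by
        by_cases hu : u = 0
        · simp [hu]
        · exact (hpos u hu).le
      add_left := fun u v w => by simp
      smul_left := fun u v c => by simp
      definite := fun u hu => by
        by_contra hne
        exact (hpos u hne).ne' hu }
  let _ : NormedAddCommGroup F := core.toNormedAddCommGroup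
  let _ : InnerProductSpace ℝ F := InnerProductSpace.ofCore core.toCore
  let o := (stdOrthonormalBasis ℝ F).reindex (finCongr hm)
  refine ⟨o.toBasis, fun i j => ?_⟩
  have := orthonormal_iff_ite.1 o.orthonormal i j
  simp only [OrthonormalBasis.coe_toBasis]
  exact this

/-- Jacobi's formula at the identity matrix. In the Leibniz expansion only the identity permutation
contributes to the first order. -/
theorem det_hasFDerivAt_one {E : Type*} [NormedAddCommGroup E] [NormedSpace ℝ E] {n : Type*}
    [Fintype n] [DecidableEq n] {A : E → Matrix n n ℝ} {A' : n → n → E →L[ℝ] ℝ} {y : E}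
    (hA : ∀ i j, HasFDerivAt (fun z => A z i j) (A' i j) y) (h1 : A y = 1) :
    HasFDerivAt (fun z => (A z).det) (∑ i, A' i i) y := by
  have h2 : HasFDerivAt (fun z => ∑ σ : Equiv.Perm n, ((Equiv.Perm.sign σ : ℤ) : ℝ) *
      ∏ i, A z (σ i) i)
      (∑ σ : Equiv.Perm n, ((Equiv.Perm.sign σ : ℤ) : ℝ) •
        ∑ i, (∏ j ∈ Finset.univ.erase i, A y (σ j) j) • A' (σ i) i) y :=
    HasFDerivAt.fun_sum fun σ _ =>
      (HasFDerivAt.finsetProd (fun i _ => hA (σ i) i)).const_mul _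
  have h3 : (fun z => (A z).det) = fun z => ∑ σ : Equiv.Perm n,
      ((Equiv.Perm.sign σ : ℤ) : ℝ) * ∏ i, A z (σ i) i := by
    funext z
    rw [Matrix.det_apply']
  rw [h3]
  refine h2.congr_fderiv ?_
  rw [Finset.sum_eq_single (1 : Equiv.Perm n)]
  · simp only [Equiv.Perm.sign_one, Units.val_one, Int.cast_one, one_smul, Equiv.Perm.one_apply]
    refine Finset.sum_congr rfl fun i _ => ?_
    rw [Finset.prod_eq_one, one_smul]
    intro j _
    rw [h1, Matrix.one_apply_eq]
  · intro σ _ hσ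
    rw [Finset.sum_eq_zero, smul_zero]
    intro i _
    -- A permutation other than the identity moves at least two points. Hence after removing the
    -- factor `i` an off-diagonal factor, which is zero at `y`, is left.
    obtain ⟨j, hj⟩ : ∃ j, j ≠ i ∧ σ j ≠ j := by
      by_contra! hcon
      apply hσ
      ext j
      by_cases hji : j = i
      · subst hji
        by_contra hne
        have h4 : σ (σ j) = σ j := hcon (σ j) hne
        exact hne (σ.injective h4)
      · exact hcon j hji
    rw [Finset.prod_eq_zero (Finset.mem_erase.2 ⟨hj.1, Finset.mem_univ j⟩), zero_smul]
    rw [h1, Matrix.one_apply_ne hj.2]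
  · simp

variable {m : ℕ}

/-- The density of the Riemannian volume of `G` with respect to Lebesgue measure. -/
def gramDensity (G : EuclideanSpace ℝ (Fin m) → EuclideanSpace ℝ (Fin m) →L[ℝ] EuclideanSpace ℝ (Fin m) →L[ℝ] ℝ) (y : EuclideanSpace ℝ (Fin m)) : ℝ :=
  Real.sqrt (Matrix.det (Matrix.of fun i j : Fin m =>
    G y (EuclideanSpace.single i 1) (EuclideanSpace.single j 1)))

section Trace

variable {E : Type*} [NormedAddCommGroup E] [NormedSpace ℝ E]

/-- The covariant Hessian as a continuous bilinear form. -/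
def hessL (G : E → E →L[ℝ] E →L[ℝ] ℝ) (f : E → ℝ) (y : E) : E →L[ℝ] E →L[ℝ] ℝ :=
  fderiv ℝ (fderiv ℝ f) y - (ContinuousLinearMap.compL ℝ E E ℝ (fderiv ℝ f y)) ∘L christoffelL G y

theorem hessL_apply (G : E → E →L[ℝ] E →L[ℝ] ℝ) (f : E → ℝ) (y u v : E) :
    hessL G f y u v = hess G f y u v := by
  simp [hessL, hess, christoffel_eq]

/-- The gradient of `f` with respect to the metric `G`. -/
def gradG (G : E → E →L[ℝ] E →L[ℝ] ℝ) (f : E → ℝ) (y : E) : E := (G y).inverse (fderiv ℝ f y)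

/-- The Laplacian of `f` with respect to the metric `G`. -/
def lapG (G : E → E →L[ℝ] E →L[ℝ] ℝ) (f : E → ℝ) (y : E) : ℝ :=
  LinearMap.trace ℝ E ((G y).inverse ∘L hessL G f y : E →L[ℝ] E)

variable [FiniteDimensional ℝ E] {ι : Type*} [Fintype ι] [DecidableEq ι]

theorem trace_eq_sum_of_orthonormal {β : E →L[ℝ] E →L[ℝ] ℝ} (b : Module.Basis ι ℝ E)
    (hb : ∀ i j, β (b i) (b j) = if i = j then 1 else 0) (T : E →ₗ[ℝ] E) :
    LinearMap.trace ℝ E T = ∑ i, β (T (b i)) (b i) := by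
  have hrepr : ∀ x i, β x (b i) = b.repr x i := by
    intro x i
    conv_lhs => rw [← b.sum_repr x]
    rw [map_sum, sum_apply, Finset.sum_eq_single i] <;> simp +contextual [hb]
  rw [LinearMap.trace_eq_matrix_trace ℝ b, Matrix.trace]
  refine Finset.sum_congr rfl fun i _ => ?_
  rw [Matrix.diag_apply, LinearMap.toMatrix_apply, hrepr]

variable {G : E → E →L[ℝ] E →L[ℝ] ℝ} {s : Set E}

theorem IsMetricOn.exists_basis (hG : IsMetricOn G s) {y : E} (hy : y ∈ s) {m : ℕ}
    (hm : Module.finrank ℝ E = m) :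
    ∃ b : Module.Basis (Fin m) ℝ E, ∀ i j, G y (b i) (b j) = if i = j then 1 else 0 := by
  have := exists_basis_orthonormal
    ((ContinuousLinearMap.coeLM ℝ (M := E) (N₃ := ℝ)) ∘ₗ (G y : E →ₗ[ℝ] (E →L[ℝ] ℝ)))
    (fun u v => hG.symm y hy u v) (fun u hu => hG.pos y hy u hu) hm
  exact this

theorem IsMetricOn.lapG_eq_sum (hG : IsMetricOn G s) {y : E} (hy : y ∈ s) (b : Module.Basis ι ℝ E)
    (hb : ∀ i j, G y (b i) (b j) = if i = j then 1 else 0) (f : E → ℝ) :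
    lapG G f y = ∑ i, hess G f y (b i) (b i) := by
  rw [lapG, trace_eq_sum_of_orthonormal b hb]
  refine Finset.sum_congr rfl fun i _ => ?_
  rw [ContinuousLinearMap.coe_coe, ContinuousLinearMap.comp_apply, hG.apply_inverse hy,
    hessL_apply]

end Trace

variable {G : EuclideanSpace ℝ (Fin m) → EuclideanSpace ℝ (Fin m) →L[ℝ] EuclideanSpace ℝ (Fin m) →L[ℝ] ℝ} {s : Set (EuclideanSpace ℝ (Fin m))} (hG : IsMetricOn G s)
include hG

-- A change of basis multiplies the Gram determinant by the square of a determinant that does not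
-- depend on the point. Hence the density can be differentiated in a basis that is orthonormal at
-- one given point only.
omit hG in
theorem exists_gram_eq (G : EuclideanSpace ℝ (Fin m) → EuclideanSpace ℝ (Fin m) →L[ℝ]
      EuclideanSpace ℝ (Fin m) →L[ℝ] ℝ)
    (b : Module.Basis (Fin m) ℝ (EuclideanSpace ℝ (Fin m))) :
    ∃ c : ℝ, 0 < c ∧ ∀ z, Matrix.det (Matrix.of fun i j : Fin m =>
      G z (EuclideanSpace.single i 1) (EuclideanSpace.single j 1)) =
      c * Matrix.det (Matrix.of fun i j : Fin m => G z (b i) (b j)) := by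
  let P := b.toMatrix (EuclideanSpace.basisFun (Fin m) ℝ).toBasis
  have hP : ∀ z, (Matrix.of fun i j : Fin m =>
      G z (EuclideanSpace.single i 1) (EuclideanSpace.single j 1)) =
      P.transpose * (Matrix.of fun i j : Fin m => G z (b i) (b j)) * P := by
    intro z
    ext i j
    have hs : ∀ i : Fin m, (EuclideanSpace.single i 1 : EuclideanSpace ℝ (Fin m)) = ∑ k, P k i • b k := by
      intro i
      have := b.sum_toMatrix_smul_self (EuclideanSpace.basisFun (Fin m) ℝ).toBasis i
      rw [this]; simp
    rw [Matrix.of_apply, hs i, hs j]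
    simp only [map_sum, Matrix.mul_apply, Matrix.transpose_apply, Matrix.of_apply, map_smul,
      sum_apply, smul_apply, smul_eq_mul, Finset.sum_mul]
    refine Finset.sum_congr rfl fun k _ => ?_
    rw [Finset.mul_sum]
    exact Finset.sum_congr rfl fun l _ => by ring
  have hdet : P.det ≠ 0 := by
    intro h0
    have := congrArg Matrix.det
      (Module.Basis.toMatrix_mul_toMatrix_flip b (EuclideanSpace.basisFun (Fin m) ℝ).toBasis)
    rw [Matrix.det_mul, show (b.toMatrix (EuclideanSpace.basisFun (Fin m) ℝ).toBasis).det = 0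
      from h0] at this
    simp at this
  refine ⟨P.det ^ 2, by positivity, fun z => ?_⟩
  rw [hP, Matrix.det_mul, Matrix.det_mul, Matrix.det_transpose]
  ring

theorem IsMetricOn.gram_det_pos {y : EuclideanSpace ℝ (Fin m)} (hy : y ∈ s) : 0 < Matrix.det (Matrix.of fun i j : Fin m =>
    G y (EuclideanSpace.single i 1) (EuclideanSpace.single j 1)) := by
  obtain ⟨b, hb⟩ := hG.exists_basis hy (m := m) (by simp)
  obtain ⟨c, hc, h⟩ := exists_gram_eq G b
  rw [h y, show (Matrix.of fun i j : Fin m => G y (b i) (b j)) = 1 by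
    ext i j; simp [hb, Matrix.one_apply]]
  simpa using hc

theorem IsMetricOn.gramDensity_pos {y : EuclideanSpace ℝ (Fin m)} (hy : y ∈ s) : 0 < gramDensity G y :=
  Real.sqrt_pos.2 (hG.gram_det_pos hy)

theorem IsMetricOn.contDiffOn_gramDensity : ContDiffOn ℝ ∞ (gramDensity G) s := by
  intro y hy
  refine ContDiffWithinAt.sqrt ?_ (hG.gram_det_pos hy).ne'
  simp only [Matrix.det_apply']
  refine ContDiffWithinAt.sum fun σ _ => contDiffWithinAt_const.mul
    (contDiffWithinAt_prod fun i _ => ?_)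
  exact ((hG.contDiffOn y hy).clm_apply contDiffWithinAt_const).clm_apply contDiffWithinAt_const

/-- The logarithmic derivative of the volume density. -/
theorem IsMetricOn.fderiv_gramDensity {y : EuclideanSpace ℝ (Fin m)} (hy : y ∈ s) {b : Module.Basis (Fin m) ℝ (EuclideanSpace ℝ (Fin m))}
    (hb : ∀ i j, G y (b i) (b j) = if i = j then 1 else 0) (v : EuclideanSpace ℝ (Fin m)) :
    fderiv ℝ (gramDensity G) y v =
      (1 / 2 : ℝ) * gramDensity G y * ∑ i, fderiv ℝ G y v (b i) (b i) := by
  obtain ⟨c, hc, h⟩ := exists_gram_eq G b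
  have h1 : (Matrix.of fun i j : Fin m => G y (b i) (b j)) = 1 := by
    ext i j; simp [hb, Matrix.one_apply]
  have hd := det_hasFDerivAt_one (A := fun z => Matrix.of fun i j : Fin m => G z (b i) (b j))
    (y := y) (fun i j => ((hG.differentiableAt hy).hasFDerivAt.clm_apply
      (hasFDerivAt_const (b i) y)).clm_apply (hasFDerivAt_const (b j) y)) h1
  have hq : gramDensity G = fun z => √(c * Matrix.det (Matrix.of fun i j : Fin m =>
      G z (b i) (b j))) := by
    funext z; rw [gramDensity, h z]
  have hne : c * Matrix.det (Matrix.of fun i j : Fin m => G y (b i) (b j)) ≠ 0 := by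
    rw [h1]; simpa using hc.ne'
  have hs := (hd.const_mul c).sqrt hne
  have hone : Matrix.det (Matrix.of fun i j : Fin m => G y (b i) (b j)) = 1 := by
    rw [h1, Matrix.det_one]
  rw [hq, hs.fderiv]
  have hsc := Real.sqrt_pos.2 hc
  have hsq := Real.sq_sqrt hc.le
  simp [hone]
  generalize √c = q at hsc hsq
  rw [← hsq]
  field_simp

/-- The divergence of `X = ψ grad U`, weighted with the volume density. -/
theorem IsMetricOn.trace_fderiv {ψ U : EuclideanSpace ℝ (Fin m) → ℝ} {y : EuclideanSpace ℝ (Fin m)} (hy : y ∈ s) (hψ : DifferentiableAt ℝ ψ y)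
    (hU : ContDiffAt ℝ ∞ U y) :
    LinearMap.trace ℝ (EuclideanSpace ℝ (Fin m)) (fderiv ℝ (fun z => (gramDensity G z * ψ z) • gradG G U z) y) =
      gramDensity G y * (ψ y * lapG G U y + fderiv ℝ ψ y (gradG G U y)) := by
  obtain ⟨b, hb⟩ := hG.exists_basis hy (m := m) (by simp)
  have hdd : DifferentiableAt ℝ (fderiv ℝ U) y :=
    (hU.fderiv_right (m := ∞) (by simp)).differentiableAt (by simp)
  have hρ : DifferentiableAt ℝ (gramDensity G) y :=
    (hG.contDiffOn_gramDensity.contDiffAt (hG.mem_nhds hy)).differentiableAt (by simp)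
  have hinv : DifferentiableAt ℝ (fun z => (G z).inverse) y :=
    (hG.contDiffOn_inverse.contDiffAt (hG.mem_nhds hy)).differentiableAt (by simp)
  have hX : DifferentiableAt ℝ (gradG G U) y := hinv.clm_apply hdd
  set X := gradG G U y with hXdef
  have hGX : ∀ w, G y X w = fderiv ℝ U y w := fun w => by
    rw [hXdef, gradG, hG.apply_inverse hy]
  -- The derivative of the defining relation `G(grad U, w) = dU(w)`.
  have hDX : ∀ v w, G y (fderiv ℝ (gradG G U) y v) w =
      fderiv ℝ (fderiv ℝ U) y v w - fderiv ℝ G y v X w := by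
    intro v w
    have h1 : HasFDerivAt (fun z => G z (gradG G U z) w) _ y :=
      ((hG.differentiableAt hy).hasFDerivAt.clm_apply hX.hasFDerivAt).clm_apply
        (hasFDerivAt_const w y)
    have h2 : HasFDerivAt (fun z => fderiv ℝ U z w) _ y :=
      hdd.hasFDerivAt.clm_apply (hasFDerivAt_const w y)
    have h3 : (fun z => G z (gradG G U z) w) =ᶠ[𝓝 y] fun z => fderiv ℝ U z w := by
      filter_upwards [hG.mem_nhds hy] with z hz
      rw [gradG, hG.apply_inverse hz]
    have h4 := DFunLike.congr_fun ((h1.congr_of_eventuallyEq h3.symm).unique h2) v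
    simp at h4
    linarith
  -- The coordinate divergence of the gradient misses the Laplacian by `½ tr D_X G`, which is the
  -- logarithmic derivative of the volume density along `X`.
  have hdiv : ∑ i, G y (fderiv ℝ (gradG G U) y (b i)) (b i) =
      lapG G U y - (1 / 2 : ℝ) * ∑ i, fderiv ℝ G y X (b i) (b i) := by
    rw [hG.lapG_eq_sum hy b hb, Finset.mul_sum, ← Finset.sum_sub_distrib]
    refine Finset.sum_congr rfl fun i _ => ?_
    rw [hDX, hess, ← hGX, hG.symm y hy X, hG.christoffel_spec hy, hG.fderiv_symm hy (b i) X]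
    ring
  have hF : HasFDerivAt (fun z => (gramDensity G z * ψ z) • gradG G U z) _ y :=
    (hρ.hasFDerivAt.mul hψ.hasFDerivAt).smul hX.hasFDerivAt
  have hexp : ∀ a : EuclideanSpace ℝ (Fin m) →L[ℝ] ℝ, ∑ i, G y ((a (b i)) • X) (b i) = a X := by
    intro a
    have hr : ∀ i, G y X (b i) = b.repr X i := by
      intro i
      conv_lhs => rw [← b.sum_repr X]
      rw [map_sum, sum_apply, Finset.sum_eq_single i] <;> simp +contextual [hb]
    conv_rhs => rw [← b.sum_repr X]
    rw [map_sum]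
    exact Finset.sum_congr rfl fun i _ => by simp [hr, mul_comm]
  rw [hF.fderiv, trace_eq_sum_of_orthonormal b hb]
  have : ∀ i, G y (((gramDensity G y * ψ y) • fderiv ℝ (gradG G U) y +
      (gramDensity G y • fderiv ℝ ψ y + ψ y • fderiv ℝ (gramDensity G) y).smulRight X) (b i)) (b i)
      = gramDensity G y * ψ y * G y (fderiv ℝ (gradG G U) y (b i)) (b i)
      + G y (((gramDensity G y • fderiv ℝ ψ y + ψ y • fderiv ℝ (gramDensity G) y) (b i)) • X)
        (b i) := by
    intro i
    rw [add_apply, map_add, add_apply]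
    congr 1
    simp
  refine (Finset.sum_congr rfl fun i _ => this i).trans ?_
  rw [Finset.sum_add_distrib, ← Finset.mul_sum, hdiv, hexp]
  rw [add_apply, smul_apply, smul_apply, hG.fderiv_gramDensity hy hb]
  simp only [smul_eq_mul]
  ring

/-- The divergence theorem in a chart. -/
theorem IsMetricOn.integral_green {ψ U : EuclideanSpace ℝ (Fin m) → ℝ} (hψ : ContDiff ℝ ∞ ψ) (hc : HasCompactSupport ψ)
    (hsub : tsupport ψ ⊆ s) (hU : ∀ y ∈ tsupport ψ, ContDiffAt ℝ ∞ U y) :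
    Continuous (fun y => gramDensity G y * (ψ y * lapG G U y + fderiv ℝ ψ y (gradG G U y))) ∧
    ∫ y, gramDensity G y * (ψ y * lapG G U y + fderiv ℝ ψ y (gradG G U y)) = 0 := by
  -- `G` and `U` are controlled only on the support of `ψ`, but the factor `ψ` makes `Y` a compactly
  -- supported `C¹` field on the whole space.
  set Y : EuclideanSpace ℝ (Fin m) → EuclideanSpace ℝ (Fin m) := fun z => (gramDensity G z * ψ z) • gradG G U z with hY
  have hsupp : tsupport Y ⊆ tsupport ψ := by
    refine closure_mono fun z hz => ?_
    contrapose! hz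
    simp only [Function.mem_support, not_not] at hz ⊢
    simp [hY, hz]
  have hYc : ContDiff ℝ 1 Y := by
    rw [contDiff_iff_contDiffAt]
    intro y
    by_cases hy : y ∈ tsupport ψ
    · have hs := hsub hy
      have hUy := hU y hy
      refine ContDiffAt.smul (ContDiffAt.mul ?_ (hψ.contDiffAt.of_le (by simp))) ?_
      · exact (hG.contDiffOn_gramDensity.contDiffAt (hG.mem_nhds hs)).of_le (by simp)
      · exact ((hG.contDiffOn_inverse.contDiffAt (hG.mem_nhds hs)).of_le (by simp)).clm_apply
          ((hUy.fderiv_right (m := ∞) (by simp)).of_le (by simp))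
    · have : Y =ᶠ[𝓝 y] fun _ => 0 := by
        have h0 : ψ =ᶠ[𝓝 y] 0 := notMem_tsupport_iff_eventuallyEq.1 hy
        filter_upwards [h0] with z hz
        simp [hY, hz]
      exact contDiffAt_const.congr_of_eventuallyEq this
  have hYcs : HasCompactSupport Y := hc.of_isClosed_subset (isClosed_tsupport _) hsupp
  have hcont : ∀ i : Fin m, Continuous (fun y => fderiv ℝ Y y (EuclideanSpace.single i 1) i) :=
    fun i => (EuclideanSpace.proj i : EuclideanSpace ℝ (Fin m) →L[ℝ] ℝ).continuous.comp
      ((hYc.continuous_fderiv (by simp)).clm_apply continuous_const)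
  have hint : ∀ i : Fin m, Integrable (fun y => fderiv ℝ Y y (EuclideanSpace.single i 1) i) := by
    intro i
    refine (hcont i).integrable_of_hasCompactSupport ?_
    · exact (hYcs.fderiv (𝕜 := ℝ)).comp_left (g := fun D : EuclideanSpace ℝ (Fin m) →L[ℝ] EuclideanSpace ℝ (Fin m) =>
        D (EuclideanSpace.single i 1) i) (by simp)
  have hzero : ∀ i : Fin m, ∫ y, fderiv ℝ Y y (EuclideanSpace.single i 1) i = 0 := by
    intro i
    let g : EuclideanSpace ℝ (Fin m) → ℝ := fun y => Y y i
    have hgd : ∀ y, HasFDerivAt g ((EuclideanSpace.proj i : EuclideanSpace ℝ (Fin m) →L[ℝ] ℝ) ∘L fderiv ℝ Y y) y :=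
      fun y => (EuclideanSpace.proj i : EuclideanSpace ℝ (Fin m) →L[ℝ] ℝ).hasFDerivAt.comp y
        (hYc.differentiable (by simp) y).hasFDerivAt
    have hgf : ∀ y v, fderiv ℝ g y v = fderiv ℝ Y y v i := fun y v => by
      rw [(hgd y).fderiv]; rfl
    -- Integration by parts against the constant function `1`.
    have := integral_mul_fderiv_eq_neg_fderiv_mul_of_integrable (μ := (volume : Measure (EuclideanSpace ℝ (Fin m))))
      (f := fun _ : EuclideanSpace ℝ (Fin m) => (1 : ℝ)) (g := g) (v := EuclideanSpace.single i 1) (by simp)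
      (by simpa [hgf] using hint i)
      (by
        simp only [one_mul]
        refine Continuous.integrable_of_hasCompactSupport
          ((EuclideanSpace.proj i : EuclideanSpace ℝ (Fin m) →L[ℝ] ℝ).continuous.comp hYc.continuous) ?_
        exact hYcs.comp_left (g := fun x : EuclideanSpace ℝ (Fin m) => x i) (by simp))
      (by simp) (fun y _ => (hgd y).differentiableAt)
    simpa [hgf] using this
  have hpt : ∀ y, gramDensity G y * (ψ y * lapG G U y + fderiv ℝ ψ y (gradG G U y)) =
      ∑ i, fderiv ℝ Y y (EuclideanSpace.single i 1) i := by
    intro y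
    have htr : LinearMap.trace ℝ (EuclideanSpace ℝ (Fin m)) (fderiv ℝ Y y) =
        ∑ i, fderiv ℝ Y y (EuclideanSpace.single i 1) i := by
      rw [LinearMap.trace_eq_matrix_trace ℝ (EuclideanSpace.basisFun (Fin m) ℝ).toBasis,
        Matrix.trace]
      refine Finset.sum_congr rfl fun i _ => ?_
      rw [Matrix.diag_apply, LinearMap.toMatrix_apply]
      simp
    rw [← htr]
    by_cases hy : y ∈ tsupport ψ
    · rw [hG.trace_fderiv (hsub hy) (hψ.differentiable (by simp) y) (hU y hy)]
    · have h0 : ψ =ᶠ[𝓝 y] 0 := notMem_tsupport_iff_eventuallyEq.1 hy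
      have h1 : Y =ᶠ[𝓝 y] fun _ => 0 := by
        filter_upwards [h0] with z hz
        simp [hY, hz]
      rw [h1.fderiv_eq, h0.fderiv_eq, h0.self_of_nhds]
      simp
  simp_rw [hpt]
  refine ⟨continuous_finsetSum _ fun i _ => hcont i, ?_⟩
  rw [integral_finsetSum _ fun i _ => hint i]
  exact Finset.sum_eq_zero fun i _ => hzero i

end Divergence

/-! ### Metrics of a manifold read in charts and parametrizations. -/

section Charts

variable {E : Type*} [NormedAddCommGroup E] [NormedSpace ℝ E]
  {M : Type*} [TopologicalSpace M] [ChartedSpace E M]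
  [RiemannianBundle (fun x : M => TangentSpace 𝓘(ℝ, E) x)]
  {V : Type*} [NormedAddCommGroup V] [NormedSpace ℝ V]

theorem riemMetric_apply (x : M) (u v : TangentSpace 𝓘(ℝ, E) x) :
    riemMetric 𝓘(ℝ, E) M x u v = inner ℝ u v := rfl

/-- Tangent spaces at points that are only provably equal are different types. Comparing vectors as
elements of the model space avoids transporting them along the equality. -/
theorem metricField_congr {F : Type*} [NormedAddCommGroup F] [NormedSpace ℝ F]
    {H' : Type*} [TopologicalSpace H'] {J : ModelWithCorners ℝ F H'}
    {W : Type*} [TopologicalSpace W] [ChartedSpace H' W] (g : MetricField J W) {x x' : W}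
    (h : x = x') {u v : TangentSpace J x} {u' v' : TangentSpace J x'}
    (hu : (u : F) = (u' : F)) (hv : (v : F) = (v' : F)) : g x u v = g x' u' v' := by
  subst h
  have h1 : u = u' := hu
  have h2 : v = v' := hv
  rw [h1, h2]

variable [FiniteDimensional ℝ V] [IsManifold 𝓘(ℝ, E) ∞ M]
  [IsContMDiffRiemannianBundle 𝓘(ℝ, E) ∞ E (fun x : M => TangentSpace 𝓘(ℝ, E) x)]

theorem contMDiffOn_mfderiv_apply {A : V → M} {t : Set V} (ht : IsOpen t)
    (hA : ContMDiffOn 𝓘(ℝ, V) 𝓘(ℝ, E) ∞ A t) (u : V) :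
    ContMDiffOn 𝓘(ℝ, V) 𝓘(ℝ, E).tangent ∞
      (fun y => (⟨A y, mfderiv 𝓘(ℝ, V) 𝓘(ℝ, E) A y u⟩ : TangentBundle 𝓘(ℝ, E) M)) t := by
  have h1 := hA.contMDiffOn_tangentMapWithin (m := ∞) (by simp) ht.uniqueMDiffOn
  have h2 : ContMDiff 𝓘(ℝ, V) 𝓘(ℝ, V).tangent ∞
      (fun y => (⟨y, u⟩ : TangentBundle 𝓘(ℝ, V) V)) :=
    contMDiff_vectorSpace_iff_contDiff.2 contDiff_const
  refine (h1.comp h2.contMDiffOn (fun y hy => hy)).congr fun y hy => ?_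
  simp only [Function.comp_apply, tangentMapWithin]
  rw [mfderivWithin_of_isOpen ht hy]

theorem isMetricOn_pullback {A : V → M} {t : Set V} (ht : IsOpen t)
    (hA : ContMDiffOn 𝓘(ℝ, V) 𝓘(ℝ, E) ∞ A t)
    (hinj : ∀ y ∈ t, Function.Injective (mfderiv 𝓘(ℝ, V) 𝓘(ℝ, E) A y)) :
    IsMetricOn (pullback 𝓘(ℝ, V) (riemMetric 𝓘(ℝ, E) M) A) t where
  isOpen := ht
  contDiffOn := by
    have key : ∀ u v, ContDiffOn ℝ ∞
        (fun y => pullback 𝓘(ℝ, V) (riemMetric 𝓘(ℝ, E) M) A y u v) t := by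
      intro u v
      rw [← contMDiffOn_iff_contDiffOn]
      exact ContMDiffOn.inner_bundle (IB := 𝓘(ℝ, E)) (F := E)
        (E := fun x : M => TangentSpace 𝓘(ℝ, E) x) (contMDiffOn_mfderiv_apply ht hA u)
        (contMDiffOn_mfderiv_apply ht hA v)
    refine (contDiffOn_clm_apply (E := V) (F := V →L[ℝ] ℝ)).2 fun u => ?_
    exact (contDiffOn_clm_apply (E := V) (F := ℝ)).2 fun v => key u v
  symm := fun y _ u v => real_inner_comm (F := TangentSpace 𝓘(ℝ, E) (A y)) _ _
  pos := fun y hy u hu => by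
    have hne : mfderiv 𝓘(ℝ, V) 𝓘(ℝ, E) A y u ≠ 0 := by
      intro h0
      exact hu (hinj y hy (h0.trans (map_zero _).symm))
    exact real_inner_self_pos (F := TangentSpace 𝓘(ℝ, E) (A y)) |>.2 hne

/-- `A` is a smooth local parametrization of `M` on the open set `t`. -/
structure IsParam (A : V → M) (t : Set V) : Prop where
  isOpen : IsOpen t
  contMDiffOn : ContMDiffOn 𝓘(ℝ, V) 𝓘(ℝ, E) ∞ A t
  bijective : ∀ y ∈ t, Function.Bijective (mfderiv 𝓘(ℝ, V) 𝓘(ℝ, E) A y)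

section Param

variable {A : V → M} {t : Set V}

omit [RiemannianBundle (fun x : M => TangentSpace 𝓘(ℝ, E) x)]
  [IsContMDiffRiemannianBundle 𝓘(ℝ, E) ∞ E (fun x : M => TangentSpace 𝓘(ℝ, E) x)] in
theorem IsParam.extChartAt_symm (p : M) :
    IsParam (E := E) (extChartAt 𝓘(ℝ, E) p).symm (extChartAt 𝓘(ℝ, E) p).target where
  isOpen := isOpen_extChartAt_target p
  contMDiffOn := contMDiffOn_extChartAt_symm p
  bijective := fun y hy => by
    have := isInvertible_mfderivWithin_extChartAt_symm (I := 𝓘(ℝ, E)) hy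
    rw [ModelWithCorners.range_eq_univ, mfderivWithin_univ] at this
    exact this.bijective

theorem IsParam.isMetricOn (hA : IsParam (E := E) A t) :
    IsMetricOn (pullback 𝓘(ℝ, V) (riemMetric 𝓘(ℝ, E) M) A) t :=
  isMetricOn_pullback hA.isOpen hA.contMDiffOn fun y hy => (hA.bijective y hy).1

theorem isMetricOn_chartMetric [FiniteDimensional ℝ E] (p : M) :
    IsMetricOn (chartMetric (riemMetric 𝓘(ℝ, E) M) p) (extChartAt 𝓘(ℝ, E) p).target :=
  (IsParam.extChartAt_symm p).isMetricOn

/-- The domain on which a parametrization can be read in the chart at `p`. -/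
def paramDomain (A : V → M) (t : Set V) (p : M) : Set V := t ∩ A ⁻¹' (chartAt E p).source

theorem IsParam.isOpen_paramDomain (hA : IsParam (E := E) A t) (p : M) :
    IsOpen (paramDomain (E := E) A t p) :=
  hA.contMDiffOn.continuousOn.isOpen_inter_preimage hA.isOpen (chartAt E p).open_source

omit [FiniteDimensional ℝ V] [RiemannianBundle (fun x : M => TangentSpace 𝓘(ℝ, E) x)]
  [IsContMDiffRiemannianBundle 𝓘(ℝ, E) ∞ E (fun x : M => TangentSpace 𝓘(ℝ, E) x)] in
theorem fderiv_extChartAt_comp {A : V → M} {y : V} {p : M}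
    (hA : MDifferentiableAt 𝓘(ℝ, V) 𝓘(ℝ, E) A y) (hy : A y ∈ (chartAt E p).source) (u : V) :
    fderiv ℝ (fun z => extChartAt 𝓘(ℝ, E) p (A z)) y u =
      mfderiv 𝓘(ℝ, E) 𝓘(ℝ, E) (extChartAt 𝓘(ℝ, E) p) (A y)
        (mfderiv 𝓘(ℝ, V) 𝓘(ℝ, E) A y u) := by
  have := mfderiv_comp (I := 𝓘(ℝ, V)) (I' := 𝓘(ℝ, E)) (I'' := 𝓘(ℝ, E)) y
    (mdifferentiableAt_extChartAt hy) hA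
  rw [← mfderiv_eq_fderiv]
  exact DFunLike.congr_fun this u

omit [FiniteDimensional ℝ V]
  [IsContMDiffRiemannianBundle 𝓘(ℝ, E) ∞ E (fun x : M => TangentSpace 𝓘(ℝ, E) x)] in
theorem chartMetric_extChartAt {x p : M} (hx : x ∈ (chartAt E p).source)
    (u v : TangentSpace 𝓘(ℝ, E) x) :
    chartMetric (riemMetric 𝓘(ℝ, E) M) p (extChartAt 𝓘(ℝ, E) p x)
      (mfderiv 𝓘(ℝ, E) 𝓘(ℝ, E) (extChartAt 𝓘(ℝ, E) p) x u)
      (mfderiv 𝓘(ℝ, E) 𝓘(ℝ, E) (extChartAt 𝓘(ℝ, E) p) x v) = inner ℝ u v := by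
  have hx' : x ∈ (extChartAt 𝓘(ℝ, E) p).source := by rwa [extChartAt_source]
  have h1 := mfderivWithin_extChartAt_symm_comp_mfderiv_extChartAt' (I := 𝓘(ℝ, E)) hx'
  rw [ModelWithCorners.range_eq_univ, mfderivWithin_univ] at h1
  rw [← riemMetric_apply]
  exact metricField_congr (riemMetric 𝓘(ℝ, E) M) ((extChartAt 𝓘(ℝ, E) p).left_inv hx')
    (DFunLike.congr_fun h1 u) (DFunLike.congr_fun h1 v)

theorem IsParam.isMetricMap [FiniteDimensional ℝ E] (hA : IsParam (E := E) A t) (p : M) :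
    IsMetricMap (pullback 𝓘(ℝ, V) (riemMetric 𝓘(ℝ, E) M) A) (paramDomain (E := E) A t p)
      (chartMetric (riemMetric 𝓘(ℝ, E) M) p) (extChartAt 𝓘(ℝ, E) p).target
      (fun z => extChartAt 𝓘(ℝ, E) p (A z)) where
  metric_source := hA.isMetricOn.mono (hA.isOpen_paramDomain p) inter_subset_left
  metric_target := isMetricOn_chartMetric p
  contDiffOn := by
    rw [← contMDiffOn_iff_contDiffOn]
    exact (contMDiffOn_extChartAt (I := 𝓘(ℝ, E)) (x := p)).comp
      (hA.contMDiffOn.mono inter_subset_left) (fun y hy => hy.2)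
  mapsTo := fun y hy => (extChartAt 𝓘(ℝ, E) p).map_source (by rw [extChartAt_source]; exact hy.2)
  eq := fun y hy u v => by
    have hd : MDifferentiableAt 𝓘(ℝ, V) 𝓘(ℝ, E) A y :=
      (hA.contMDiffOn.contMDiffAt (hA.isOpen.mem_nhds hy.1)).mdifferentiableAt (by simp)
    rw [fderiv_extChartAt_comp hd hy.2, fderiv_extChartAt_comp hd hy.2,
      chartMetric_extChartAt hy.2]
    rfl

omit [FiniteDimensional ℝ V] [RiemannianBundle (fun x : M => TangentSpace 𝓘(ℝ, E) x)]
  [IsContMDiffRiemannianBundle 𝓘(ℝ, E) ∞ E (fun x : M => TangentSpace 𝓘(ℝ, E) x)] in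
theorem IsParam.bijective_fderiv (hA : IsParam (E := E) A t) (p : M) {y : V}
    (hy : y ∈ paramDomain (E := E) A t p) :
    Function.Bijective (fderiv ℝ (fun z => extChartAt 𝓘(ℝ, E) p (A z)) y) := by
  have hd : MDifferentiableAt 𝓘(ℝ, V) 𝓘(ℝ, E) A y :=
    (hA.contMDiffOn.contMDiffAt (hA.isOpen.mem_nhds hy.1)).mdifferentiableAt (by simp)
  have h1 : (mfderiv 𝓘(ℝ, E) 𝓘(ℝ, E) (extChartAt 𝓘(ℝ, E) p) (A y)).IsInvertible :=
    isInvertible_mfderiv_extChartAt (by rw [extChartAt_source]; exact hy.2)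
  have h2 : ⇑(fderiv ℝ (fun z => extChartAt 𝓘(ℝ, E) p (A z)) y) =
      (mfderiv 𝓘(ℝ, E) 𝓘(ℝ, E) (extChartAt 𝓘(ℝ, E) p) (A y)) ∘
        (mfderiv 𝓘(ℝ, V) 𝓘(ℝ, E) A y) := funext fun u => fderiv_extChartAt_comp hd hy.2 u
  rw [h2]
  exact h1.bijective.comp (hA.bijective y hy.1)

end Param

end Charts

/-! ### Invariance of the Laplacian under local isometries. -/

section Laplacian

variable {E : Type*} [NormedAddCommGroup E] [NormedSpace ℝ E] [FiniteDimensional ℝ E]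
  {V : Type*} [NormedAddCommGroup V] [NormedSpace ℝ V] [FiniteDimensional ℝ V]
  {G : E → E →L[ℝ] E →L[ℝ] ℝ} {s : Set E} {K : V → V →L[ℝ] V →L[ℝ] ℝ} {t : Set V} {Φ : V → E}

/-- A bijective isometric differential carries orthonormal bases to orthonormal bases, and the
Hessian is natural. -/
theorem IsMetricMap.lapG_comp (h : IsMetricMap K t G s Φ)
    (hbij : ∀ y ∈ t, Function.Bijective (fderiv ℝ Φ y)) {y : V} (hy : y ∈ t) {f : E → ℝ}
    (hf : ContDiffAt ℝ ∞ f (Φ y)) :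
    lapG K (fun z => f (Φ z)) y = lapG G f (Φ y) := by
  obtain ⟨b, hb⟩ := h.metric_source.exists_basis hy rfl
  let e : V ≃ₗ[ℝ] E := LinearEquiv.ofBijective (fderiv ℝ Φ y : V →ₗ[ℝ] E) (hbij y hy)
  have hb' : ∀ i j, G (Φ y) (b.map e i) (b.map e j) = if i = j then 1 else 0 := by
    intro i j
    rw [← hb i j, h.eq y hy]
    simp [e]
  rw [h.metric_source.lapG_eq_sum hy b hb, h.metric_target.lapG_eq_sum (h.mapsTo hy) (b.map e) hb']
  refine Finset.sum_congr rfl fun i _ => ?_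
  rw [h.hess_comp (fun y hy => (hbij y hy).2) hy hf]
  simp [e]

theorem hess_congr {f f' : E → ℝ} {y : E} (h : f =ᶠ[𝓝 y] f') (u v : E) :
    hess G f y u v = hess G f' y u v := by
  rw [hess, hess, h.fderiv.fderiv_eq, h.fderiv_eq]

theorem lapG_congr {f f' : E → ℝ} {y : E} (h : f =ᶠ[𝓝 y] f') : lapG G f y = lapG G f' y := by
  rw [lapG, lapG, hessL, hessL, h.fderiv.fderiv_eq, h.fderiv_eq]

end Laplacian

/-! ### Geodesics: chart independence, uniqueness and constant speed. -/

section CurveCalculus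

variable {E : Type*} [NormedAddCommGroup E] [NormedSpace ℝ E]
  {V : Type*} [NormedAddCommGroup V] [NormedSpace ℝ V]

theorem deriv_comp_curve {Φ : V → E} {c : ℝ → V} {s : ℝ} (hΦ : DifferentiableAt ℝ Φ (c s))
    (hc : DifferentiableAt ℝ c s) :
    deriv (fun s => Φ (c s)) s = fderiv ℝ Φ (c s) (deriv c s) :=
  (hΦ.hasFDerivAt.comp_hasDerivAt s hc.hasDerivAt).deriv

theorem deriv_deriv_comp_curve {Φ : V → E} {c : ℝ → V} {s : ℝ} (hΦ : ContDiffAt ℝ ∞ Φ (c s))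
    (hc : ContDiffAt ℝ ∞ c s) :
    deriv (deriv (fun s => Φ (c s))) s = fderiv ℝ (fderiv ℝ Φ) (c s) (deriv c s) (deriv c s)
      + fderiv ℝ Φ (c s) (deriv (deriv c) s) := by
  have h2 : ∀ᶠ x in 𝓝 (c s), ContDiffAt ℝ 2 Φ x :=
    (hΦ.of_le ENat.LEInfty.out).eventually (by simp)
  have h3 : ∀ᶠ x in 𝓝 s, ContDiffAt ℝ 2 c x :=
    (hc.of_le ENat.LEInfty.out).eventually (by simp)
  have h1 : deriv (fun s => Φ (c s)) =ᶠ[𝓝 s] fun s => fderiv ℝ Φ (c s) (deriv c s) := by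
    filter_upwards [hc.continuousAt.eventually h2, h3] with x hx hx'
    exact deriv_comp_curve (hx.differentiableAt (by simp)) (hx'.differentiableAt (by simp))
  have hd : HasFDerivAt (fderiv ℝ Φ) (fderiv ℝ (fderiv ℝ Φ) (c s)) (c s) :=
    ((hΦ.fderiv_right (m := ∞) (by simp)).differentiableAt (by simp)).hasFDerivAt
  have hcd : HasDerivAt c (deriv c s) s := (hc.differentiableAt (by simp)).hasDerivAt
  have hc' : DifferentiableAt ℝ (deriv c) s := by
    have := (hc.fderiv_right (m := ∞) (by simp)).clm_apply (contDiffAt_const (c := (1 : ℝ)))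
    exact this.differentiableAt (by simp)
  have h4 : HasDerivAt (fun s => fderiv ℝ Φ (c s)) (fderiv ℝ (fderiv ℝ Φ) (c s) (deriv c s)) s :=
    HasFDerivAt.comp_hasDerivAt (f := c) s hd hcd
  rw [h1.deriv_eq, (h4.clm_apply hc'.hasDerivAt).deriv]

end CurveCalculus

section Geodesics

variable {E : Type*} [NormedAddCommGroup E] [NormedSpace ℝ E] [FiniteDimensional ℝ E]
  {N : Type*} [TopologicalSpace N] [ChartedSpace E N] [IsManifold 𝓘(ℝ, E) ∞ N]
  [RiemannianBundle (fun x : N => TangentSpace 𝓘(ℝ, E) x)]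
  [IsContMDiffRiemannianBundle 𝓘(ℝ, E) ∞ E (fun x : N => TangentSpace 𝓘(ℝ, E) x)]

theorem deriv_extChartAt_comp {γ : ℝ → N} {s : ℝ} {p : N}
    (hγ : MDifferentiableAt 𝓘(ℝ, ℝ) 𝓘(ℝ, E) γ s) (hs : γ s ∈ (chartAt E p).source) :
    deriv (fun s => extChartAt 𝓘(ℝ, E) p (γ s)) s =
      mfderiv 𝓘(ℝ, E) 𝓘(ℝ, E) (extChartAt 𝓘(ℝ, E) p) (γ s) (velocity 𝓘(ℝ, E) γ s) :=
  fderiv_extChartAt_comp hγ hs 1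

theorem deriv_extChartAt_comp_self {γ : ℝ → N} {s : ℝ}
    (hγ : MDifferentiableAt 𝓘(ℝ, ℝ) 𝓘(ℝ, E) γ s) :
    deriv (fun t => extChartAt 𝓘(ℝ, E) (γ s) (γ t)) s = velocity 𝓘(ℝ, E) γ s := by
  rw [deriv_extChartAt_comp hγ (mem_chart_source E (γ s)), mfderiv_extChartAt_self]
  rfl

theorem contDiffAt_extChartAt_comp {γ : ℝ → N} {s : ℝ} {p : N}
    (hγ : ContMDiff 𝓘(ℝ, ℝ) 𝓘(ℝ, E) ∞ γ) (hs : γ s ∈ (chartAt E p).source) :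
    ContDiffAt ℝ ∞ (fun s => extChartAt 𝓘(ℝ, E) p (γ s)) s := by
  rw [← contMDiffAt_iff_contDiffAt]
  exact (contMDiffAt_extChartAt' hs).comp s hγ.contMDiffAt

theorem eventually_mem_chart_source {γ : ℝ → N} {s : ℝ} {p : N} (hγ : ContinuousAt γ s)
    (hs : γ s ∈ (chartAt E p).source) : ∀ᶠ t in 𝓝 s, γ t ∈ (chartAt E p).source :=
  hγ.eventually ((chartAt E p).open_source.mem_nhds hs)

/-- The transition map from the chart at `q` to the chart at `p`. -/
def transition (E : Type*) [NormedAddCommGroup E] [NormedSpace ℝ E] {N : Type*}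
    [TopologicalSpace N] [ChartedSpace E N] (q p : N) (y : E) : E :=
  extChartAt 𝓘(ℝ, E) p ((extChartAt 𝓘(ℝ, E) q).symm y)

theorem isMetricMap_transition (q p : N) :
    IsMetricMap (chartMetric (riemMetric 𝓘(ℝ, E) N) q)
      (paramDomain (E := E) (extChartAt 𝓘(ℝ, E) q).symm (extChartAt 𝓘(ℝ, E) q).target p)
      (chartMetric (riemMetric 𝓘(ℝ, E) N) p) (extChartAt 𝓘(ℝ, E) p).target (transition E q p) :=
  (IsParam.extChartAt_symm q).isMetricMap p

theorem bijective_fderiv_transition (q p : N) {y : E} (hy : y ∈ paramDomain (E := E)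
    (extChartAt 𝓘(ℝ, E) q).symm (extChartAt 𝓘(ℝ, E) q).target p) :
    Function.Bijective (fderiv ℝ (transition E q p) y) :=
  (IsParam.extChartAt_symm q).bijective_fderiv p hy

theorem extChartAt_mem_paramDomain {x q p : N} (hq : x ∈ (chartAt E q).source)
    (hp : x ∈ (chartAt E p).source) : extChartAt 𝓘(ℝ, E) q x ∈ paramDomain (E := E)
      (extChartAt 𝓘(ℝ, E) q).symm (extChartAt 𝓘(ℝ, E) q).target p := by
  have hq' : x ∈ (extChartAt 𝓘(ℝ, E) q).source := by rwa [extChartAt_source]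
  refine ⟨(extChartAt 𝓘(ℝ, E) q).map_source hq', ?_⟩
  rw [mem_preimage, (extChartAt 𝓘(ℝ, E) q).left_inv hq']
  exact hp

theorem transition_extChartAt {x q p : N} (hq : x ∈ (chartAt E q).source) :
    transition E q p (extChartAt 𝓘(ℝ, E) q x) = extChartAt 𝓘(ℝ, E) p x := by
  rw [transition, (extChartAt 𝓘(ℝ, E) q).left_inv (by rwa [extChartAt_source])]

/-- The geodesic equation holds in every chart. -/
theorem IsGeodesic.eq_in_chart {γ : ℝ → N} (hγ : IsGeodesic (riemMetric 𝓘(ℝ, E) N) γ) {p : N}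
    {s : ℝ} (hs : γ s ∈ (chartAt E p).source) :
    deriv (deriv fun s => extChartAt 𝓘(ℝ, E) p (γ s)) s =
      - christoffel (chartMetric (riemMetric 𝓘(ℝ, E) N) p) (extChartAt 𝓘(ℝ, E) p (γ s))
        (deriv (fun s => extChartAt 𝓘(ℝ, E) p (γ s)) s)
        (deriv (fun s => extChartAt 𝓘(ℝ, E) p (γ s)) s) := by
  have h2 := eq_neg_of_add_eq_zero_left (hγ.2 s)
  -- The definition gives the equation only in the chart centred at `γ s`. The centre is generalized
  -- to `q`, so that it stays fixed while the curve moves.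
  have key : ∀ q : N, γ s ∈ (chartAt E q).source →
      deriv (deriv fun s => extChartAt 𝓘(ℝ, E) q (γ s)) s =
      - christoffel (chartMetric (riemMetric 𝓘(ℝ, E) N) q) (extChartAt 𝓘(ℝ, E) q (γ s))
        (deriv (fun s => extChartAt 𝓘(ℝ, E) q (γ s)) s)
        (deriv (fun s => extChartAt 𝓘(ℝ, E) q (γ s)) s) →
      deriv (deriv fun s => extChartAt 𝓘(ℝ, E) p (γ s)) s =
      - christoffel (chartMetric (riemMetric 𝓘(ℝ, E) N) p) (extChartAt 𝓘(ℝ, E) p (γ s))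
        (deriv (fun s => extChartAt 𝓘(ℝ, E) p (γ s)) s)
        (deriv (fun s => extChartAt 𝓘(ℝ, E) p (γ s)) s) := by
    intro q hqs h2
    have hΦ := isMetricMap_transition (E := E) q p
    have hm := extChartAt_mem_paramDomain hqs hs
    have hc := contDiffAt_extChartAt_comp hγ.1 hqs
    have he : (fun t => extChartAt 𝓘(ℝ, E) p (γ t)) =ᶠ[𝓝 s]
        fun t => transition E q p (extChartAt 𝓘(ℝ, E) q (γ t)) := by
      filter_upwards [eventually_mem_chart_source hγ.1.continuous.continuousAt hqs] with t ht
      exact (transition_extChartAt ht).symm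
    rw [he.deriv.deriv_eq, he.deriv_eq, ← transition_extChartAt (p := p) hqs,
      deriv_deriv_comp_curve (hΦ.contDiffAt hm) hc,
      deriv_comp_curve (hΦ.differentiableAt hm) (hc.differentiableAt (by simp)), h2, map_neg,
      hΦ.map_christoffel (fun y hy => (bijective_fderiv_transition q p hy).2) hm]
    abel
  exact key (γ s) (mem_chart_source E (γ s)) h2

/-- Two curves have the same position and velocity at time `t`. -/
def SameState (γ₁ γ₂ : ℝ → N) (t : ℝ) : Prop :=
  γ₁ t = γ₂ t ∧ (velocity 𝓘(ℝ, E) γ₁ t : E) = velocity 𝓘(ℝ, E) γ₂ t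

/-- Over equal points the derivative of the chart is one and the same invertible map, so agreement
of velocities can be tested in any chart. This makes the states points of a phase space `E × E`. -/
theorem sameState_iff {γ₁ γ₂ : ℝ → N} {t : ℝ} {p : N}
    (h₁ : MDifferentiableAt 𝓘(ℝ, ℝ) 𝓘(ℝ, E) γ₁ t) (h₂ : MDifferentiableAt 𝓘(ℝ, ℝ) 𝓘(ℝ, E) γ₂ t)
    (hp₁ : γ₁ t ∈ (chartAt E p).source) (hp₂ : γ₂ t ∈ (chartAt E p).source) :
    SameState (E := E) γ₁ γ₂ t ↔
      extChartAt 𝓘(ℝ, E) p (γ₁ t) = extChartAt 𝓘(ℝ, E) p (γ₂ t) ∧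
      deriv (fun s => extChartAt 𝓘(ℝ, E) p (γ₁ s)) t =
        deriv (fun s => extChartAt 𝓘(ℝ, E) p (γ₂ s)) t := by
  rw [deriv_extChartAt_comp h₁ hp₁, deriv_extChartAt_comp h₂ hp₂]
  have hinj := (extChartAt 𝓘(ℝ, E) p).injOn
  rw [extChartAt_source] at hinj
  rw [SameState, hinj.eq_iff hp₁ hp₂, and_congr_right_iff]
  intro he
  have h3 : (mfderiv 𝓘(ℝ, E) 𝓘(ℝ, E) (extChartAt 𝓘(ℝ, E) p) (γ₁ t)).IsInvertible :=
    isInvertible_mfderiv_extChartAt (by rwa [extChartAt_source])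
  have h4 : ∀ x x' : N, x = x' → ∀ u : E,
      (mfderiv 𝓘(ℝ, E) 𝓘(ℝ, E) (extChartAt 𝓘(ℝ, E) p) x : E →L[ℝ] E) u =
      (mfderiv 𝓘(ℝ, E) 𝓘(ℝ, E) (extChartAt 𝓘(ℝ, E) p) x' : E →L[ℝ] E) u := by
    rintro x _ rfl u; rfl
  have h5 := h4 _ _ he (velocity 𝓘(ℝ, E) γ₂ t)
  constructor
  · intro h
    exact (congrArg (mfderiv 𝓘(ℝ, E) 𝓘(ℝ, E) (extChartAt 𝓘(ℝ, E) p) (γ₁ t)) h).trans h5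
  · intro h
    exact h3.injective (h.trans h5.symm)

theorem differentiableAt_deriv_of_contDiffAt {c : ℝ → E} {t : ℝ} (hc : ContDiffAt ℝ ∞ c t) :
    DifferentiableAt ℝ (deriv c) t := by
  have := (hc.fderiv_right (m := ∞) (by simp)).clm_apply (contDiffAt_const (c := (1 : ℝ)))
  exact this.differentiableAt (by simp)

/-- In a chart the geodesic equation is a first-order system on `E × E` with a `C¹`, hence locally
Lipschitz, right-hand side `F`; local uniqueness for such systems applies. -/
theorem IsGeodesic.eventually_sameState {γ₁ γ₂ : ℝ → N}
    (h₁ : IsGeodesic (riemMetric 𝓘(ℝ, E) N) γ₁) (h₂ : IsGeodesic (riemMetric 𝓘(ℝ, E) N) γ₂)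
    {t₀ : ℝ} (h : SameState (E := E) γ₁ γ₂ t₀) : ∀ᶠ t in 𝓝 t₀, SameState (E := E) γ₁ γ₂ t := by
  obtain ⟨p, hp₁⟩ : ∃ p : N, γ₁ t₀ ∈ (chartAt E p).source := ⟨_, mem_chart_source E _⟩
  have hp₂ : γ₂ t₀ ∈ (chartAt E p).source := by rw [← h.1]; exact hp₁
  have hm := isMetricOn_chartMetric (E := E) p
  set G := chartMetric (riemMetric 𝓘(ℝ, E) N) p with hG
  let F : E × E → E × E := fun z => (z.2, - christoffelL G z.1 z.2 z.2)
  have hev : ∀ γ : ℝ → N, IsGeodesic (riemMetric 𝓘(ℝ, E) N) γ → γ t₀ ∈ (chartAt E p).source →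
      ∀ᶠ t in 𝓝 t₀, HasDerivAt (fun t => (extChartAt 𝓘(ℝ, E) p (γ t),
        deriv (fun s => extChartAt 𝓘(ℝ, E) p (γ s)) t))
        (F (extChartAt 𝓘(ℝ, E) p (γ t), deriv (fun s => extChartAt 𝓘(ℝ, E) p (γ s)) t)) t := by
    intro γ hγ hs
    filter_upwards [eventually_mem_chart_source hγ.1.continuous.continuousAt hs] with t ht
    have hc := contDiffAt_extChartAt_comp hγ.1 ht
    have h3 := (differentiableAt_deriv_of_contDiffAt hc).hasDerivAt
    rw [hγ.eq_in_chart ht, christoffel_eq] at h3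
    exact (hc.differentiableAt (by simp)).hasDerivAt.prodMk h3
  have hcont : ∀ γ : ℝ → N, IsGeodesic (riemMetric 𝓘(ℝ, E) N) γ →
      γ t₀ ∈ (chartAt E p).source → ContinuousAt (fun t => (extChartAt 𝓘(ℝ, E) p (γ t),
        deriv (fun s => extChartAt 𝓘(ℝ, E) p (γ s)) t)) t₀ := fun γ hγ hs =>
    (hev γ hγ hs).self_of_nhds.continuousAt
  have hmem : extChartAt 𝓘(ℝ, E) p (γ₁ t₀) ∈ (extChartAt 𝓘(ℝ, E) p).target :=
    (extChartAt 𝓘(ℝ, E) p).map_source (by rwa [extChartAt_source])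
  have h5 : ContDiffOn ℝ 1 (fun z : E × E => christoffelL G z.1)
      ((extChartAt 𝓘(ℝ, E) p).target ×ˢ univ) :=
    ContDiffOn.comp (g := christoffelL G) (f := Prod.fst)
      (hm.contDiffOn_christoffelL.of_le ENat.LEInfty.out) contDiffOn_fst (fun z hz => hz.1)
  have hF : ContDiffAt ℝ 1 F (extChartAt 𝓘(ℝ, E) p (γ₁ t₀),
      deriv (fun s => extChartAt 𝓘(ℝ, E) p (γ₁ s)) t₀) := by
    have h6 := h5.contDiffAt ((hm.isOpen.prod isOpen_univ).mem_nhds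
      (show (extChartAt 𝓘(ℝ, E) p (γ₁ t₀), deriv (fun s => extChartAt 𝓘(ℝ, E) p (γ₁ s)) t₀) ∈
        (extChartAt 𝓘(ℝ, E) p).target ×ˢ univ from ⟨hmem, mem_univ _⟩))
    exact contDiffAt_snd.prodMk ((h6.clm_apply contDiffAt_snd).clm_apply contDiffAt_snd).neg
  obtain ⟨K, u, hu, hK⟩ := hF.exists_lipschitzOnWith
  have hmd : ∀ γ : ℝ → N, IsGeodesic (riemMetric 𝓘(ℝ, E) N) γ → ∀ t,
      MDifferentiableAt 𝓘(ℝ, ℝ) 𝓘(ℝ, E) γ t := fun γ hγ t =>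
    hγ.1.contMDiffAt.mdifferentiableAt (by simp)
  have h6 := (sameState_iff (hmd _ h₁ _) (hmd _ h₂ _) hp₁ hp₂).1 h
  have h7 := hcont _ h₁ hp₁
  have h8 := hcont _ h₂ hp₂
  have h9 := ODE_solution_unique_of_eventually (v := fun _ => F) (s := fun _ => u) (K := K)
    (f := fun t => (extChartAt 𝓘(ℝ, E) p (γ₁ t), deriv (fun s => extChartAt 𝓘(ℝ, E) p (γ₁ s)) t))
    (g := fun t => (extChartAt 𝓘(ℝ, E) p (γ₂ t), deriv (fun s => extChartAt 𝓘(ℝ, E) p (γ₂ s)) t))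
    (t₀ := t₀) (Eventually.of_forall fun _ => hK) ((hev _ h₁ hp₁).and (h7.eventually hu))
    ((hev _ h₂ hp₂).and (h8.eventually (by rw [h6.1, h6.2] at hu; exact hu)))
    (Prod.ext h6.1 h6.2)
  filter_upwards [h9, eventually_mem_chart_source h₁.1.continuous.continuousAt hp₁,
    eventually_mem_chart_source h₂.1.continuous.continuousAt hp₂] with t ht ht₁ ht₂
  exact (sameState_iff (hmd _ h₁ _) (hmd _ h₂ _) ht₁ ht₂).2 ⟨congrArg Prod.fst ht, congrArg Prod.snd ht⟩

theorem IsGeodesic.sameState_of_frequently [T2Space N] {γ₁ γ₂ : ℝ → N}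
    (h₁ : IsGeodesic (riemMetric 𝓘(ℝ, E) N) γ₁) (h₂ : IsGeodesic (riemMetric 𝓘(ℝ, E) N) γ₂)
    {t₀ : ℝ} (h : ∃ᶠ t in 𝓝 t₀, SameState (E := E) γ₁ γ₂ t) : SameState (E := E) γ₁ γ₂ t₀ := by
  have hmd : ∀ γ : ℝ → N, IsGeodesic (riemMetric 𝓘(ℝ, E) N) γ → ∀ t,
      MDifferentiableAt 𝓘(ℝ, ℝ) 𝓘(ℝ, E) γ t := fun γ hγ t =>
    hγ.1.contMDiffAt.mdifferentiableAt (by simp)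
  have h0 : γ₁ t₀ = γ₂ t₀ := by
    have hc : IsClosed {t | γ₁ t = γ₂ t} := isClosed_eq h₁.1.continuous h₂.1.continuous
    exact hc.mem_of_frequently_of_tendsto (h.mono fun t ht => ht.1) tendsto_id
  obtain ⟨p, hp₁⟩ : ∃ p : N, γ₁ t₀ ∈ (chartAt E p).source := ⟨_, mem_chart_source E _⟩
  have hp₂ : γ₂ t₀ ∈ (chartAt E p).source := by rw [← h0]; exact hp₁
  refine (sameState_iff (hmd _ h₁ _) (hmd _ h₂ _) hp₁ hp₂).2 ⟨by rw [h0], ?_⟩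
  by_contra hne
  have hc : ∀ γ : ℝ → N, IsGeodesic (riemMetric 𝓘(ℝ, E) N) γ → γ t₀ ∈ (chartAt E p).source →
      ContinuousAt (deriv fun s => extChartAt 𝓘(ℝ, E) p (γ s)) t₀ := fun γ hγ hs =>
    (differentiableAt_deriv_of_contDiffAt (contDiffAt_extChartAt_comp hγ.1 hs)).continuousAt
  refine h ?_
  filter_upwards [((hc _ h₁ hp₁).sub (hc _ h₂ hp₂)).eventually_ne (sub_ne_zero.2 hne),
    eventually_mem_chart_source h₁.1.continuous.continuousAt hp₁,
    eventually_mem_chart_source h₂.1.continuous.continuousAt hp₂] with t ht ht₁ ht₂ hs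
  exact ht (sub_eq_zero.2 ((sameState_iff (hmd _ h₁ _) (hmd _ h₂ _) ht₁ ht₂).1 hs).2)

/-- The set of times at which the states agree is open by uniqueness, closed by continuity, and `ℝ`
is connected. -/
theorem IsGeodesic.eq_of_sameState [T2Space N] {γ₁ γ₂ : ℝ → N}
    (h₁ : IsGeodesic (riemMetric 𝓘(ℝ, E) N) γ₁) (h₂ : IsGeodesic (riemMetric 𝓘(ℝ, E) N) γ₂)
    {t₀ : ℝ} (h : SameState (E := E) γ₁ γ₂ t₀) : γ₁ = γ₂ := by
  have hclopen : IsClopen {t | SameState (E := E) γ₁ γ₂ t} := by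
    refine ⟨isClosed_iff_frequently.2 fun t ht => h₁.sameState_of_frequently h₂ ht,
      isOpen_iff_mem_nhds.2 fun t ht => h₁.eventually_sameState h₂ ht⟩
  have := hclopen.eq_univ ⟨t₀, h⟩
  funext t
  exact (this ▸ mem_univ t : t ∈ {t | SameState (E := E) γ₁ γ₂ t}).1

theorem isGeodesic_const (p : N) : IsGeodesic (riemMetric 𝓘(ℝ, E) N) fun _ : ℝ => p := by
  refine ⟨contMDiff_const, fun t => ?_⟩
  simp [christoffel_eq]

theorem IsGeodesic.comp_mul_left {γ : ℝ → N} (hγ : IsGeodesic (riemMetric 𝓘(ℝ, E) N) γ) (a : ℝ) :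
    IsGeodesic (riemMetric 𝓘(ℝ, E) N) fun t => γ (a * t) := by
  refine ⟨hγ.1.comp (contMDiff_iff_contDiff.2 (contDiff_const.mul contDiff_id)), fun t => ?_⟩
  have h2 := hγ.2 (a * t)
  simp only at h2 ⊢
  have h3 : ∀ (c : ℝ → E) (t : ℝ), deriv (fun s => c (a * s)) t = a • deriv c (a * t) := fun c t =>
    deriv_comp_mul_left a c t
  have h4 : ∀ c : ℝ → E, deriv (fun s => c (a * s)) = fun t => a • deriv c (a * t) := fun c =>
    funext (h3 c)
  rw [h4 fun s => extChartAt 𝓘(ℝ, E) (γ (a * t)) (γ s)]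
  simp only [deriv_fun_const_smul_field]
  rw [h3 (deriv fun s => extChartAt 𝓘(ℝ, E) (γ (a * t)) (γ s))]
  simp only [christoffel_eq, map_smul, smul_apply] at h2 ⊢
  rw [← smul_add, ← smul_add, h2, smul_zero, smul_zero]

theorem velocity_comp_mul_left {γ : ℝ → N} (hγ : IsGeodesic (riemMetric 𝓘(ℝ, E) N) γ) (a t : ℝ) :
    velocity 𝓘(ℝ, E) (fun t => γ (a * t)) t = a • velocity 𝓘(ℝ, E) γ (a * t) := by
  have h1 : MDifferentiableAt 𝓘(ℝ, ℝ) 𝓘(ℝ, E) γ (a * t) :=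
    hγ.1.contMDiffAt.mdifferentiableAt (by simp)
  have h2 : MDifferentiableAt 𝓘(ℝ, ℝ) 𝓘(ℝ, E) (fun t => γ (a * t)) t :=
    (hγ.comp_mul_left a).1.contMDiffAt.mdifferentiableAt (by simp)
  rw [← deriv_extChartAt_comp_self h1, ← deriv_extChartAt_comp_self h2]
  exact deriv_comp_mul_left a (fun s => extChartAt 𝓘(ℝ, E) (γ (a * t)) (γ s)) t

/-- Geodesics have constant speed. -/
theorem IsGeodesic.norm_velocity {γ : ℝ → N} (hγ : IsGeodesic (riemMetric 𝓘(ℝ, E) N) γ) (t : ℝ) :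
    ‖velocity 𝓘(ℝ, E) γ t‖ = ‖velocity 𝓘(ℝ, E) γ 0‖ := by
  have hmd : ∀ t, MDifferentiableAt 𝓘(ℝ, ℝ) 𝓘(ℝ, E) γ t := fun t =>
    hγ.1.contMDiffAt.mdifferentiableAt (by simp)
  have hd : ∀ t, HasDerivAt (fun t => inner ℝ (velocity 𝓘(ℝ, E) γ t) (velocity 𝓘(ℝ, E) γ t))
      0 t := by
    intro t
    obtain ⟨p, hp⟩ : ∃ p : N, γ t ∈ (chartAt E p).source := ⟨_, mem_chart_source E _⟩
    have hG := isMetricOn_chartMetric (E := E) p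
    have hc := contDiffAt_extChartAt_comp hγ.1 hp
    have hc1 := (hc.differentiableAt (by simp)).hasDerivAt
    have hc2 := (differentiableAt_deriv_of_contDiffAt hc).hasDerivAt
    rw [hγ.eq_in_chart hp] at hc2
    have hmem : extChartAt 𝓘(ℝ, E) p (γ t) ∈ (extChartAt 𝓘(ℝ, E) p).target :=
      (extChartAt 𝓘(ℝ, E) p).map_source (by rwa [extChartAt_source])
    have hG1 := HasFDerivAt.comp_hasDerivAt (f := fun s => extChartAt 𝓘(ℝ, E) p (γ s)) t
      (l := chartMetric (riemMetric 𝓘(ℝ, E) N) p) (hG.differentiableAt hmem).hasFDerivAt hc1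
    refine (((hG1.clm_apply hc2).clm_apply hc2).congr_deriv ?_).congr_of_eventuallyEq ?_
    · simp only [add_apply, map_neg, neg_apply, Function.comp_apply]
      rw [hG.fderiv_apply hmem]
      ring
    · filter_upwards [eventually_mem_chart_source hγ.1.continuous.continuousAt hp] with s hs
      simp only [Function.comp_apply]
      rw [deriv_extChartAt_comp (hmd s) hs, chartMetric_extChartAt hs]
  have h := is_const_of_deriv_eq_zero (fun t => (hd t).differentiableAt) (fun t => (hd t).deriv) t 0
  simp only [real_inner_self_eq_norm_sq] at h
  exact (sq_eq_sq₀ (norm_nonneg _) (norm_nonneg _)).1 h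

end Geodesics

/-! ### The exponential map within the injectivity radius. -/

section Rays

variable {E : Type*} [NormedAddCommGroup E] [NormedSpace ℝ E]
  {N : Type*} [TopologicalSpace N] [ChartedSpace E N]
  {V : Type*} [NormedAddCommGroup V] [NormedSpace ℝ V]

theorem velocity_comp_smul {A : V → N} {t : ℝ} {v : V}
    (hA : MDifferentiableAt 𝓘(ℝ, V) 𝓘(ℝ, E) A (t • v)) :
    velocity 𝓘(ℝ, E) (fun t : ℝ => A (t • v)) t = mfderiv 𝓘(ℝ, V) 𝓘(ℝ, E) A (t • v) v := by
  have h1 : HasDerivAt (fun t : ℝ => t • v) v t := by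
    simpa using (hasDerivAt_id' t).smul_const v
  have h2 : HasMFDerivAt 𝓘(ℝ, ℝ) 𝓘(ℝ, V) (fun t : ℝ => t • v) t
      (ContinuousLinearMap.toSpanSingleton ℝ v) := h1.hasFDerivAt.hasMFDerivAt
  have h3 := (hA.hasMFDerivAt.comp t h2).mfderiv
  rw [velocity]
  refine (DFunLike.congr_fun h3 (1 : ℝ)).trans ?_
  exact congrArg (mfderiv 𝓘(ℝ, V) 𝓘(ℝ, E) A (t • v)) (one_smul ℝ v)

end Rays

section ExpMap

variable {E : Type*} [NormedAddCommGroup E] [NormedSpace ℝ E] [FiniteDimensional ℝ E]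
  {N : Type*} [TopologicalSpace N] [T2Space N] [ChartedSpace E N] [IsManifold 𝓘(ℝ, E) ∞ N]
  [RiemannianBundle (fun x : N => TangentSpace 𝓘(ℝ, E) x)]
  [IsContMDiffRiemannianBundle 𝓘(ℝ, E) ∞ E (fun x : N => TangentSpace 𝓘(ℝ, E) x)]

omit [FiniteDimensional ℝ E] [T2Space N] [IsManifold 𝓘(ℝ, E) ∞ N]
  [RiemannianBundle (fun x : N => TangentSpace 𝓘(ℝ, E) x)]
  [IsContMDiffRiemannianBundle 𝓘(ℝ, E) ∞ E (fun x : N => TangentSpace 𝓘(ℝ, E) x)] in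
theorem tangentBundle_mk_eq_iff {x y : N} {u : TangentSpace 𝓘(ℝ, E) x}
    {v : TangentSpace 𝓘(ℝ, E) y} :
    (⟨x, u⟩ : TangentBundle 𝓘(ℝ, E) N) = ⟨y, v⟩ ↔ x = y ∧ (u : E) = (v : E) := by
  constructor
  · intro h
    exact ⟨congrArg TotalSpace.proj h, congrArg (fun z : TangentBundle 𝓘(ℝ, E) N => (z.2 : E)) h⟩
  · rintro ⟨rfl, h⟩
    have : u = v := h
    rw [this]

/-- Uniqueness of geodesics makes the choice in the definition of `expMap` irrelevant. -/
theorem expMap_eq {γ : ℝ → N} (hγ : IsGeodesic (riemMetric 𝓘(ℝ, E) N) γ) {p : N}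
    {v : TangentSpace 𝓘(ℝ, E) p} (h0 : γ 0 = p) (hv : (velocity 𝓘(ℝ, E) γ 0 : E) = (v : E)) :
    expMap 𝓘(ℝ, E) p v = γ 1 := by
  have hex : ∃ γ : ℝ → N, IsGeodesic (riemMetric 𝓘(ℝ, E) N) γ ∧
      (⟨γ 0, velocity 𝓘(ℝ, E) γ 0⟩ : TangentBundle 𝓘(ℝ, E) N) = ⟨p, v⟩ :=
    ⟨γ, hγ, tangentBundle_mk_eq_iff.2 ⟨h0, hv⟩⟩
  rw [expMap, dif_pos hex]
  obtain ⟨h1, h2⟩ := tangentBundle_mk_eq_iff.1 hex.choose_spec.2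
  exact congrFun (hex.choose_spec.1.eq_of_sameState hγ (t₀ := 0)
    ⟨h1.trans h0.symm, h2.trans hv.symm⟩) 1

omit [FiniteDimensional ℝ E] [T2Space N] [IsManifold 𝓘(ℝ, E) ∞ N]
  [IsContMDiffRiemannianBundle 𝓘(ℝ, E) ∞ E (fun x : N => TangentSpace 𝓘(ℝ, E) x)] in
theorem expMap_of_not_exists {p : N} {v : TangentSpace 𝓘(ℝ, E) p}
    (h : ¬ ∃ γ : ℝ → N, IsGeodesic (riemMetric 𝓘(ℝ, E) N) γ ∧ γ 0 = p ∧
      (velocity 𝓘(ℝ, E) γ 0 : E) = (v : E)) : expMap 𝓘(ℝ, E) p v = p := by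
  rw [expMap, dif_neg]
  rintro ⟨γ, h1, h2⟩
  exact h ⟨γ, h1, tangentBundle_mk_eq_iff.1 h2⟩

/-- The exponential map at `p` is a diffeomorphism from the ball of radius `r` onto its image. -/
structure IsInjRadius (E : Type*) [NormedAddCommGroup E] [NormedSpace ℝ E] {N : Type*}
    [TopologicalSpace N] [ChartedSpace E N] [RiemannianBundle (fun x : N => TangentSpace 𝓘(ℝ, E) x)]
    (p : N) (r : ℝ) : Prop where
  pos : 0 < r
  injOn : InjOn (expMap 𝓘(ℝ, E) p) (Metric.ball (0 : TangentSpace 𝓘(ℝ, E) p) r)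
  isLocalDiffeomorphOn : IsLocalDiffeomorphOn 𝓘(ℝ, TangentSpace 𝓘(ℝ, E) p) 𝓘(ℝ, E) ∞
    (expMap 𝓘(ℝ, E) p) (Metric.ball (0 : TangentSpace 𝓘(ℝ, E) p) r)

omit [FiniteDimensional ℝ E] [T2Space N] [IsManifold 𝓘(ℝ, E) ∞ N]
  [IsContMDiffRiemannianBundle 𝓘(ℝ, E) ∞ E (fun x : N => TangentSpace 𝓘(ℝ, E) x)] in
theorem isInjRadius_of_le {p : N} {r : ℝ} (hr : 0 < r)
    (h : ENNReal.ofReal r ≤ injRadius 𝓘(ℝ, E) p) : IsInjRadius E p r := by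
  -- The supremum in `injRadius` need not be attained. Two points of the open ball of radius `r`
  -- still lie in a smaller ball, and an admissible `ρ` exceeds its radius.
  have key : ∀ r' < r, ∃ ρ, r' < ρ ∧
      InjOn (expMap 𝓘(ℝ, E) p) (Metric.ball (0 : TangentSpace 𝓘(ℝ, E) p) ρ) ∧
      IsLocalDiffeomorphOn 𝓘(ℝ, TangentSpace 𝓘(ℝ, E) p) 𝓘(ℝ, E) ∞
        (expMap 𝓘(ℝ, E) p) (Metric.ball (0 : TangentSpace 𝓘(ℝ, E) p) ρ) := by
    intro r' hr'
    have h1 : ENNReal.ofReal r' < injRadius 𝓘(ℝ, E) p :=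
      ((ENNReal.ofReal_lt_ofReal_iff hr).2 hr').trans_le h
    rw [injRadius] at h1
    obtain ⟨ρ, h1⟩ := lt_iSup_iff.1 h1
    obtain ⟨hρ, h1⟩ := lt_iSup_iff.1 h1
    exact ⟨ρ, (ENNReal.ofReal_lt_ofReal_iff hρ.1).1 h1, hρ.2⟩
  refine ⟨hr, fun x hx y hy hxy => ?_, fun x => ?_⟩
  · rw [mem_ball_zero_iff] at hx hy
    obtain ⟨ρ, hρ, hi, -⟩ := key (max ‖x‖ ‖y‖) (max_lt hx hy)
    exact hi (mem_ball_zero_iff.2 ((le_max_left _ _).trans_lt hρ))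
      (mem_ball_zero_iff.2 ((le_max_right _ _).trans_lt hρ)) hxy
  · obtain ⟨ρ, hρ, -, hd⟩ := key ‖(x : TangentSpace 𝓘(ℝ, E) p)‖ (mem_ball_zero_iff.1 x.2)
    exact hd ⟨x, mem_ball_zero_iff.2 hρ⟩

namespace IsInjRadius

variable {p : N} {r : ℝ} (h : IsInjRadius E p r)
include h

/-- `expMap` takes the value `p` at vectors that are not initial velocities of geodesics. If some `v
≠ 0` were such a vector, so would be all its nonzero multiples by rescaling time, and `expMap` would
be constant on them, against injectivity near zero. -/
theorem exists_geodesic (v : TangentSpace 𝓘(ℝ, E) p) :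
    ∃ γ : ℝ → N, IsGeodesic (riemMetric 𝓘(ℝ, E) N) γ ∧ γ 0 = p ∧
      (velocity 𝓘(ℝ, E) γ 0 : E) = (v : E) := by
  by_cases hv : v = 0
  · refine ⟨fun _ => p, isGeodesic_const p, rfl, ?_⟩
    rw [hv, ← deriv_extChartAt_comp_self mdifferentiableAt_const]
    simp only [deriv_const]
    rfl
  by_contra hcon
  have key : ∀ a : ℝ, a ≠ 0 → expMap 𝓘(ℝ, E) p (a • v) = p := by
    intro a ha
    refine expMap_of_not_exists ?_
    rintro ⟨γ, h1, h2, h3⟩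
    refine hcon ⟨fun t => γ (a⁻¹ * t), h1.comp_mul_left _, by simpa using h2, ?_⟩
    rw [velocity_comp_mul_left h1]
    have h4 : ∀ t : ℝ, t = 0 → (velocity 𝓘(ℝ, E) γ t : E) = ((a • v : TangentSpace 𝓘(ℝ, E) p) : E) := by
      rintro t rfl; exact h3
    have h5 := h4 (a⁻¹ * 0) (by simp)
    refine (congrArg (fun z : E => a⁻¹ • z) h5).trans ?_
    exact inv_smul_smul₀ ha (v : E)
  have hv0 : 0 < ‖v‖ := norm_pos_iff.2 hv
  have hr := h.pos
  have hm : ∀ a : ℝ, 0 < a → a ≤ 1 / 2 → (a * r / ‖v‖) • v ∈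
      Metric.ball (0 : TangentSpace 𝓘(ℝ, E) p) r := by
    intro a h0 h1
    rw [mem_ball_zero_iff, norm_smul, Real.norm_of_nonneg (by positivity),
      div_mul_cancel₀ _ hv0.ne']
    nlinarith
  -- The contradiction is drawn from the multiples of `v` of length `r/2` and `r/4`.
  have h1 := h.injOn (hm (1 / 2) (by norm_num) le_rfl) (hm (1 / 4) (by norm_num) (by norm_num))
    ((key _ (by positivity)).trans (key _ (by positivity)).symm)
  have h2 := smul_left_injective ℝ hv h1
  field_simp at h2
  norm_num at h2

/-- Homogeneity: the geodesic with initial velocity `t v`, taken at time `1`, is the geodesic with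
initial velocity `v`, taken at time `t`. -/
theorem exists_geodesic_eq (v : TangentSpace 𝓘(ℝ, E) p) :
    IsGeodesic (riemMetric 𝓘(ℝ, E) N) (fun t : ℝ => expMap 𝓘(ℝ, E) p (t • v)) ∧
    expMap 𝓘(ℝ, E) p 0 = p ∧
    (velocity 𝓘(ℝ, E) (fun t : ℝ => expMap 𝓘(ℝ, E) p (t • v)) 0 : E) = (v : E) := by
  obtain ⟨γ, h1, h2, h3⟩ := h.exists_geodesic v
  have h4 : ∀ t : ℝ, expMap 𝓘(ℝ, E) p (t • v) = γ t := by
    intro t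
    rw [expMap_eq (h1.comp_mul_left t) (by simpa using h2), mul_one]
    rw [velocity_comp_mul_left h1]
    have h4 : ∀ s : ℝ, s = 0 → (velocity 𝓘(ℝ, E) γ s : E) = (v : E) := by
      rintro s rfl; exact h3
    exact congrArg (fun z : E => t • z) (h4 (t * 0) (by simp))
  have h5 : (fun t : ℝ => expMap 𝓘(ℝ, E) p (t • v)) = γ := funext h4
  rw [h5]
  refine ⟨h1, ?_, h3⟩
  have := h4 0
  rw [zero_smul] at this
  rw [this, h2]

theorem isGeodesic (v : TangentSpace 𝓘(ℝ, E) p) :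
    IsGeodesic (riemMetric 𝓘(ℝ, E) N) (fun t : ℝ => expMap 𝓘(ℝ, E) p (t • v)) :=
  (h.exists_geodesic_eq v).1

theorem expMap_zero : expMap 𝓘(ℝ, E) p 0 = p := (h.exists_geodesic_eq 0).2.1

theorem isParam : IsParam (E := E) (expMap 𝓘(ℝ, E) p)
    (Metric.ball (0 : TangentSpace 𝓘(ℝ, E) p) r) where
  isOpen := Metric.isOpen_ball
  contMDiffOn := h.isLocalDiffeomorphOn.contMDiffOn
  bijective := fun y hy => by
    have h1 : IsLocalDiffeomorphAt 𝓘(ℝ, TangentSpace 𝓘(ℝ, E) p) 𝓘(ℝ, E) ∞ (expMap 𝓘(ℝ, E) p) y :=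
      h.isLocalDiffeomorphOn ⟨y, hy⟩
    have h2 := h1.mfderivToContinuousLinearEquiv_coe (by simp)
    rw [← h2]
    exact (h1.mfderivToContinuousLinearEquiv (by simp)).bijective

theorem mdifferentiableAt {y : TangentSpace 𝓘(ℝ, E) p}
    (hy : y ∈ Metric.ball (0 : TangentSpace 𝓘(ℝ, E) p) r) :
    MDifferentiableAt 𝓘(ℝ, TangentSpace 𝓘(ℝ, E) p) 𝓘(ℝ, E) (expMap 𝓘(ℝ, E) p) y :=
  (h.isParam.contMDiffOn.contMDiffAt (h.isParam.isOpen.mem_nhds hy)).mdifferentiableAt (by simp)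

theorem velocity_eq {v : TangentSpace 𝓘(ℝ, E) p} {t : ℝ}
    (hv : t • v ∈ Metric.ball (0 : TangentSpace 𝓘(ℝ, E) p) r) :
    velocity 𝓘(ℝ, E) (fun t : ℝ => expMap 𝓘(ℝ, E) p (t • v)) t =
      mfderiv 𝓘(ℝ, TangentSpace 𝓘(ℝ, E) p) 𝓘(ℝ, E) (expMap 𝓘(ℝ, E) p) (t • v) v :=
  velocity_comp_smul (h.mdifferentiableAt hv)

end IsInjRadius

end ExpMap

/-! ### Normal coordinates on `N`. -/

section NormalParam

variable {E : Type*} [NormedAddCommGroup E] [NormedSpace ℝ E] [FiniteDimensional ℝ E]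
  {N : Type*} [TopologicalSpace N] [ChartedSpace E N] [IsManifold 𝓘(ℝ, E) ∞ N]
  [RiemannianBundle (fun x : N => TangentSpace 𝓘(ℝ, E) x)]
  [IsContMDiffRiemannianBundle 𝓘(ℝ, E) ∞ E (fun x : N => TangentSpace 𝓘(ℝ, E) x)]
  {V : Type*} [NormedAddCommGroup V] [InnerProductSpace ℝ V] [FiniteDimensional ℝ V]

/-- The metric of `N` read in the parametrization `A`. -/
def paramMetric (E : Type*) [NormedAddCommGroup E] [NormedSpace ℝ E] {N : Type*}
    [TopologicalSpace N] [ChartedSpace E N] [RiemannianBundle (fun x : N => TangentSpace 𝓘(ℝ, E) x)]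
    {V : Type*} [NormedAddCommGroup V] [NormedSpace ℝ V] (A : V → N) (y : V) :
    V →L[ℝ] V →L[ℝ] ℝ :=
  pullback 𝓘(ℝ, V) (riemMetric 𝓘(ℝ, E) N) A y

/-- `A` is a parametrization by normal coordinates on the ball of radius `r`. -/
structure IsNormalParam (A : V → N) (r : ℝ) : Prop where
  pos : 0 < r
  isParam : IsParam (E := E) A (Metric.ball 0 r)
  injOn : InjOn A (Metric.ball 0 r)
  isLocalDiffeomorphOn : IsLocalDiffeomorphOn 𝓘(ℝ, V) 𝓘(ℝ, E) ∞ A (Metric.ball 0 r)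
  isGeodesic : ∀ v, IsGeodesic (riemMetric 𝓘(ℝ, E) N) fun t : ℝ => A (t • v)
  inner_zero : ∀ u v, paramMetric E A 0 u v = inner ℝ u v

theorem IsInjRadius.isNormalParam [T2Space N] {p : N} {r : ℝ} (h : IsInjRadius E p r) :
    IsNormalParam (E := E) (expMap 𝓘(ℝ, E) p) r where
  pos := h.pos
  isParam := h.isParam
  injOn := h.injOn
  isLocalDiffeomorphOn := h.isLocalDiffeomorphOn
  isGeodesic := h.isGeodesic
  inner_zero := fun u v => by
    have h0 : (0 : TangentSpace 𝓘(ℝ, E) p) ∈ Metric.ball (0 : TangentSpace 𝓘(ℝ, E) p) r :=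
      Metric.mem_ball_self h.pos
    -- The differential of `exp_p` at `0` is the identity, because `t ↦ exp_p (t w)` has initial
    -- velocity `w`.
    have key : ∀ w : TangentSpace 𝓘(ℝ, E) p,
        (mfderiv 𝓘(ℝ, TangentSpace 𝓘(ℝ, E) p) 𝓘(ℝ, E) (expMap 𝓘(ℝ, E) p) 0 w : E) = (w : E) := by
      intro w
      have h1 := h.velocity_eq (v := w) (t := 0) (by rwa [zero_smul])
      have h2 : ∀ z : TangentSpace 𝓘(ℝ, E) p, z = 0 →
          (mfderiv 𝓘(ℝ, TangentSpace 𝓘(ℝ, E) p) 𝓘(ℝ, E) (expMap 𝓘(ℝ, E) p) z w : E) =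
          (mfderiv 𝓘(ℝ, TangentSpace 𝓘(ℝ, E) p) 𝓘(ℝ, E) (expMap 𝓘(ℝ, E) p) 0 w : E) := by
        rintro z rfl; rfl
      exact (h2 _ (zero_smul ℝ w)).symm.trans (h1.symm.trans (h.exists_geodesic_eq w).2.2)
    change pullback 𝓘(ℝ, TangentSpace 𝓘(ℝ, E) p) (riemMetric 𝓘(ℝ, E) N) (expMap 𝓘(ℝ, E) p) 0 u v = _
    exact metricField_congr (riemMetric 𝓘(ℝ, E) N) h.expMap_zero (key u) (key v)

namespace IsNormalParam

variable {A : V → N} {r : ℝ} (h : IsNormalParam (E := E) A r)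
include h

theorem mdifferentiableAt {y : V} (hy : y ∈ Metric.ball (0 : V) r) :
    MDifferentiableAt 𝓘(ℝ, V) 𝓘(ℝ, E) A y :=
  (h.isParam.contMDiffOn.contMDiffAt (h.isParam.isOpen.mem_nhds hy)).mdifferentiableAt (by simp)

/-- The segment `t y` has zero second derivative in the parameter space and is mapped to a geodesic.
By naturality its geodesic equation at `t = 1` reads `DΦ(Γ(y, y)) = 0`, and `DΦ` is injective. -/
theorem isNormalMetric : IsNormalMetric (paramMetric E A) r where
  isMetricOn := h.isParam.isMetricOn
  inner_zero := h.inner_zero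
  ray := fun y hy => by
    obtain ⟨p, hp⟩ : ∃ p : N, A y ∈ (chartAt E p).source := ⟨_, mem_chart_source E _⟩
    have hΦ := h.isParam.isMetricMap p
    have hy' : y ∈ paramDomain (E := E) A (Metric.ball 0 r) p := ⟨hy, hp⟩
    have hp1 : A ((1 : ℝ) • y) ∈ (chartAt E p).source := by rwa [one_smul]
    have h1 := (h.isGeodesic y).eq_in_chart hp1
    have hc : ∀ t, HasDerivAt (fun t : ℝ => t • y) y t := fun t => by
      simpa using (hasDerivAt_id' t).smul_const y
    have hcd : ContDiffAt ℝ ∞ (fun t : ℝ => t • y) 1 := contDiffAt_id.smul contDiffAt_const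
    have hd : deriv (fun t : ℝ => t • y) = fun _ => y := funext fun t => (hc t).deriv
    have hy1 : (1 : ℝ) • y ∈ paramDomain (E := E) A (Metric.ball 0 r) p := by rwa [one_smul]
    rw [deriv_deriv_comp_curve (Φ := fun z => extChartAt 𝓘(ℝ, E) p (A z)) (c := fun t : ℝ => t • y)
      (hΦ.contDiffAt hy1) hcd,
      deriv_comp_curve (Φ := fun z => extChartAt 𝓘(ℝ, E) p (A z)) (c := fun t : ℝ => t • y)
      (hΦ.differentiableAt hy1) (hc 1).differentiableAt] at h1
    simp only [hd, one_smul, deriv_const, map_zero, add_zero] at h1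
    have h2 := hΦ.map_christoffel (fun y hy => (h.isParam.bijective_fderiv p hy).2) hy' y y
    rw [h1, neg_add_cancel] at h2
    exact (h.isParam.bijective_fderiv p hy').1 (h2.trans (map_zero _).symm)

theorem metric_apply (y u v : V) : paramMetric E A y u v =
    inner ℝ (mfderiv 𝓘(ℝ, V) 𝓘(ℝ, E) A y u) (mfderiv 𝓘(ℝ, V) 𝓘(ℝ, E) A y v) := rfl

theorem velocity_eq {θ : V} {t : ℝ} (ht : t • θ ∈ Metric.ball (0 : V) r) :
    velocity 𝓘(ℝ, E) (fun t : ℝ => A (t • θ)) t = mfderiv 𝓘(ℝ, V) 𝓘(ℝ, E) A (t • θ) θ :=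
  velocity_comp_smul (h.mdifferentiableAt ht)

theorem norm_velocity {θ : V} (hθ : ‖θ‖ = 1) (t : ℝ) :
    ‖velocity 𝓘(ℝ, E) (fun t : ℝ => A (t • θ)) t‖ = 1 := by
  rw [(h.isGeodesic θ).norm_velocity, ← sq_eq_sq₀ (norm_nonneg _) zero_le_one,
    ← real_inner_self_eq_norm_sq,
    h.velocity_eq (by rw [zero_smul]; exact Metric.mem_ball_self h.pos), ← h.metric_apply,
    zero_smul]
  rw [h.inner_zero, real_inner_self_eq_norm_sq, hθ]

/-- The ray is a unit-speed geodesic whose velocity corresponds to `θ`, and the Gauss lemma turns `w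
⊥ θ` at the origin into orthogonality along the ray. Sectional curvature is read in the parameter
space by naturality, and `curvatureForm_swap` moves it into the form in which the Jacobi equation
uses it. -/
theorem curvature_le {κ : ℝ} (hκ : RadialCurvatureLE 𝓘(ℝ, E) (A 0) κ) {θ : V} (hθ : ‖θ‖ = 1)
    {t : ℝ} (ht : 0 < t) (htr : t < r) (w : V) (hw : inner ℝ θ w = 0) :
    paramMetric E A (t • θ)
      (curvatureForm (paramMetric E A) (t • θ) w θ θ) w ≤
    κ * paramMetric E A (t • θ) w w := by
  have hy : t • θ ∈ Metric.ball (0 : V) r := by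
    rw [mem_ball_zero_iff, norm_smul, hθ, Real.norm_of_nonneg ht.le]; linarith
  by_cases hw0 : w = 0
  · simp [hw0]
  have hK := h.isNormalMetric
  set K := paramMetric E A with hKdef
  have hKw : 0 < K (t • θ) w w := hK.isMetricOn.pos _ hy w hw0
  have hperp : K (t • θ) θ w = 0 := by
    have := hK.gauss hy w
    rw [map_smul, smul_apply, real_inner_smul_left, hw, mul_zero, smul_eq_mul] at this
    exact (mul_eq_zero.1 this).resolve_left ht.ne'
  -- The curvature hypothesis concerns unit vectors, so `w` is divided by its length at `t θ`.
  set s : ℝ := (√(K (t • θ) w w))⁻¹ with hs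
  have hss : s ^ 2 * K (t • θ) w w = 1 := by
    rw [hs, inv_pow, Real.sq_sqrt hKw.le, inv_mul_cancel₀ hKw.ne']
  set y : V := t • θ with hydef
  have hvel := h.velocity_eq hy
  rw [← hydef] at hvel
  have hθθ : K y θ θ = 1 := by
    rw [hKdef, h.metric_apply, real_inner_self_eq_norm_sq, ← hvel, h.norm_velocity hθ, one_pow]
  have h1 := hκ (fun t : ℝ => A (t • θ)) (h.isGeodesic θ) (by simp) (h.norm_velocity hθ) t ht
    (mfderiv 𝓘(ℝ, V) 𝓘(ℝ, E) A y (s • w))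
    (by
      rw [← sq_eq_sq₀ (norm_nonneg _) zero_le_one, ← real_inner_self_eq_norm_sq]
      change K y (s • w) (s • w) = _
      simp only [map_smul, smul_apply, smul_eq_mul]
      linarith)
    (by
      rw [hvel]
      change K y θ (s • w) = 0
      rw [map_smul, hperp, smul_zero])
  rw [hvel] at h1
  have hp : A y ∈ (chartAt E (A y)).source := mem_chart_source E _
  have hΦ := h.isParam.isMetricMap (A y)
  have hy' : y ∈ paramDomain (E := E) A (Metric.ball 0 r) (A y) := ⟨hy, hp⟩
  have hsec : ∀ a b : V, sectionalCurvature (riemMetric 𝓘(ℝ, E) N) (A y)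
      (mfderiv 𝓘(ℝ, V) 𝓘(ℝ, E) A y a) (mfderiv 𝓘(ℝ, V) 𝓘(ℝ, E) A y b) =
      K y (curvatureForm K y a b b) a / (K y a a * K y b b - K y a b ^ 2) := by
    intro a b
    simp only [sectionalCurvature]
    rw [← fderiv_extChartAt_comp (h.mdifferentiableAt hy) hp,
      ← fderiv_extChartAt_comp (h.mdifferentiableAt hy) hp,
      ← hΦ.map_curvatureForm (fun z hz => (h.isParam.bijective_fderiv (A y) hz).2) hy',
      ← hΦ.eq y hy', ← hΦ.eq y hy', ← hΦ.eq y hy', ← hΦ.eq y hy']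
    rfl
  have h2 := (hsec θ (s • w)).symm.trans_le h1
  rw [hK.isMetricOn.curvatureForm_swap hy] at h2
  have h3 : curvatureForm K y (s • w) θ θ = s • curvatureForm K y w θ θ := by
    rw [hK.isMetricOn.curvatureForm_eq hy, hK.isMetricOn.curvatureForm_eq hy]
    simp only [map_smul, smul_apply, smul_sub, smul_add]
  rw [h3, hθθ] at h2
  simp only [map_smul, smul_apply, smul_eq_mul, hperp, mul_zero] at h2
  have h4 : s * (s * K y w w) = 1 := by rw [← hss]; ring
  rw [h4] at h2
  norm_num at h2
  have h5 : K y (curvatureForm K y w θ θ) w =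
      s * (s * K y (curvatureForm K y w θ θ) w) * K y w w := by
    linear_combination (-K y (curvatureForm K y w θ θ) w) * hss
  rw [h5]
  exact mul_le_mul_of_nonneg_right (by linarith) hKw.le

end IsNormalParam

end NormalParam

/-! ### Half the squared radius as a smooth function on `N`. -/

section RadialEnergy

variable {E : Type*} [NormedAddCommGroup E] [NormedSpace ℝ E] [FiniteDimensional ℝ E]
  {N : Type*} [TopologicalSpace N] [ChartedSpace E N] [IsManifold 𝓘(ℝ, E) ∞ N]
  [RiemannianBundle (fun x : N => TangentSpace 𝓘(ℝ, E) x)]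
  [IsContMDiffRiemannianBundle 𝓘(ℝ, E) ∞ E (fun x : N => TangentSpace 𝓘(ℝ, E) x)]
  {V : Type*} [NormedAddCommGroup V] [InnerProductSpace ℝ V] [FiniteDimensional ℝ V]

/-- The inverse of a parametrization of the ball of radius `r`. -/
def paramInv (A : V → N) (r : ℝ) (z : N) : V := Function.invFunOn A (Metric.ball 0 r) z

/-- Half of the squared distance to the centre, read through normal coordinates. -/
def radialEnergy (A : V → N) (r : ℝ) (z : N) : ℝ :=
  (1 / 2 : ℝ) * inner ℝ (paramInv A r z) (paramInv A r z)

namespace IsNormalParam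

variable {A : V → N} {r : ℝ} (h : IsNormalParam (E := E) A r)
include h

theorem paramInv_apply {v : V} (hv : v ∈ Metric.ball (0 : V) r) : paramInv A r (A v) = v :=
  h.injOn.leftInvOn_invFunOn hv

theorem radialEnergy_apply {v : V} (hv : v ∈ Metric.ball (0 : V) r) :
    radialEnergy A r (A v) = (1 / 2 : ℝ) * inner ℝ v v := by
  rw [radialEnergy, h.paramInv_apply hv]

/-- `paramInv` is only a set-theoretic choice of inverse. Its smoothness comes from these local
inverses, which agree with it near `A v` by injectivity on the ball. -/
theorem exists_localInverse {v : V} (hv : v ∈ Metric.ball (0 : V) r) :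
    ∃ Ψ : N → V, ContMDiffAt 𝓘(ℝ, E) 𝓘(ℝ, V) ∞ Ψ (A v) ∧
      ∀ᶠ z in 𝓝 (A v), A (Ψ z) = z ∧ Ψ z ∈ Metric.ball (0 : V) r := by
  have h1 : IsLocalDiffeomorphAt 𝓘(ℝ, V) 𝓘(ℝ, E) ∞ A v := h.isLocalDiffeomorphOn ⟨v, hv⟩
  refine ⟨h1.localInverse, h1.localInverse_contMDiffAt, ?_⟩
  have h2 := h1.localInverse_contMDiffAt.continuousAt
  have h3 : h1.localInverse (A v) = v :=
    h1.localInverse_left_inv h1.localInverse_mem_target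
  filter_upwards [h1.localInverse.open_source.mem_nhds h1.localInverse_mem_source,
    h2.eventually (Metric.isOpen_ball.mem_nhds (by rw [h3]; exact hv))] with z hz hz'
  exact ⟨h1.localInverse_right_inv hz, hz'⟩

theorem isOpen_image : IsOpen (A '' Metric.ball (0 : V) r) := by
  rw [isOpen_iff_mem_nhds]
  rintro _ ⟨v, hv, rfl⟩
  obtain ⟨Ψ, -, hΨ⟩ := h.exists_localInverse hv
  filter_upwards [hΨ] with z hz
  exact ⟨Ψ z, hz.2, hz.1⟩

theorem contMDiffAt_radialEnergy {z : N} (hz : z ∈ A '' Metric.ball (0 : V) r) :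
    ContMDiffAt 𝓘(ℝ, E) 𝓘(ℝ, ℝ) ∞ (radialEnergy A r) z := by
  obtain ⟨v, hv, rfl⟩ := hz
  obtain ⟨Ψ, h1, h2⟩ := h.exists_localInverse hv
  have h3 : radialEnergy A r =ᶠ[𝓝 (A v)] fun z => (1 / 2 : ℝ) * inner ℝ (Ψ z) (Ψ z) := by
    filter_upwards [h2] with z hz
    conv_lhs => rw [← hz.1]
    exact h.radialEnergy_apply hz.2
  refine ContMDiffAt.congr_of_eventuallyEq ?_ h3
  have h4 : ContDiff ℝ ∞ fun z : V => (1 / 2 : ℝ) * inner ℝ z z :=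
    contDiff_const.mul (contDiff_id.inner ℝ contDiff_id)
  exact h4.contMDiff.contMDiffAt.comp (A v) h1

theorem radialEnergy_comp_eventuallyEq {v : V} (hv : v ∈ Metric.ball (0 : V) r) :
    (fun z => radialEnergy A r (A z)) =ᶠ[𝓝 v] fun z => (1 / 2 : ℝ) * inner ℝ z z := by
  filter_upwards [Metric.isOpen_ball.mem_nhds hv] with z hz
  exact h.radialEnergy_apply hz

theorem mvfderiv_radialEnergy {v : V} (hv : v ∈ Metric.ball (0 : V) r) (w : V) :
    mvfderiv 𝓘(ℝ, E) (radialEnergy A r) (A v) (mfderiv 𝓘(ℝ, V) 𝓘(ℝ, E) A v w) =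
      inner ℝ v w := by
  have h1 := mfderiv_comp (I := 𝓘(ℝ, V)) (I' := 𝓘(ℝ, E)) (I'' := 𝓘(ℝ, ℝ)) v
    ((h.contMDiffAt_radialEnergy ⟨v, hv, rfl⟩).mdifferentiableAt (by simp)) (h.mdifferentiableAt hv)
  have h2 : HasFDerivAt (fun z : V => (1 / 2 : ℝ) * inner ℝ z z) (innerSL ℝ v) v := by
    refine (((hasFDerivAt_id v).inner ℝ (hasFDerivAt_id v)).const_mul (1 / 2 : ℝ)).congr_fderiv ?_
    ext w
    simp [real_inner_comm]
    ring
  have h3 : mfderiv 𝓘(ℝ, V) 𝓘(ℝ, ℝ) (radialEnergy A r ∘ A) v = innerSL ℝ v := by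
    rw [mfderiv_eq_fderiv]
    exact (h2.congr_of_eventuallyEq (h.radialEnergy_comp_eventuallyEq hv)).fderiv
  rw [h1] at h3
  exact DFunLike.congr_fun h3 w

/-- With `X = dA w`, the Gauss lemma turns the derivative `⟨v, w⟩` into the inner product of `dA v`
and `X`. Cauchy–Schwarz and `|dA v| = |v|` finish. -/
theorem abs_mvfderiv_radialEnergy_le {z : N} (hz : z ∈ A '' Metric.ball (0 : V) r)
    (X : TangentSpace 𝓘(ℝ, E) z) :
    |mvfderiv 𝓘(ℝ, E) (radialEnergy A r) z X| ≤ ‖paramInv A r z‖ * ‖X‖ := by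
  obtain ⟨v, hv, rfl⟩ := hz
  obtain ⟨w, hw⟩ : ∃ w : V, mfderiv 𝓘(ℝ, V) 𝓘(ℝ, E) A v w = X := (h.isParam.bijective v hv).2 X
  subst hw
  rw [h.mvfderiv_radialEnergy hv, h.paramInv_apply hv, ← h.isNormalMetric.gauss hv]
  refine abs_le_of_sq_le_sq ?_ (by positivity)
  have h1 : inner ℝ (mfderiv 𝓘(ℝ, V) 𝓘(ℝ, E) A v v) (mfderiv 𝓘(ℝ, V) 𝓘(ℝ, E) A v w) ^ 2 ≤
      (‖mfderiv 𝓘(ℝ, V) 𝓘(ℝ, E) A v v‖ * ‖mfderiv 𝓘(ℝ, V) 𝓘(ℝ, E) A v w‖) ^ 2 := by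
    rw [← sq_abs]
    gcongr
    exact abs_real_inner_le_norm _ _
  refine h1.trans_eq ?_
  have h2 : ‖mfderiv 𝓘(ℝ, V) 𝓘(ℝ, E) A v v‖ ^ 2 = ‖v‖ ^ 2 := by
    rw [← real_inner_self_eq_norm_sq, ← real_inner_self_eq_norm_sq]
    exact h.isNormalMetric.apply_self hv
  rw [mul_pow, mul_pow, h2]

end IsNormalParam

end RadialEnergy

/-! ### Metric balls lie in the image of the exponential map. -/

section Curves

variable {E : Type*} [NormedAddCommGroup E] [NormedSpace ℝ E]
  {N : Type*} [TopologicalSpace N] [ChartedSpace E N]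

theorem hasDerivAt_comp_curve {u : N → ℝ} {γ : ℝ → N} {t : ℝ}
    (hu : MDifferentiableAt 𝓘(ℝ, E) 𝓘(ℝ, ℝ) u (γ t)) (hγ : MDifferentiableAt 𝓘(ℝ, ℝ) 𝓘(ℝ, E) γ t) :
    HasDerivAt (fun s => u (γ s)) (mvfderiv 𝓘(ℝ, E) u (γ t) (velocity 𝓘(ℝ, E) γ t)) t := by
  have h1 : DifferentiableAt ℝ (fun s => u (γ s)) t :=
    mdifferentiableAt_iff_differentiableAt.1 (hu.comp t hγ)
  refine h1.hasDerivAt.congr_deriv ?_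
  rw [← fderiv_apply_one_eq_deriv, ← mfderiv_eq_fderiv]
  exact DFunLike.congr_fun (mfderiv_comp t hu hγ) (1 : ℝ)

end Curves

section Ball

variable {E : Type*} [NormedAddCommGroup E] [NormedSpace ℝ E] [FiniteDimensional ℝ E]
  {N : Type*} [MetricSpace N] [ChartedSpace E N] [IsManifold 𝓘(ℝ, E) ∞ N]
  [RiemannianBundle (fun x : N => TangentSpace 𝓘(ℝ, E) x)]
  [IsContMDiffRiemannianBundle 𝓘(ℝ, E) ∞ E (fun x : N => TangentSpace 𝓘(ℝ, E) x)]
  [IsRiemannianManifold 𝓘(ℝ, E) N]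
  {V : Type*} [NormedAddCommGroup V] [InnerProductSpace ℝ V] [FiniteDimensional ℝ V]

namespace IsNormalParam

variable {A : V → N} {r : ℝ} (h : IsNormalParam (E := E) A r)
include h

/-- The radius has gradient of length at most one, so it grows at most like arc length. As it is not
differentiable at the centre, `√(radius² + ε²)` is used instead, at the cost of an additive `ε`. -/
theorem norm_paramInv_le_pathELength {γ : ℝ → N} (hγ : ContMDiff 𝓘(ℝ, ℝ) 𝓘(ℝ, E) 1 γ)
    (h0 : γ 0 = A 0) {t : ℝ} (ht : 0 ≤ t) (hmem : ∀ s ∈ Icc 0 t, γ s ∈ A '' Metric.ball (0 : V) r) :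
    ENNReal.ofReal ‖paramInv A r (γ t)‖ ≤ Manifold.pathELength 𝓘(ℝ, E) γ 0 t := by
  refine ENNReal.le_of_forall_pos_le_add fun ε hε _ => ?_
  set g : ℝ → ℝ := fun s => √(2 * radialEnergy A r (γ s) + (ε : ℝ) ^ 2) with hg
  have hnn : ∀ s, 2 * radialEnergy A r (γ s) = ‖paramInv A r (γ s)‖ ^ 2 := fun s => by
    rw [radialEnergy, real_inner_self_eq_norm_sq]; ring
  have hpos : ∀ s, 0 < 2 * radialEnergy A r (γ s) + (ε : ℝ) ^ 2 := fun s => by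
    rw [hnn]; positivity
  have hcd : ContDiffOn ℝ 1 g (Icc 0 t) := by
    intro s hs
    have h1 : ContMDiffAt 𝓘(ℝ, ℝ) 𝓘(ℝ, ℝ) 1 (fun s => radialEnergy A r (γ s)) s :=
      ((h.contMDiffAt_radialEnergy (hmem s hs)).of_le ENat.LEInfty.out).comp s hγ.contMDiffAt
    rw [contMDiffAt_iff_contDiffAt] at h1
    exact ((((contDiffAt_const.mul h1).add contDiffAt_const).sqrt (hpos s).ne')).contDiffWithinAt
  have hderiv : ∀ s ∈ Icc 0 t, ‖deriv g s‖ₑ ≤ ‖velocity 𝓘(ℝ, E) γ s‖ₑ := by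
    intro s hs
    have h1 := hasDerivAt_comp_curve
      ((h.contMDiffAt_radialEnergy (hmem s hs)).mdifferentiableAt (by simp))
      (hγ.contMDiffAt.mdifferentiableAt (x := s) (by simp))
    have h2 := ((h1.const_mul 2).add_const ((ε : ℝ) ^ 2)).sqrt (hpos s).ne'
    rw [h2.deriv, ← ofReal_norm, ← ofReal_norm]
    refine ENNReal.ofReal_le_ofReal ?_
    have h3 := h.abs_mvfderiv_radialEnergy_le (hmem s hs) (velocity 𝓘(ℝ, E) γ s)
    have h4 : ‖paramInv A r (γ s)‖ ≤ √(2 * radialEnergy A r (γ s) + (ε : ℝ) ^ 2) := by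
      refine Real.le_sqrt_of_sq_le ?_
      rw [hnn]
      have := sq_nonneg (ε : ℝ)
      linarith
    have h5 := Real.sqrt_pos.2 (hpos s)
    rw [Real.norm_eq_abs, mul_div_mul_left _ _ two_ne_zero, abs_div, abs_of_pos h5, div_le_iff₀ h5]
    refine h3.trans ?_
    rw [mul_comm]
    gcongr
  have h1 := enorm_sub_le_lintegral_deriv_of_contDiffOn_Icc hcd ht
  have h2 : ∫⁻ s in Icc 0 t, ‖deriv g s‖ₑ ≤ Manifold.pathELength 𝓘(ℝ, E) γ 0 t := by
    rw [Manifold.pathELength_eq_lintegral_mfderiv_Icc]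
    exact setLIntegral_mono' measurableSet_Icc hderiv
  have h3 : g 0 = ε := by
    simp only [hg, hnn, h0]
    rw [h.paramInv_apply (Metric.mem_ball_self h.pos)]
    simp
  have h4 : ‖paramInv A r (γ t)‖ ≤ g t := by
    refine Real.le_sqrt_of_sq_le ?_
    rw [hnn]
    have := sq_nonneg (ε : ℝ)
    linarith
  have h5 : ENNReal.ofReal (g t - g 0) ≤ ‖g t - g 0‖ₑ := by
    rw [← ofReal_norm]
    exact ENNReal.ofReal_le_ofReal (le_abs_self _)
  calc ENNReal.ofReal ‖paramInv A r (γ t)‖ ≤ ENNReal.ofReal ((g t - g 0) + ε) :=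
        ENNReal.ofReal_le_ofReal (by rw [h3]; linarith)
    _ ≤ ENNReal.ofReal (g t - g 0) + ENNReal.ofReal ε := ENNReal.ofReal_add_le
    _ ≤ _ := by
      rw [ENNReal.ofReal_coe_nnreal]
      gcongr
      exact h5.trans (h1.trans h2)

/-- A point at distance less than `r` is joined to the centre by a curve of length `L < r`. Until it
leaves the image of the ball this curve stays in the image of the closed ball of radius `L`, which
is compact, so it never leaves. -/
theorem ball_subset_image : Metric.ball (A 0) r ⊆ A '' Metric.ball (0 : V) r := by
  intro y hy
  have h1 : Manifold.riemannianEDist 𝓘(ℝ, E) (A 0) y < ENNReal.ofReal r := by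
    rw [← IsRiemannianManifold.out (I := 𝓘(ℝ, E)), edist_dist, dist_comm]
    exact (ENNReal.ofReal_lt_ofReal_iff h.pos).2 hy
  obtain ⟨γ, h0, hy1, hγ, hlen, -, -⟩ :=
    Manifold.exists_lt_locally_constant_of_riemannianEDist_lt h1 zero_lt_one
  set L := (Manifold.pathELength 𝓘(ℝ, E) γ 0 1).toReal with hL
  have hLr : L < r := by
    rw [hL, ← ENNReal.lt_ofReal_iff_toReal_lt (ne_top_of_lt hlen)]
    exact hlen
  have hC : IsCompact (A '' Metric.closedBall (0 : V) L) :=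
    (isCompact_closedBall 0 L).image_of_continuousOn
      (h.isParam.contMDiffOn.continuousOn.mono (Metric.closedBall_subset_ball hLr))
  have hCW : A '' Metric.closedBall (0 : V) L ⊆ A '' Metric.ball (0 : V) r :=
    image_mono (Metric.closedBall_subset_ball hLr)
  by_contra hcon
  -- The exit times form a compact set, because the image of the open ball is open; `s` is the first
  -- of them.
  set T := {t ∈ Icc (0 : ℝ) 1 | γ t ∉ A '' Metric.ball (0 : V) r} with hT
  have hTc : IsCompact T := isCompact_Icc.inter_right
    ((h.isOpen_image.preimage hγ.continuous).isClosed_compl)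
  have hTn : T.Nonempty := ⟨1, ⟨by simp, by rwa [hy1]⟩⟩
  obtain ⟨s, hs, hmin⟩ := hTc.exists_isLeast hTn
  have hs0 : 0 < s := by
    refine lt_of_le_of_ne hs.1.1 fun h2 => hs.2 ?_
    rw [← h2, h0]
    exact ⟨0, Metric.mem_ball_self h.pos, rfl⟩
  have hlt : ∀ t ∈ Ico 0 s, γ t ∈ A '' Metric.closedBall (0 : V) L := by
    intro t ht
    have hmem : ∀ t' ∈ Icc 0 t, γ t' ∈ A '' Metric.ball (0 : V) r := by
      intro t' ht'
      by_contra h2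
      have := hmin (show t' ∈ T from ⟨⟨ht'.1, by linarith [ht'.2, ht.2, hs.1.2]⟩, h2⟩)
      linarith [ht'.2, ht.2]
    have h3 := (h.norm_paramInv_le_pathELength hγ h0 ht.1 hmem).trans
      (Manifold.pathELength_mono (b' := 1) le_rfl (by linarith [ht.2, hs.1.2]))
    obtain ⟨v, hv, hvt⟩ := hmem t ⟨ht.1, le_rfl⟩
    refine ⟨v, ?_, hvt⟩
    rw [← hvt, h.paramInv_apply hv] at h3
    rw [mem_closedBall_zero_iff, hL]
    exact (ENNReal.ofReal_le_iff_le_toReal (ne_top_of_lt hlen)).1 h3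
  -- The point `γ s` is a limit of points of a closed set contained in the image, which contradicts
  -- the choice of `s`.
  have hs1 : s ∈ closure (Ico 0 s) := by
    rw [closure_Ico hs0.ne]; exact ⟨hs0.le, le_rfl⟩
  have := hC.isClosed.closure_subset_iff.2 (image_subset_iff.2 (fun t ht => hlt t ht) :
    γ '' Ico 0 s ⊆ A '' Metric.closedBall (0 : V) L)
  exact hs.2 (hCW (this (image_closure_subset_closure_image hγ.continuous ⟨s, hs1, rfl⟩)))

end IsNormalParam

end Ball

/-! ### Hessian comparison for the squared radius on `N`. -/

/-- The function `ρ ↦ ρ C_κ(ρ) / S_κ(ρ)`, extended by its limit at `0`. -/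
def radialCoeff (κ ρ : ℝ) : ℝ := if ρ = 0 then 1 else ρ * (compC κ ρ / compS κ ρ)

theorem mem_compDomain_of_le_half {κ ρ : ℝ} (h0 : 0 < ρ) (h : 0 < κ → ρ ≤ Real.pi / (2 * √κ)) :
    ρ ∈ compDomain κ := by
  refine ⟨h0, fun hκ => (h hκ).trans_lt ?_⟩
  have := Real.sqrt_pos.2 hκ
  gcongr
  linarith

theorem radialCoeff_nonneg {κ ρ : ℝ} (h0 : 0 ≤ ρ) (h : 0 < κ → ρ ≤ Real.pi / (2 * √κ)) :
    0 ≤ radialCoeff κ ρ := by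
  unfold radialCoeff
  split_ifs with h1
  · exact zero_le_one
  · exact mul_nonneg h0 (div_nonneg (compC_nonneg h0 h)
      (compS_pos (mem_compDomain_of_le_half (lt_of_le_of_ne h0 (Ne.symm h1)) h)).le)

/-- Continuity at `0` comes from writing the coefficient as `C_κ` over the difference quotient of
`S_κ` at `0`, which `dslope` extends by `S_κ'(0) = 1`. -/
theorem continuousOn_radialCoeff {κ r : ℝ} (h : 0 < κ → r ≤ Real.pi / (2 * √κ)) :
    ContinuousOn (radialCoeff κ) (Icc 0 r) := by
  have hS : ContinuousAt (dslope (compS κ) 0) 0 :=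
    continuousAt_dslope_same.2 (hasDerivAt_compS κ 0).differentiableAt
  have heq : ∀ ρ, radialCoeff κ ρ = compC κ ρ / dslope (compS κ) 0 ρ := by
    intro ρ
    by_cases h1 : ρ = 0
    · rw [radialCoeff, if_pos h1, h1, dslope_same, (hasDerivAt_compS κ 0).deriv, div_self]
      rw [compC_zero]; exact one_ne_zero
    · rw [radialCoeff, if_neg h1, dslope_of_ne _ h1, slope_def_field, compS_zero, sub_zero, sub_zero]
      field_simp
  intro ρ hρ
  have h2 : radialCoeff κ = fun ρ => compC κ ρ / dslope (compS κ) 0 ρ := funext heq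
  rw [h2]
  have hC := (hasDerivAt_compC κ ρ).continuousAt
  by_cases h1 : ρ = 0
  · subst h1
    refine (hC.div hS ?_).continuousWithinAt
    rw [dslope_same, (hasDerivAt_compS κ 0).deriv, compC_zero]
    exact one_ne_zero
  · refine (hC.div ((continuousAt_dslope_of_ne h1).2
      (hasDerivAt_compS κ ρ).continuousAt) ?_).continuousWithinAt
    rw [dslope_of_ne _ h1, slope_def_field, compS_zero, sub_zero, sub_zero]
    exact div_ne_zero (compS_pos (mem_compDomain_of_le_half (lt_of_le_of_ne hρ.1 (Ne.symm h1))
      fun hκ => hρ.2.trans (h hκ))).ne' h1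

section RadialHessian

variable {E : Type*} [NormedAddCommGroup E] [NormedSpace ℝ E] [FiniteDimensional ℝ E]
  {N : Type*} [TopologicalSpace N] [ChartedSpace E N] [IsManifold 𝓘(ℝ, E) ∞ N]
  [RiemannianBundle (fun x : N => TangentSpace 𝓘(ℝ, E) x)]
  [IsContMDiffRiemannianBundle 𝓘(ℝ, E) ∞ E (fun x : N => TangentSpace 𝓘(ℝ, E) x)]
  {V : Type*} [NormedAddCommGroup V] [InnerProductSpace ℝ V] [FiniteDimensional ℝ V]

theorem contDiffAt_comp_extChartAt_symm {u : N → ℝ} {z p : N}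
    (hu : ContMDiffAt 𝓘(ℝ, E) 𝓘(ℝ, ℝ) ∞ u z) (hz : z ∈ (chartAt E p).source) :
    ContDiffAt ℝ ∞ (fun y => u ((extChartAt 𝓘(ℝ, E) p).symm y)) (extChartAt 𝓘(ℝ, E) p z) := by
  have hz' : z ∈ (extChartAt 𝓘(ℝ, E) p).source := by rwa [extChartAt_source]
  rw [← contMDiffAt_iff_contDiffAt]
  have h1 : ContMDiffAt 𝓘(ℝ, E) 𝓘(ℝ, E) ∞ (extChartAt 𝓘(ℝ, E) p).symm (extChartAt 𝓘(ℝ, E) p z) :=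
    (contMDiffOn_extChartAt_symm p).contMDiffAt
      ((isOpen_extChartAt_target p).mem_nhds ((extChartAt 𝓘(ℝ, E) p).map_source hz'))
  refine ContMDiffAt.comp _ ?_ h1
  rwa [(extChartAt 𝓘(ℝ, E) p).left_inv hz']

namespace IsNormalParam

variable {A : V → N} {r : ℝ} (h : IsNormalParam (E := E) A r)
include h

/-- Hessian comparison for the function `radialEnergy`. -/
theorem exists_hess_radialEnergy_le {κ : ℝ} (hr : 0 < κ → r ≤ Real.pi / (2 * √κ))
    (hκ : RadialCurvatureLE 𝓘(ℝ, E) (A 0) κ) {z p : N} (hz : z ∈ A '' Metric.ball (0 : V) r)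
    (hp : z ∈ (chartAt E p).source) :
    ∃ ν : E →ₗ[ℝ] ℝ,
      (∀ w, fderiv ℝ (fun y => radialEnergy A r ((extChartAt 𝓘(ℝ, E) p).symm y))
        (extChartAt 𝓘(ℝ, E) p z) w = ‖paramInv A r z‖ * ν w) ∧
      (∀ w, ν w ^ 2 ≤ chartMetric (riemMetric 𝓘(ℝ, E) N) p (extChartAt 𝓘(ℝ, E) p z) w w) ∧
      ∀ w, radialCoeff κ ‖paramInv A r z‖ *
        (chartMetric (riemMetric 𝓘(ℝ, E) N) p (extChartAt 𝓘(ℝ, E) p z) w w - ν w ^ 2) + ν w ^ 2 ≤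
        hess (chartMetric (riemMetric 𝓘(ℝ, E) N) p)
          (fun y => radialEnergy A r ((extChartAt 𝓘(ℝ, E) p).symm y))
          (extChartAt 𝓘(ℝ, E) p z) w w := by
  obtain ⟨v, hv, rfl⟩ := hz
  rw [h.paramInv_apply hv]
  have hΦ := h.isParam.isMetricMap p
  have hy' : v ∈ paramDomain (E := E) A (Metric.ball 0 r) p := ⟨hv, hp⟩
  have hbij := h.isParam.bijective_fderiv p hy'
  have hsurj := fun z hz => (h.isParam.bijective_fderiv p (y := z) hz).2
  have hK := h.isNormalMetric
  set K := paramMetric E A with hKdef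
  set G := chartMetric (riemMetric 𝓘(ℝ, E) N) p with hG
  set Φ : V → E := fun z => extChartAt 𝓘(ℝ, E) p (A z) with hΦdef
  set f : E → ℝ := fun y => radialEnergy A r ((extChartAt 𝓘(ℝ, E) p).symm y) with hf
  have hfs : ContDiffAt ℝ ∞ f (Φ v) :=
    contDiffAt_comp_extChartAt_symm (h.contMDiffAt_radialEnergy ⟨v, hv, rfl⟩) hp
  have hfΦ : (fun z => f (Φ z)) =ᶠ[𝓝 v] fun z => (1 / 2 : ℝ) * inner ℝ z z := by
    filter_upwards [hΦ.metric_source.mem_nhds hy'] with z hz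
    rw [← h.radialEnergy_apply hz.1]
    simp only [hf, hΦdef]
    rw [(extChartAt 𝓘(ℝ, E) p).left_inv (by rw [extChartAt_source]; exact hz.2)]
  have hhess : ∀ w, hess G f (Φ v) (fderiv ℝ Φ v w) (fderiv ℝ Φ v w) =
      hess K (fun z => (1 / 2 : ℝ) * inner ℝ z z) v w w := by
    intro w
    rw [← hess_congr hfΦ]
    exact (hΦ.hess_comp hsurj hy' hfs w w).symm
  have hmet : ∀ w, G (Φ v) (fderiv ℝ Φ v w) (fderiv ℝ Φ v w) = K v w w := fun w =>
    (hΦ.eq v hy' w w).symm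
  have hdf : ∀ w, fderiv ℝ f (Φ v) (fderiv ℝ Φ v w) = inner ℝ v w := by
    intro w
    have h1 := ((hfs.differentiableAt (by simp)).hasFDerivAt.comp v
      (hΦ.differentiableAt hy').hasFDerivAt).fderiv
    have h2 : HasFDerivAt (fun z : V => (1 / 2 : ℝ) * inner ℝ z z) (innerSL ℝ v) v := by
      refine (((hasFDerivAt_id v).inner ℝ (hasFDerivAt_id v)).const_mul (1 / 2 : ℝ)).congr_fderiv ?_
      ext w
      simp [real_inner_comm]
      ring
    have h3 := hfΦ.fderiv_eq.trans h2.fderiv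
    exact (DFunLike.congr_fun h1 w).symm.trans (DFunLike.congr_fun h3 w)
  change ∃ ν : E →ₗ[ℝ] ℝ, (∀ w, fderiv ℝ f (Φ v) w = ‖v‖ * ν w) ∧
    (∀ w, ν w ^ 2 ≤ G (Φ v) w w) ∧
    ∀ w, radialCoeff κ ‖v‖ * (G (Φ v) w w - ν w ^ 2) + ν w ^ 2 ≤ hess G f (Φ v) w w
  by_cases hv0 : v = 0
  -- At the centre the covector `dρ` does not exist. Since the Hessian there is the metric itself
  -- and the coefficient is `1`, the value `ν = 0` works.
  · refine ⟨0, fun w => ?_, fun w => ?_, fun w => ?_⟩ <;>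
      obtain ⟨w, rfl⟩ := hbij.2 w
    · rw [hdf, hv0]; simp
    · rw [hmet, hv0, h.inner_zero]; simp
    · rw [hmet, hhess, hv0, hK.hess_sq_zero h.pos, hK.inner_zero]; simp [radialCoeff]
  have hρ : 0 < ‖v‖ := norm_pos_iff.2 hv0
  have hvr : ‖v‖ < r := mem_ball_zero_iff.1 hv
  set θ : V := ‖v‖⁻¹ • v with hθ
  have hθ1 : ‖θ‖ = 1 := by rw [hθ, norm_smul, norm_inv, norm_norm, inv_mul_cancel₀ hρ.ne']
  have hvθ : ‖v‖ • θ = v := by rw [hθ, smul_inv_smul₀ hρ.ne']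
  -- Away from the centre `ν` is `dρ`: the inner product with the unit radial vector `θ`,
  -- transported by `dΦ`.
  let e : V ≃ₗ[ℝ] E := LinearEquiv.ofBijective (fderiv ℝ Φ v : V →ₗ[ℝ] E) hbij
  have hν : ∀ w, ((innerSL ℝ θ : V →ₗ[ℝ] ℝ) ∘ₗ (e.symm : E →ₗ[ℝ] V)) (fderiv ℝ Φ v w) =
      inner ℝ θ w := by
    intro w
    have : e.symm (fderiv ℝ Φ v w) = w := e.symm_apply_apply w
    simp [this]
  have hdom := mem_compDomain_of_le_half hρ fun hκ => hvr.le.trans (hr hκ)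
  refine ⟨(innerSL ℝ θ : V →ₗ[ℝ] ℝ) ∘ₗ (e.symm : E →ₗ[ℝ] V), fun w => ?_, fun w => ?_, fun w => ?_⟩ <;>
    obtain ⟨w, rfl⟩ := hbij.2 w
  · rw [hdf, hν]
    conv_lhs => rw [← hvθ]
    rw [real_inner_smul_left]
  · rw [hν, hmet]
    have h1 : ∀ w, K v θ w = inner ℝ θ w := fun w => by
      have := hK.gauss hv w
      rw [hθ, map_smul, smul_apply, this, real_inner_smul_left, smul_eq_mul]
    have h2 : inner ℝ θ θ = 1 := by rw [real_inner_self_eq_norm_sq, hθ1, one_pow]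
    have h3 := hK.isMetricOn.symm v hv
    -- Positivity of the metric on the component of `w` orthogonal to `θ` is the inequality `ν² ≤
    -- g`.
    have h4 : 0 ≤ K v (w - inner ℝ θ w • θ) (w - inner ℝ θ w • θ) := by
      by_cases h5 : w - inner ℝ θ w • θ = 0
      · rw [h5]; simp
      · exact (hK.isMetricOn.pos v hv _ h5).le
    simp only [map_sub, sub_apply, map_smul, smul_apply, h3 w θ, h1, h2, smul_eq_mul] at h4
    nlinarith
  · rw [hν, hmet, hhess, radialCoeff, if_neg hρ.ne']
    have h1 := hK.le_hess_sq hρ hdom hθ1 hvr (fun t ht w hw =>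
      h.curvature_le hκ hθ1 ht.1 (ht.2.trans hvr) w hw) w
    rwa [hvθ] at h1

end IsNormalParam

end RadialHessian

/-! ### Hessians along maps into the product `N × ℝ`. -/

section HessComp

variable {E : Type*} [NormedAddCommGroup E] [NormedSpace ℝ E]
  {V : Type*} [NormedAddCommGroup V] [NormedSpace ℝ V]

/-- A pure chain-rule identity, in which the two Christoffel terms are inserted and cancel, so no
relation between `K`, `G` and `Φ` is required. The last summand is `df` of the second fundamental
form of `Φ`. -/
theorem hess_comp_add {Φ : V → E} {f : E → ℝ} {y : V} (hΦ : ContDiffAt ℝ ∞ Φ y)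
    (hf : ContDiffAt ℝ ∞ f (Φ y)) (K : V → V →L[ℝ] V →L[ℝ] ℝ) (G : E → E →L[ℝ] E →L[ℝ] ℝ) (u v : V) :
    hess K (fun z => f (Φ z)) y u v = hess G f (Φ y) (fderiv ℝ Φ y u) (fderiv ℝ Φ y v)
      + fderiv ℝ f (Φ y) (fderiv ℝ (fderiv ℝ Φ) y u v
        + christoffel G (Φ y) (fderiv ℝ Φ y u) (fderiv ℝ Φ y v)
        - fderiv ℝ Φ y (christoffel K y u v)) := by
  have h1 : ∀ᶠ z in 𝓝 y, fderiv ℝ (fun z => f (Φ z)) z =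
      (fderiv ℝ f (Φ z)).comp (fderiv ℝ Φ z) := by
    have h2 : ∀ᶠ x in 𝓝 (Φ y), ContDiffAt ℝ 2 f x :=
      (hf.of_le ENat.LEInfty.out).eventually (by simp)
    have h3 : ∀ᶠ x in 𝓝 y, ContDiffAt ℝ 2 Φ x :=
      (hΦ.of_le ENat.LEInfty.out).eventually (by simp)
    filter_upwards [h3, hΦ.continuousAt.eventually h2] with z hz hfz
    exact fderiv_comp z (hfz.differentiableAt (by simp)) (hz.differentiableAt (by simp))
  have hD : HasFDerivAt (fderiv ℝ Φ) (fderiv ℝ (fderiv ℝ Φ) y) y :=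
    ((hΦ.fderiv_right (m := ∞) (by simp)).differentiableAt (by simp)).hasFDerivAt
  have hd : HasFDerivAt (fderiv ℝ f) (fderiv ℝ (fderiv ℝ f) (Φ y)) (Φ y) :=
    ((hf.fderiv_right (m := ∞) (by simp)).differentiableAt (by simp)).hasFDerivAt
  have hc := (hd.comp y (hΦ.differentiableAt (by simp)).hasFDerivAt).clm_comp hD
  have h2 : fderiv ℝ (fderiv ℝ (fun z => f (Φ z))) y = _ :=
    (hc.congr_of_eventuallyEq h1).fderiv
  rw [hess, h2, h1.self_of_nhds, hess]
  simp only [add_apply, ContinuousLinearMap.comp_apply, map_add, map_sub,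
    ContinuousLinearMap.compL_apply, ContinuousLinearMap.flip_apply, Function.comp_apply]
  ring

end HessComp

section ProdMetric

variable {E : Type*} [NormedAddCommGroup E] [NormedSpace ℝ E]

/-- The product of the metric `G` and the standard metric of `ℝ`. -/
def prodMetric (G : E → E →L[ℝ] E →L[ℝ] ℝ) (q : E × ℝ) : (E × ℝ) →L[ℝ] (E × ℝ) →L[ℝ] ℝ :=
  bilinPullback (G q.1) (ContinuousLinearMap.fst ℝ E ℝ)
    + bilinPullback (ContinuousLinearMap.mul ℝ ℝ) (ContinuousLinearMap.snd ℝ E ℝ)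

theorem prodMetric_apply (G : E → E →L[ℝ] E →L[ℝ] ℝ) (q u v : E × ℝ) :
    prodMetric G q u v = G q.1 u.1 v.1 + u.2 * v.2 := rfl

variable {G : E → E →L[ℝ] E →L[ℝ] ℝ} {s : Set E} [FiniteDimensional ℝ E]

theorem IsMetricOn.prodMetric (hG : IsMetricOn G s) :
    IsMetricOn (CylTone.prodMetric G) (s ×ˢ univ) where
  isOpen := hG.isOpen.prod isOpen_univ
  contDiffOn := by
    refine (contDiffOn_clm_apply (E := E × ℝ) (F := (E × ℝ) →L[ℝ] ℝ)).2 fun u => ?_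
    refine (contDiffOn_clm_apply (E := E × ℝ) (F := ℝ)).2 fun v => ?_
    simp only [prodMetric_apply]
    have h1 : ContDiffOn ℝ ∞ (fun q : E × ℝ => G q.1) (s ×ˢ univ) :=
      ContDiffOn.comp (g := G) (f := Prod.fst) hG.contDiffOn contDiffOn_fst (fun z hz => hz.1)
    exact ((h1.clm_apply contDiffOn_const).clm_apply contDiffOn_const).add contDiffOn_const
  symm := fun y hy u v => by
    rw [prodMetric_apply, prodMetric_apply, hG.symm _ hy.1, mul_comm]
  pos := fun y hy u hu => by
    rw [prodMetric_apply]
    by_cases h1 : u.1 = 0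
    · have h2 : u.2 ≠ 0 := fun h2 => hu (Prod.ext h1 h2)
      rw [h1, map_zero, zero_add]
      exact mul_self_pos.2 h2
    · have := hG.pos _ hy.1 _ h1
      nlinarith [mul_self_nonneg u.2]

theorem IsMetricOn.fderiv_prodMetric (hG : IsMetricOn G s) {q : E × ℝ} (hq : q.1 ∈ s)
    (a u v : E × ℝ) : fderiv ℝ (CylTone.prodMetric G) q a u v = fderiv ℝ G q.1 a.1 u.1 v.1 := by
  have hd := hG.prodMetric.differentiableAt (y := q) ⟨hq, mem_univ _⟩
  have h1 := ((hd.hasFDerivAt.clm_apply (hasFDerivAt_const u q)).clm_apply (hasFDerivAt_const v q))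
  have h0 : HasFDerivAt (fun q : E × ℝ => G q.1)
      ((fderiv ℝ G q.1).comp (ContinuousLinearMap.fst ℝ E ℝ)) q :=
    HasFDerivAt.comp (g := G) (f := Prod.fst) q (hG.differentiableAt hq).hasFDerivAt hasFDerivAt_fst
  have h2 := ((h0.clm_apply (hasFDerivAt_const u.1 q)).clm_apply
    (hasFDerivAt_const v.1 q)).add_const (u.2 * v.2)
  have h3 := DFunLike.congr_fun (h1.unique h2) a
  simpa using h3

theorem IsMetricOn.christoffel_prodMetric (hG : IsMetricOn G s) {q : E × ℝ} (hq : q.1 ∈ s)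
    (u v : E × ℝ) : christoffel (CylTone.prodMetric G) q u v = (christoffel G q.1 u.1 v.1, 0) := by
  have hq' : q ∈ s ×ˢ (univ : Set ℝ) := ⟨hq, mem_univ _⟩
  refine hG.prodMetric.ext_left hq' fun w => ?_
  rw [hG.prodMetric.christoffel_spec hq', prodMetric_apply, hG.christoffel_spec hq,
    hG.fderiv_prodMetric hq, hG.fderiv_prodMetric hq, hG.fderiv_prodMetric hq]
  ring

theorem IsMetricOn.hess_prodMetric (hG : IsMetricOn G s) {q : E × ℝ} (hq : q.1 ∈ s) {f : E → ℝ}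
    (hf : ContDiffAt ℝ ∞ f q.1) (u v : E × ℝ) :
    hess (CylTone.prodMetric G) (fun z => f z.1) q u v = hess G f q.1 u.1 v.1 := by
  rw [hess_comp_add (Φ := Prod.fst) contDiffAt_fst hf (CylTone.prodMetric G) G,
    hG.christoffel_prodMetric hq]
  have h1 : fderiv ℝ (Prod.fst : E × ℝ → E) = fun _ => ContinuousLinearMap.fst ℝ E ℝ :=
    funext fun _ => fderiv_fst
  simp [h1]

theorem christoffel_congr {G G' : E → E →L[ℝ] E →L[ℝ] ℝ} {y : E} (h : G =ᶠ[𝓝 y] G') (u v : E) :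
    christoffel G y u v = christoffel G' y u v := by
  rw [christoffel, christoffel, h.fderiv_eq, h.self_of_nhds]

end ProdMetric

section CylMetric

variable {E : Type*} [NormedAddCommGroup E] [NormedSpace ℝ E] [FiniteDimensional ℝ E]
  {N : Type*} [TopologicalSpace N] [ChartedSpace E N] [IsManifold 𝓘(ℝ, E) ∞ N]
  [RiemannianBundle (fun x : N => TangentSpace 𝓘(ℝ, E) x)]
  [IsContMDiffRiemannianBundle 𝓘(ℝ, E) ∞ E (fun x : N => TangentSpace 𝓘(ℝ, E) x)]

theorem cylMetric_apply (q : N × ℝ) (u v : TangentSpace (𝓘(ℝ, E).prod 𝓘(ℝ, ℝ)) q) :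
    cylMetric 𝓘(ℝ, E) N q u v = riemMetric 𝓘(ℝ, E) N q.1 (u : E × ℝ).1 (v : E × ℝ).1
      + (u : E × ℝ).2 * (v : E × ℝ).2 := by
  have h1 : cylMetric 𝓘(ℝ, E) N q u v = riemMetric 𝓘(ℝ, E) N q.1
      (mfderiv (𝓘(ℝ, E).prod 𝓘(ℝ, ℝ)) 𝓘(ℝ, E) (Prod.fst : N × ℝ → N) q u)
      (mfderiv (𝓘(ℝ, E).prod 𝓘(ℝ, ℝ)) 𝓘(ℝ, E) (Prod.fst : N × ℝ → N) q v)
      + riemMetric 𝓘(ℝ, ℝ) ℝ q.2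
      (mfderiv (𝓘(ℝ, E).prod 𝓘(ℝ, ℝ)) 𝓘(ℝ, ℝ) (Prod.snd : N × ℝ → ℝ) q u)
      (mfderiv (𝓘(ℝ, E).prod 𝓘(ℝ, ℝ)) 𝓘(ℝ, ℝ) (Prod.snd : N × ℝ → ℝ) q v) := rfl
  rw [h1, mfderiv_fst, mfderiv_snd]
  congr 1
  exact mul_comm _ _

theorem extChartAt_cyl_symm_apply (q : N × ℝ) (y : E × ℝ) :
    (extChartAt (𝓘(ℝ, E).prod 𝓘(ℝ, ℝ)) q).symm y = ((extChartAt 𝓘(ℝ, E) q.1).symm y.1, y.2) := by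
  rw [extChartAt_prod]; rfl

theorem extChartAt_cyl_apply (q p : N × ℝ) :
    extChartAt (𝓘(ℝ, E).prod 𝓘(ℝ, ℝ)) q p = (extChartAt 𝓘(ℝ, E) q.1 p.1, p.2) := by
  rw [extChartAt_prod]; rfl

theorem chartMetric_cylMetric (q : N × ℝ) {y : E × ℝ} (hy : y.1 ∈ (extChartAt 𝓘(ℝ, E) q.1).target) :
    chartMetric (cylMetric 𝓘(ℝ, E) N) q y =
      prodMetric (chartMetric (riemMetric 𝓘(ℝ, E) N) q.1) y := by
  set Ψ : E × ℝ → N × ℝ := fun y => (extChartAt (𝓘(ℝ, E).prod 𝓘(ℝ, ℝ)) q).symm y with hΨ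
  have hy' : y ∈ (extChartAt (𝓘(ℝ, E).prod 𝓘(ℝ, ℝ)) q).target := by
    rw [extChartAt_prod]; exact ⟨hy, by simp [chartAt_self_eq]⟩
  have hd : MDifferentiableAt 𝓘(ℝ, E × ℝ) (𝓘(ℝ, E).prod 𝓘(ℝ, ℝ)) Ψ y :=
    ((contMDiffOn_extChartAt_symm (n := ∞) q).contMDiffAt
      ((isOpen_extChartAt_target q).mem_nhds hy')).mdifferentiableAt (by simp)
  have hd1 : MDifferentiableAt 𝓘(ℝ, E) 𝓘(ℝ, E) (extChartAt 𝓘(ℝ, E) q.1).symm y.1 :=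
    ((contMDiffOn_extChartAt_symm (n := ∞) q.1).contMDiffAt
      ((isOpen_extChartAt_target q.1).mem_nhds hy)).mdifferentiableAt (by simp)
  have hf : (Prod.fst : N × ℝ → N) ∘ Ψ = (extChartAt 𝓘(ℝ, E) q.1).symm ∘ Prod.fst :=
    funext fun z => by
      simp only [Function.comp_apply, hΨ]
      rw [extChartAt_cyl_symm_apply]
  have hs : (Prod.snd : N × ℝ → ℝ) ∘ Ψ = Prod.snd := funext fun z => by
    simp only [Function.comp_apply, hΨ]
    rw [extChartAt_cyl_symm_apply]
  have hfst : ∀ u : E × ℝ, ((mfderiv 𝓘(ℝ, E × ℝ) (𝓘(ℝ, E).prod 𝓘(ℝ, ℝ)) Ψ y u : E × ℝ).1 : E) =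
      mfderiv 𝓘(ℝ, E) 𝓘(ℝ, E) (extChartAt 𝓘(ℝ, E) q.1).symm y.1 u.1 := by
    intro u
    have h1 := mfderiv_comp (I'' := 𝓘(ℝ, E)) y (mdifferentiableAt_fst (x := Ψ y)) hd
    have h2 := mfderiv_comp (I := 𝓘(ℝ, E × ℝ)) (I' := 𝓘(ℝ, E)) (I'' := 𝓘(ℝ, E)) y hd1
      (show MDifferentiableAt 𝓘(ℝ, E × ℝ) 𝓘(ℝ, E) (Prod.fst : E × ℝ → E) y from
        mdifferentiableAt_iff_differentiableAt.2 differentiableAt_fst)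
    rw [← hf, h1, mfderiv_fst, mfderiv_eq_fderiv, fderiv_fst] at h2
    exact DFunLike.congr_fun h2 u
  have hsnd : ∀ u : E × ℝ, ((mfderiv 𝓘(ℝ, E × ℝ) (𝓘(ℝ, E).prod 𝓘(ℝ, ℝ)) Ψ y u : E × ℝ).2 : ℝ) =
      u.2 := by
    intro u
    have h1 := mfderiv_comp (I'' := 𝓘(ℝ, ℝ)) y (mdifferentiableAt_snd (x := Ψ y)) hd
    rw [hs, mfderiv_eq_fderiv, fderiv_snd, mfderiv_snd] at h1
    exact (DFunLike.congr_fun h1 u).symm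
  refine ContinuousLinearMap.ext fun u => ContinuousLinearMap.ext fun v => ?_
  rw [prodMetric_apply]
  refine (cylMetric_apply (Ψ y) (mfderiv 𝓘(ℝ, E × ℝ) (𝓘(ℝ, E).prod 𝓘(ℝ, ℝ)) Ψ y u)
    (mfderiv 𝓘(ℝ, E × ℝ) (𝓘(ℝ, E).prod 𝓘(ℝ, ℝ)) Ψ y v)).trans ?_
  refine congrArg₂ (· + ·) ?_ (congrArg₂ (· * ·) (hsnd u) (hsnd v))
  exact metricField_congr (riemMetric 𝓘(ℝ, E) N)
    (by simp only [hΨ]; rw [extChartAt_cyl_symm_apply]) (hfst u) (hfst v)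

/-- The Christoffel form involves derivatives of the metric, so the agreement in
`chartMetric_cylMetric` is needed on a neighbourhood. -/
theorem christoffel_cylMetric (q : N × ℝ) {y : E × ℝ}
    (hy : y.1 ∈ (extChartAt 𝓘(ℝ, E) q.1).target) (u v : E × ℝ) :
    christoffel (chartMetric (cylMetric 𝓘(ℝ, E) N) q) y u v =
      christoffel (prodMetric (chartMetric (riemMetric 𝓘(ℝ, E) N) q.1)) y u v := by
  refine christoffel_congr ?_ u v
  filter_upwards [continuousAt_fst.eventually ((isOpen_extChartAt_target q.1).mem_nhds hy)] with z hz
  exact chartMetric_cylMetric q hz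

variable {D : Type*} [NormedAddCommGroup D] [NormedSpace ℝ D] [FiniteDimensional ℝ D]
  {M : Type*} [TopologicalSpace M] [ChartedSpace D M] [IsManifold 𝓘(ℝ, D) ∞ M]

/-- The Hessian of a function on `N` along a map `φ : M → N × ℝ`. -/
theorem hess_comp_fst (g : MetricField 𝓘(ℝ, D) M) {φ : M → N × ℝ}
    (hφ : ContMDiff 𝓘(ℝ, D) (𝓘(ℝ, E).prod 𝓘(ℝ, ℝ)) ∞ φ) (x : M) {k : N → ℝ}
    (hk : ContMDiffAt 𝓘(ℝ, E) 𝓘(ℝ, ℝ) ∞ k (φ x).1) (X : D) :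
    hess (chartMetric g x) (fun y => k (φ ((extChartAt 𝓘(ℝ, D) x).symm y)).1)
      (extChartAt 𝓘(ℝ, D) x x) X X =
    hess (chartMetric (riemMetric 𝓘(ℝ, E) N) (φ x).1)
      (fun y => k ((extChartAt 𝓘(ℝ, E) (φ x).1).symm y)) (extChartAt 𝓘(ℝ, E) (φ x).1 (φ x).1)
      (mfderiv 𝓘(ℝ, D) (𝓘(ℝ, E).prod 𝓘(ℝ, ℝ)) φ x X : E × ℝ).1
      (mfderiv 𝓘(ℝ, D) (𝓘(ℝ, E).prod 𝓘(ℝ, ℝ)) φ x X : E × ℝ).1 +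
    fderiv ℝ (fun y => k ((extChartAt 𝓘(ℝ, E) (φ x).1).symm y))
      (extChartAt 𝓘(ℝ, E) (φ x).1 (φ x).1)
      (secondFundamentalForm g (cylMetric 𝓘(ℝ, E) N) φ x X X : E × ℝ).1 := by
  set y₀ : D := extChartAt 𝓘(ℝ, D) x x with hy₀
  set z := (φ x).1 with hz
  set κ : E → ℝ := fun y => k ((extChartAt 𝓘(ℝ, E) z).symm y) with hκ
  set F : D → E × ℝ := fun y => extChartAt (𝓘(ℝ, E).prod 𝓘(ℝ, ℝ)) (φ x)
    (φ ((extChartAt 𝓘(ℝ, D) x).symm y)) with hF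
  have hxs : (extChartAt 𝓘(ℝ, D) x).symm y₀ = x := extChartAt_to_inv x
  have hFy : F y₀ = (extChartAt 𝓘(ℝ, E) z z, (φ x).2) := by
    simp only [hF]
    rw [hxs, extChartAt_cyl_apply]
  have hsymm : ContMDiffAt 𝓘(ℝ, D) 𝓘(ℝ, D) ∞ (extChartAt 𝓘(ℝ, D) x).symm y₀ :=
    (contMDiffOn_extChartAt_symm x).contMDiffAt (extChartAt_target_mem_nhds x)
  have hφs : ContMDiffAt 𝓘(ℝ, D) (𝓘(ℝ, E).prod 𝓘(ℝ, ℝ)) ∞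
      (fun y => φ ((extChartAt 𝓘(ℝ, D) x).symm y)) y₀ := hφ.contMDiffAt.comp y₀ hsymm
  have hFs : ContDiffAt ℝ ∞ F y₀ := by
    rw [← contMDiffAt_iff_contDiffAt]
    refine ContMDiffAt.comp (I' := 𝓘(ℝ, E).prod 𝓘(ℝ, ℝ)) y₀ ?_ hφs
    rw [hxs]
    exact contMDiffAt_extChartAt
  have hκs : ContDiffAt ℝ ∞ κ (extChartAt 𝓘(ℝ, E) z z) :=
    contDiffAt_comp_extChartAt_symm hk (mem_chart_source E z)
  have htar : (F y₀).1 ∈ (extChartAt 𝓘(ℝ, E) z).target := by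
    rw [hFy]; exact mem_extChartAt_target z
  have hG := isMetricOn_chartMetric (E := E) z
  have hκs' : ContDiffAt ℝ ∞ κ (F y₀).1 := by rw [hFy]; exact hκs
  have hev : (fun y => k (φ ((extChartAt 𝓘(ℝ, D) x).symm y)).1) =ᶠ[𝓝 y₀] fun y => κ (F y).1 := by
    have h1 : ContinuousAt (fun y => (φ ((extChartAt 𝓘(ℝ, D) x).symm y)).1) y₀ :=
      continuousAt_fst.comp hφs.continuousAt
    have h2 := h1.eventually ((chartAt E z).open_source.mem_nhds
      (by beta_reduce; rw [hxs]; exact mem_chart_source E z))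
    filter_upwards [h2] with y hy
    simp only [hκ, hF]
    rw [extChartAt_cyl_apply, (extChartAt 𝓘(ℝ, E) z).left_inv (by rwa [extChartAt_source])]
  have hDF : ∀ X : D, fderiv ℝ F y₀ X = mfderiv 𝓘(ℝ, D) (𝓘(ℝ, E).prod 𝓘(ℝ, ℝ)) φ x X := by
    have h1 := (hφ.contMDiffAt.mdifferentiableAt (x := x) (by simp)).mfderiv
    rw [ModelWithCorners.range_eq_univ, fderivWithin_univ] at h1
    intro X
    rw [h1]
    rfl
  -- The preferred charts at `x` and at `φ x` have identity differential at these points, so the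
  -- conversions in the definition of the second fundamental form drop out.
  have hsff : (secondFundamentalForm g (cylMetric 𝓘(ℝ, E) N) φ x X X : E × ℝ) =
      fderiv ℝ (fderiv ℝ F) y₀ X X
      + christoffel (prodMetric (chartMetric (riemMetric 𝓘(ℝ, E) N) z)) (F y₀) (fderiv ℝ F y₀ X)
        (fderiv ℝ F y₀ X) - fderiv ℝ F y₀ (christoffel (chartMetric g x) y₀ X X) := by
    have hid : ∀ w : E × ℝ, ((mfderiv (𝓘(ℝ, E).prod 𝓘(ℝ, ℝ)) 𝓘(ℝ, E × ℝ)
        (extChartAt (𝓘(ℝ, E).prod 𝓘(ℝ, ℝ)) (φ x)) (φ x)).inverse w : E × ℝ) = w := by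
      intro w
      have h1 := mfderiv_extChartAt_self (I := 𝓘(ℝ, E).prod 𝓘(ℝ, ℝ)) (x := φ x)
      refine (congrArg (fun L : (E × ℝ) →L[ℝ] (E × ℝ) => L.inverse w) h1).trans ?_
      exact DFunLike.congr_fun (ContinuousLinearMap.inverse_id (R := ℝ) (M := E × ℝ)) w
    have hX : (mfderiv 𝓘(ℝ, D) 𝓘(ℝ, D) (extChartAt 𝓘(ℝ, D) x) x X : D) = X :=
      DFunLike.congr_fun (mfderiv_extChartAt_self (I := 𝓘(ℝ, D)) (x := x)) X
    refine (hid _).trans ?_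
    rw [← christoffel_cylMetric (φ x) htar]
    exact congrArg (fun Y : D => fderiv ℝ (fderiv ℝ F) y₀ Y Y
      + christoffel (chartMetric (cylMetric 𝓘(ℝ, E) N) (φ x)) (F y₀) (fderiv ℝ F y₀ Y)
        (fderiv ℝ F y₀ Y) - fderiv ℝ F y₀ (christoffel (chartMetric g x) y₀ Y Y)) hX
  rw [hess_congr hev, hess_comp_add (f := fun q : E × ℝ => κ q.1) (Φ := F) hFs
    (ContDiffAt.comp (g := κ) (f := Prod.fst) (F y₀) hκs' contDiffAt_fst) _
    (prodMetric (chartMetric (riemMetric 𝓘(ℝ, E) N) z)), hG.hess_prodMetric htar hκs', ← hsff]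
  have h3 : fderiv ℝ (fun q : E × ℝ => κ q.1) (F y₀) =
      (fderiv ℝ κ (F y₀).1).comp (ContinuousLinearMap.fst ℝ E ℝ) :=
    (HasFDerivAt.comp (g := κ) (f := Prod.fst) (F y₀)
      (hκs'.differentiableAt (by simp)).hasFDerivAt hasFDerivAt_fst).fderiv
  rw [h3, hFy, hDF]
  rfl

end CylMetric

/-! ### The Laplacian of the smoothed radius along an isometric immersion. -/

section HessSqrt

variable {E : Type*} [NormedAddCommGroup E] [NormedSpace ℝ E]

theorem hess_scalar_comp {κ κ' κ'' : ℝ → ℝ} {f : E → ℝ} {y : E} (hf : ContDiffAt ℝ ∞ f y)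
    (hκ : ContDiffAt ℝ ∞ κ (f y)) (h1 : ∀ᶠ t in 𝓝 (f y), HasDerivAt κ (κ' t) t)
    (h2 : HasDerivAt κ' (κ'' (f y)) (f y)) (G : E → E →L[ℝ] E →L[ℝ] ℝ) (u v : E) :
    hess G (fun z => κ (f z)) y u v =
      κ' (f y) * hess G f y u v + κ'' (f y) * (fderiv ℝ f y u * fderiv ℝ f y v) := by
  have h3 : fderiv ℝ κ =ᶠ[𝓝 (f y)] fun t => κ' t • ContinuousLinearMap.id ℝ ℝ := by
    filter_upwards [h1] with t ht
    rw [ht.hasFDerivAt.fderiv]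
    ext
    simp
  have h4 := (h2.smul_const (ContinuousLinearMap.id ℝ ℝ)).hasFDerivAt
  -- The zero form on `ℝ` has zero Christoffel form, so it serves as the flat metric on the target.
  rw [hess_comp_add hf hκ G (fun _ => 0), hess, h3.fderiv_eq, h4.fderiv, h3.self_of_nhds, hess]
  simp [christoffel]
  ring

theorem hess_sqrt {f : E → ℝ} {y : E} (hf : ContDiffAt ℝ ∞ f y) {c : ℝ} (hc : 0 < 2 * f y + c)
    (G : E → E →L[ℝ] E →L[ℝ] ℝ) (u v : E) :
    hess G (fun z => √(2 * f z + c)) y u v = hess G f y u v / √(2 * f y + c)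
      - fderiv ℝ f y u * fderiv ℝ f y v / √(2 * f y + c) ^ 3 := by
  have hσ := Real.sqrt_pos.2 hc
  have hd : ∀ t : ℝ, 0 < 2 * t + c → HasDerivAt (fun t => √(2 * t + c)) (1 / √(2 * t + c)) t := by
    intro t ht
    refine ((((hasDerivAt_id' t).const_mul 2).add_const c).sqrt ht.ne').congr_deriv ?_
    rw [mul_one, div_eq_div_iff (by positivity) (Real.sqrt_pos.2 ht).ne']
    ring
  have h1 : ∀ᶠ t in 𝓝 (f y), 0 < 2 * t + c :=
    ((continuous_const.mul continuous_id).add continuous_const).continuousAt.eventually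
      (lt_mem_nhds hc)
  have h2 : HasDerivAt (fun t : ℝ => 1 / √(2 * t + c)) (-1 / √(2 * f y + c) ^ 3) (f y) := by
    refine ((hasDerivAt_const (f y) (1 : ℝ)).fun_div (hd _ hc) hσ.ne').congr_deriv ?_
    field_simp
    ring
  rw [hess_scalar_comp (κ := fun t => √(2 * t + c)) (κ' := fun t => 1 / √(2 * t + c))
    (κ'' := fun _ => -1 / √(2 * f y + c) ^ 3) hf
    (((contDiffAt_const.mul contDiffAt_id).add contDiffAt_const).sqrt hc.ne')
    (h1.mono hd) h2]
  ring

theorem fderiv_sqrt_apply {f : E → ℝ} {y : E} (hf : DifferentiableAt ℝ f y) {c : ℝ}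
    (hc : 0 < 2 * f y + c) (u : E) :
    fderiv ℝ (fun z => √(2 * f z + c)) y u = fderiv ℝ f y u / √(2 * f y + c) := by
  have hσ := Real.sqrt_pos.2 hc
  rw [(((hf.hasFDerivAt.const_mul 2).add_const c).sqrt hc.ne').fderiv]
  simp
  field_simp

end HessSqrt

/-- Evaluating the hypothesis at the vector dual to `l` gives `S² ≤ S` for the sum `S` of squares.
-/
theorem sum_sq_le_one {F : Type*} [NormedAddCommGroup F] [InnerProductSpace ℝ F] {ι : Type*}
    [Fintype ι] (e : OrthonormalBasis ι ℝ F) (l : F →ₗ[ℝ] ℝ)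
    (hl : ∀ X, l X ^ 2 ≤ inner ℝ X X) : ∑ i, l (e i) ^ 2 ≤ 1 := by
  have h1 := hl (∑ i, l (e i) • e i)
  have h2 : inner ℝ (∑ i, l (e i) • e i) (∑ i, l (e i) • e i) = ∑ i, l (e i) ^ 2 := by
    rw [e.orthonormal.inner_sum]
    simp [sq]
  rw [h2, map_sum] at h1
  simp only [map_smul, smul_eq_mul, ← sq] at h1
  have h3 : 0 ≤ ∑ i, l (e i) ^ 2 := Finset.sum_nonneg fun i _ => sq_nonneg _
  nlinarith

section LapM

variable {D : Type*} [NormedAddCommGroup D] [NormedSpace ℝ D] [FiniteDimensional ℝ D]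
  {M : Type*} [TopologicalSpace M] [ChartedSpace D M]
  [RiemannianBundle (fun x : M => TangentSpace 𝓘(ℝ, D) x)]

/-- The Laplace-Beltrami operator, computed in the chart at the point. -/
def lapM (D : Type*) [NormedAddCommGroup D] [NormedSpace ℝ D]
    {M : Type*} [TopologicalSpace M] [ChartedSpace D M]
    [RiemannianBundle (fun x : M => TangentSpace 𝓘(ℝ, D) x)] (U : M → ℝ) (x : M) : ℝ :=
  lapG (chartMetric (riemMetric 𝓘(ℝ, D) M) x) (fun y => U ((extChartAt 𝓘(ℝ, D) x).symm y))
    (extChartAt 𝓘(ℝ, D) x x)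

variable [IsManifold 𝓘(ℝ, D) ∞ M]
  [IsContMDiffRiemannianBundle 𝓘(ℝ, D) ∞ D (fun x : M => TangentSpace 𝓘(ℝ, D) x)]

theorem chartMetric_self_apply (x : M) (u v : TangentSpace 𝓘(ℝ, D) x) :
    chartMetric (riemMetric 𝓘(ℝ, D) M) x (extChartAt 𝓘(ℝ, D) x x) u v = inner ℝ u v := by
  have h1 := chartMetric_extChartAt (mem_chart_source D x) u v
  rw [mfderiv_extChartAt_self] at h1
  exact h1

theorem lapM_eq_sum (U : M → ℝ) (x : M) {ι : Type*} [Fintype ι] [DecidableEq ι]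
    (e : OrthonormalBasis ι ℝ (TangentSpace 𝓘(ℝ, D) x)) :
    lapM D U x = ∑ i, hess (chartMetric (riemMetric 𝓘(ℝ, D) M) x)
      (fun y => U ((extChartAt 𝓘(ℝ, D) x).symm y)) (extChartAt 𝓘(ℝ, D) x x) (e i) (e i) := by
  have h1 := (isMetricOn_chartMetric (E := D) x).lapG_eq_sum (mem_extChartAt_target x)
    (e.toBasis : Module.Basis ι ℝ D) (fun i j => by
      refine (chartMetric_self_apply x (e.toBasis i) (e.toBasis j)).trans ?_
      rw [e.coe_toBasis]
      exact orthonormal_iff_ite.1 e.orthonormal i j)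
    (fun y => U ((extChartAt 𝓘(ℝ, D) x).symm y))
  rw [lapM, h1]
  refine Finset.sum_congr rfl fun i _ => ?_
  have h2 : (e.toBasis i : TangentSpace 𝓘(ℝ, D) x) = e i := by rw [e.coe_toBasis]
  exact congrArg (fun Y : D => hess (chartMetric (riemMetric 𝓘(ℝ, D) M) x)
      (fun y => U ((extChartAt 𝓘(ℝ, D) x).symm y)) (extChartAt 𝓘(ℝ, D) x x) Y Y) h2

end LapM

section Submanifold

variable {m n : ℕ} {M : Type*} [TopologicalSpace M] [ChartedSpace (EuclideanSpace ℝ (Fin m)) M]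
  [RiemannianBundle (fun x : M => TangentSpace (𝓡 m) x)] [IsManifold (𝓡 m) ∞ M]
  [IsContMDiffRiemannianBundle (𝓡 m) ∞ (EuclideanSpace ℝ (Fin m))
    (fun x : M => TangentSpace (𝓡 m) x)]
  {N : Type*} [MetricSpace N] [ChartedSpace (EuclideanSpace ℝ (Fin n)) N]
  [RiemannianBundle (fun x : N => TangentSpace (𝓡 n) x)] [IsManifold (𝓡 n) ∞ N]
  [IsContMDiffRiemannianBundle (𝓡 n) ∞ (EuclideanSpace ℝ (Fin n))
    (fun x : N => TangentSpace (𝓡 n) x)]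
  {φ : M → N × ℝ}

/-- The horizontal part of the differential of `φ`. -/
def horizontalDeriv (φ : M → N × ℝ) (x : M) :
    TangentSpace (𝓡 m) x →ₗ[ℝ] EuclideanSpace ℝ (Fin n) where
  toFun X := (mfderiv (𝓡 m) ((𝓡 n).prod 𝓘(ℝ, ℝ)) φ x X : EuclideanSpace ℝ (Fin n) × ℝ).1
  map_add' X Y := congrArg (fun z : EuclideanSpace ℝ (Fin n) × ℝ => z.1)
    (map_add (mfderiv (𝓡 m) ((𝓡 n).prod 𝓘(ℝ, ℝ)) φ x) X Y)
  map_smul' c X := congrArg (fun z : EuclideanSpace ℝ (Fin n) × ℝ => z.1)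
    (map_smul (mfderiv (𝓡 m) ((𝓡 n).prod 𝓘(ℝ, ℝ)) φ x) c X)

/-- The vertical part of the differential of `φ`. -/
def verticalDeriv (φ : M → N × ℝ) (x : M) : TangentSpace (𝓡 m) x →ₗ[ℝ] ℝ where
  toFun X := (mfderiv (𝓡 m) ((𝓡 n).prod 𝓘(ℝ, ℝ)) φ x X : EuclideanSpace ℝ (Fin n) × ℝ).2
  map_add' X Y := congrArg (fun z : EuclideanSpace ℝ (Fin n) × ℝ => z.2)
    (map_add (mfderiv (𝓡 m) ((𝓡 n).prod 𝓘(ℝ, ℝ)) φ x) X Y)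
  map_smul' c X := congrArg (fun z : EuclideanSpace ℝ (Fin n) × ℝ => z.2)
    (map_smul (mfderiv (𝓡 m) ((𝓡 n).prod 𝓘(ℝ, ℝ)) φ x) c X)

theorem IsIsometricImmersion.inner_eq
    (hφ : IsIsometricImmersion (riemMetric (𝓡 m) M) (cylMetric (𝓡 n) N) φ) (x : M)
    (X : TangentSpace (𝓡 m) x) :
    chartMetric (riemMetric (𝓡 n) N) (φ x).1 (extChartAt (𝓡 n) (φ x).1 (φ x).1)
      (horizontalDeriv (n := n) φ x X) (horizontalDeriv (n := n) φ x X)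
      + verticalDeriv (n := n) φ x X ^ 2 = inner ℝ X X := by
  rw [← riemMetric_apply, ← hφ.2 x X X, sq]
  refine Eq.trans ?_ (cylMetric_apply (E := EuclideanSpace ℝ (Fin n)) (φ x)
    (mfderiv (𝓡 m) ((𝓡 n).prod 𝓘(ℝ, ℝ)) φ x X) (mfderiv (𝓡 m) ((𝓡 n).prod 𝓘(ℝ, ℝ)) φ x X)).symm
  exact congrArg (· + _) (chartMetric_self_apply (D := EuclideanSpace ℝ (Fin n)) (φ x).1 _ _)

theorem sq_horizontal_meanCurvature_le (x : M) :
    chartMetric (riemMetric (𝓡 n) N) (φ x).1 (extChartAt (𝓡 n) (φ x).1 (φ x).1)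
      (meanCurvature (m := m) φ x : EuclideanSpace ℝ (Fin n) × ℝ).1
      (meanCurvature (m := m) φ x : EuclideanSpace ℝ (Fin n) × ℝ).1 ≤
      meanCurvatureNorm m n φ x ^ 2 := by
  have h1 := cylMetric_apply (E := EuclideanSpace ℝ (Fin n)) (φ x) (meanCurvature (m := m) φ x)
    (meanCurvature (m := m) φ x)
  have h2 := chartMetric_self_apply (D := EuclideanSpace ℝ (Fin n)) (φ x).1
    (meanCurvature (m := m) φ x : EuclideanSpace ℝ (Fin n) × ℝ).1
    (meanCurvature (m := m) φ x : EuclideanSpace ℝ (Fin n) × ℝ).1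
  have h3 : 0 ≤ riemMetric (𝓡 n) N (φ x).1
      (meanCurvature (m := m) φ x : EuclideanSpace ℝ (Fin n) × ℝ).1
      (meanCurvature (m := m) φ x : EuclideanSpace ℝ (Fin n) × ℝ).1 :=
    real_inner_self_nonneg (F := TangentSpace (𝓡 n) (φ x).1)
  have h4 := mul_self_nonneg (meanCurvature (m := m) φ x : EuclideanSpace ℝ (Fin n) × ℝ).2
  rw [meanCurvatureNorm, Real.sq_sqrt (by rw [h1]; exact add_nonneg h3 h4), h1]
  exact h2.le.trans (le_add_of_nonneg_right h4)

theorem lapM_comp_fst (hφ : ContMDiff (𝓡 m) ((𝓡 n).prod 𝓘(ℝ, ℝ)) ∞ φ) (x : M) {k : N → ℝ}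
    (hk : ContMDiffAt (𝓡 n) 𝓘(ℝ, ℝ) ∞ k (φ x).1) :
    lapM (EuclideanSpace ℝ (Fin m)) (fun x => k (φ x).1) x =
    ∑ i, hess (chartMetric (riemMetric (𝓡 n) N) (φ x).1)
      (fun y => k ((extChartAt (𝓡 n) (φ x).1).symm y)) (extChartAt (𝓡 n) (φ x).1 (φ x).1)
      (horizontalDeriv (n := n) φ x (stdOrthonormalBasis ℝ (TangentSpace (𝓡 m) x) i))
      (horizontalDeriv (n := n) φ x (stdOrthonormalBasis ℝ (TangentSpace (𝓡 m) x) i)) +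
    fderiv ℝ (fun y => k ((extChartAt (𝓡 n) (φ x).1).symm y))
      (extChartAt (𝓡 n) (φ x).1 (φ x).1)
      (meanCurvature (m := m) φ x : EuclideanSpace ℝ (Fin n) × ℝ).1 := by
  rw [lapM_eq_sum _ x (stdOrthonormalBasis ℝ (TangentSpace (𝓡 m) x))]
  rw [Finset.sum_congr rfl fun i _ => hess_comp_fst (E := EuclideanSpace ℝ (Fin n))
    (riemMetric (𝓡 m) M) hφ x hk (stdOrthonormalBasis ℝ (TangentSpace (𝓡 m) x) i)]
  rw [Finset.sum_add_distrib]
  refine congrArg₂ (· + ·) rfl ?_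
  rw [← map_sum]
  congr 1
  exact (map_sum (LinearMap.fst ℝ (EuclideanSpace ℝ (Fin n)) ℝ) _ _).symm

variable {V : Type*} [NormedAddCommGroup V] [InnerProductSpace ℝ V] [FiniteDimensional ℝ V]
  {A : V → N} {r : ℝ}

/-- A smooth approximation of the distance to the axis of the cylinder. -/
def smoothRadius (A : V → N) (r ε : ℝ) (z : N) : ℝ := √(2 * radialEnergy A r z + ε ^ 2)

theorem smoothRadius_pos (A : V → N) (r : ℝ) {ε : ℝ} (hε : 0 < ε) (z : N) :
    0 < 2 * radialEnergy A r z + ε ^ 2 := by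
  have : 0 ≤ radialEnergy A r z :=
    mul_nonneg (by norm_num) real_inner_self_nonneg
  positivity

theorem two_mul_radialEnergy (A : V → N) (r : ℝ) (z : N) :
    2 * radialEnergy A r z = ‖paramInv A r z‖ ^ 2 := by
  rw [radialEnergy, real_inner_self_eq_norm_sq]; ring

theorem IsNormalParam.contMDiffAt_smoothRadius
    (h : IsNormalParam (E := EuclideanSpace ℝ (Fin n)) A r) {ε : ℝ} (hε : 0 < ε) {z : N}
    (hz : z ∈ A '' Metric.ball (0 : V) r) :
    ContMDiffAt (𝓡 n) 𝓘(ℝ, ℝ) ∞ (smoothRadius A r ε) z := by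
  have h1 : ContDiffAt ℝ ∞ (fun t : ℝ => √(2 * t + ε ^ 2)) (radialEnergy A r z) :=
    ((contDiffAt_const.mul contDiffAt_id).add contDiffAt_const).sqrt
      (smoothRadius_pos A r hε z).ne'
  exact h1.contMDiffAt.comp z (h.contMDiffAt_radialEnergy hz)

/-- The origin of the `2` in `m - 2`. The horizontal parts of an orthonormal basis have squared
lengths of sum `m - ∑ dt(e_i)²`, and the sums of squares of `dt` and of `ν` over the basis are each
at most one. -/
theorem IsIsometricImmersion.le_sum_horizontalDeriv
    (hφ : IsIsometricImmersion (riemMetric (𝓡 m) M) (cylMetric (𝓡 n) N) φ) (x : M)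
    (ν : EuclideanSpace ℝ (Fin n) →ₗ[ℝ] ℝ)
    (hν : ∀ w, ν w ^ 2 ≤ chartMetric (riemMetric (𝓡 n) N) (φ x).1
      (extChartAt (𝓡 n) (φ x).1 (φ x).1) w w) :
    ((m : ℝ) - 2) ≤ ∑ i, (chartMetric (riemMetric (𝓡 n) N) (φ x).1
      (extChartAt (𝓡 n) (φ x).1 (φ x).1)
      (horizontalDeriv (n := n) φ x (stdOrthonormalBasis ℝ (TangentSpace (𝓡 m) x) i))
      (horizontalDeriv (n := n) φ x (stdOrthonormalBasis ℝ (TangentSpace (𝓡 m) x) i))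
      - ν (horizontalDeriv (n := n) φ x (stdOrthonormalBasis ℝ (TangentSpace (𝓡 m) x) i)) ^ 2) := by
  have hinner := hφ.inner_eq x
  have hdim : Module.finrank ℝ (TangentSpace (𝓡 m) x) = m :=
    (finrank_euclideanSpace_fin (𝕜 := ℝ) (n := m))
  set e := stdOrthonormalBasis ℝ (TangentSpace (𝓡 m) x) with he
  have hb1 := sum_sq_le_one e (verticalDeriv (n := n) φ x) fun X => by
    rw [← hinner X]
    exact le_add_of_nonneg_left ((sq_nonneg _).trans (hν _))
  have hb2 := sum_sq_le_one e (ν ∘ₗ horizontalDeriv (n := n) φ x) fun X => by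
    rw [← hinner X, LinearMap.comp_apply]
    exact (hν _).trans (le_add_of_nonneg_right (sq_nonneg _))
  have h4 : ∀ i, chartMetric (riemMetric (𝓡 n) N) (φ x).1
      (extChartAt (𝓡 n) (φ x).1 (φ x).1) (horizontalDeriv (n := n) φ x (e i))
      (horizontalDeriv (n := n) φ x (e i)) - ν (horizontalDeriv (n := n) φ x (e i)) ^ 2 =
      1 - verticalDeriv (n := n) φ x (e i) ^ 2
        - (ν ∘ₗ horizontalDeriv (n := n) φ x) (e i) ^ 2 := by
    intro i
    have h5 := hinner (e i)
    rw [real_inner_self_eq_norm_sq, e.norm_eq_one, one_pow] at h5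
    rw [LinearMap.comp_apply, ← h5]
    ring
  rw [Finset.sum_congr rfl fun i _ => h4 i, Finset.sum_sub_distrib, Finset.sum_sub_distrib]
  simp only [Finset.sum_const, Finset.card_univ, Fintype.card_fin, nsmul_eq_mul, mul_one]
  have hdim' : ((Module.finrank ℝ (TangentSpace (𝓡 m) x) : ℕ) : ℝ) = m := congrArg Nat.cast hdim
  linarith

theorem mul_div_le_sum {ι : Type*} [Fintype ι] {P L : ι → ℝ} {c τ σ : ℝ} (hτ : 0 ≤ τ) (hσ : 0 < σ)
    (hc : c ≤ ∑ i, P i) (hL : ∀ i, τ * P i / σ ≤ L i) : c * τ / σ ≤ ∑ i, L i := by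
  refine le_trans ?_ (Finset.sum_le_sum fun i _ => hL i)
  rw [← Finset.sum_div, ← Finset.mul_sum, mul_comm]
  gcongr

/-- Lower bound for the Laplacian of the smoothed radius along an isometric immersion. -/
theorem IsNormalParam.le_lapM_smoothRadius
    (h : IsNormalParam (E := EuclideanSpace ℝ (Fin n)) A r)
    (hφ : IsIsometricImmersion (riemMetric (𝓡 m) M) (cylMetric (𝓡 n) N) φ) {κ : ℝ}
    (hr : 0 < κ → r ≤ Real.pi / (2 * √κ)) (hκ : RadialCurvatureLE (𝓡 n) (A 0) κ) {ε : ℝ}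
    (hε : 0 < ε) {x : M} (hx : (φ x).1 ∈ A '' Metric.ball (0 : V) r) :
    (((m : ℝ) - 2) * radialCoeff κ ‖paramInv A r (φ x).1‖
      - ‖paramInv A r (φ x).1‖ * meanCurvatureNorm m n φ x) / smoothRadius A r ε (φ x).1 ≤
    lapM (EuclideanSpace ℝ (Fin m)) (fun x => smoothRadius A r ε (φ x).1) x := by
  rw [lapM_comp_fst hφ.1 x (h.contMDiffAt_smoothRadius hε hx)]
  obtain ⟨ν, h1, h2, h3⟩ := h.exists_hess_radialEnergy_le hr hκ hx
    (mem_chart_source (EuclideanSpace ℝ (Fin n)) (φ x).1)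
  have hfs := contDiffAt_comp_extChartAt_symm (h.contMDiffAt_radialEnergy hx)
    (mem_chart_source (EuclideanSpace ℝ (Fin n)) (φ x).1)
  have hinner := hφ.inner_eq x
  have hH := sq_horizontal_meanCurvature_le (m := m) (n := n) (φ := φ) x
  set z := (φ x).1 with hz
  set y := extChartAt (𝓡 n) z z with hy
  set G := chartMetric (riemMetric (𝓡 n) N) z with hG
  set ρ := ‖paramInv A r z‖ with hρ
  set e := stdOrthonormalBasis ℝ (TangentSpace (𝓡 m) x) with he
  set f : EuclideanSpace ℝ (Fin n) → ℝ :=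
    fun y => radialEnergy A r ((extChartAt (𝓡 n) z).symm y) with hf
  set w := fun i => horizontalDeriv (n := n) φ x (e i) with hw
  set a := (meanCurvature (m := m) φ x : EuclideanSpace ℝ (Fin n) × ℝ).1 with ha
  have hfy : f y = radialEnergy A r z := by
    simp only [hf, hy]
    rw [extChartAt_to_inv]
  have hpos : 0 < 2 * f y + ε ^ 2 := by rw [hfy]; exact smoothRadius_pos A r hε z
  have hσ : smoothRadius A r ε z = √(2 * f y + ε ^ 2) := by rw [smoothRadius, hfy]
  have hσpos := Real.sqrt_pos.2 hpos
  have hσsq : √(2 * f y + ε ^ 2) ^ 2 = ρ ^ 2 + ε ^ 2 := by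
    rw [Real.sq_sqrt hpos.le, hfy, two_mul_radialEnergy]
  rw [hσ]
  set σ := √(2 * f y + ε ^ 2) with hσdef
  have hτ : 0 ≤ radialCoeff κ ρ := by
    obtain ⟨v, hv, hvz⟩ := hx
    have hvr : ρ < r := by
      rw [hρ, ← hvz, h.paramInv_apply hv]
      exact mem_ball_zero_iff.1 hv
    exact radialCoeff_nonneg (norm_nonneg _) fun hκ => hvr.le.trans (hr hκ)
  set τ := radialCoeff κ ρ with hτdef
  have hρ0 : 0 ≤ ρ := norm_nonneg _
  have hterm : ∀ i, τ * (G y (w i) (w i) - ν (w i) ^ 2) / σ ≤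
      hess G (fun y => smoothRadius A r ε ((extChartAt (𝓡 n) z).symm y)) y (w i) (w i) := by
    intro i
    have h4 := hess_sqrt hfs hpos G (w i) (w i)
    have h5 := h3 (w i)
    have h6 : fderiv ℝ f y (w i) = ρ * ν (w i) := h1 (w i)
    change _ ≤ hess G (fun z => √(2 * f z + ε ^ 2)) y (w i) (w i)
    rw [h4, ← hσdef, h6]
    -- The concavity of the square root costs `ρ² ν² / σ³ ≤ ν² / σ`, because `ρ ≤ σ`. The term `ν²`
    -- in the Hessian comparison pays for it.
    have h7 : ρ * ν (w i) * (ρ * ν (w i)) / σ ^ 3 ≤ ν (w i) ^ 2 / σ := by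
      rw [div_le_div_iff₀ (by positivity) hσpos]
      have : ρ ^ 2 ≤ σ ^ 2 := by rw [hσsq]; nlinarith [sq_nonneg ε]
      have := mul_le_mul_of_nonneg_right this (mul_nonneg (sq_nonneg (ν (w i))) hσpos.le)
      nlinarith
    have h8 : (τ * (G y (w i) (w i) - ν (w i) ^ 2) + ν (w i) ^ 2) / σ ≤
        hess G f y (w i) (w i) / σ := div_le_div_of_nonneg_right h5 hσpos.le
    rw [add_div] at h8
    linarith
  -- The mean curvature term is `ρ ν(H) / σ`, and `|ν(H)|` is bounded by the length of the
  -- horizontal part of `H`.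
  have hlast : -(ρ * meanCurvatureNorm m n φ x) / σ ≤
      fderiv ℝ (fun y => smoothRadius A r ε ((extChartAt (𝓡 n) z).symm y)) y a := by
    change _ ≤ fderiv ℝ (fun z => √(2 * f z + ε ^ 2)) y a
    rw [fderiv_sqrt_apply (hfs.differentiableAt (by simp)) hpos, ← hσdef]
    refine div_le_div_of_nonneg_right ?_ hσpos.le
    have h6 : fderiv ℝ f y a = ρ * ν a := h1 a
    rw [h6]
    have h7 : |ν a| ≤ meanCurvatureNorm m n φ x :=
      abs_le_of_sq_le_sq ((h2 a).trans hH) (Real.sqrt_nonneg _)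
    have h8 := neg_abs_le (ν a)
    nlinarith
  have hsum := hφ.le_sum_horizontalDeriv x ν h2
  have hfin := add_le_add (mul_div_le_sum hτ hσpos hsum hterm) hlast
  rwa [← add_div, ← sub_eq_add_neg] at hfin

end Submanifold

/-! ### The Riemannian volume measure. -/

section Volume

variable {m : ℕ}

/-- The Gram matrices are related by `Pᵀ G P` with `P` the matrix of `L`, so the determinant
acquires the square of `L.det`. -/
theorem gramDensity_comp {G K : EuclideanSpace ℝ (Fin m) → EuclideanSpace ℝ (Fin m) →L[ℝ]
      EuclideanSpace ℝ (Fin m) →L[ℝ] ℝ} {y z : EuclideanSpace ℝ (Fin m)}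
    (L : EuclideanSpace ℝ (Fin m) →L[ℝ] EuclideanSpace ℝ (Fin m))
    (h : ∀ u v, K y u v = G z (L u) (L v)) :
    gramDensity K y = |L.det| * gramDensity G z := by
  let e := (EuclideanSpace.basisFun (Fin m) ℝ).toBasis
  let P := LinearMap.toMatrix e e (L : EuclideanSpace ℝ (Fin m) →ₗ[ℝ] EuclideanSpace ℝ (Fin m))
  have hP : (Matrix.of fun i j : Fin m =>
      K y (EuclideanSpace.single i 1) (EuclideanSpace.single j 1)) =
      P.transpose * (Matrix.of fun i j : Fin m =>
        G z (EuclideanSpace.single i 1) (EuclideanSpace.single j 1)) * P := by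
    ext i j
    have hs : ∀ i : Fin m, L (EuclideanSpace.single i 1) =
        ∑ k, P k i • (EuclideanSpace.single k 1 : EuclideanSpace ℝ (Fin m)) := by
      intro i
      have h1 := e.sum_repr (L (e i))
      have h2 : ∀ k, (e.repr (L (e i))) k = P k i := fun k =>
        (LinearMap.toMatrix_apply e e _ k i).symm
      simp only [h2] at h1
      simpa [e] using h1.symm
    rw [Matrix.of_apply, h, hs i, hs j]
    simp only [map_sum, Matrix.mul_apply, Matrix.transpose_apply, Matrix.of_apply, map_smul,
      sum_apply, smul_apply, smul_eq_mul, Finset.sum_mul]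
    refine Finset.sum_congr rfl fun k _ => ?_
    rw [Finset.mul_sum]
    exact Finset.sum_congr rfl fun l _ => by ring
  have hdet : P.det = L.det := LinearMap.det_toMatrix e _
  rw [gramDensity, hP, Matrix.det_mul, Matrix.det_mul, Matrix.det_transpose, hdet,
    show ∀ a b : ℝ, a * b * a = a ^ 2 * b from fun a b => by ring,
    Real.sqrt_mul (sq_nonneg _), Real.sqrt_sq_eq_abs]
  rfl

variable {M : Type*} [TopologicalSpace M] [ChartedSpace (EuclideanSpace ℝ (Fin m)) M]
  [RiemannianBundle (fun x : M => TangentSpace (𝓡 m) x)]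

theorem measurableSet_target_inter_preimage [MeasurableSpace M] [BorelSpace M] (p : M) {B : Set M}
    (hB : MeasurableSet B) :
    MeasurableSet ((extChartAt (𝓡 m) p).target ∩ (extChartAt (𝓡 m) p).symm ⁻¹' B) := by
  have h1 := (continuousOn_extChartAt_symm (I := 𝓡 m) p).domRestrict.measurable hB
  have h2 := (MeasurableEmbedding.subtype_coe
    (isOpen_extChartAt_target (I := 𝓡 m) p).measurableSet).measurableSet_image.2 h1
  convert h2 using 1
  ext y
  constructor
  · rintro ⟨hy, hy'⟩
    exact ⟨⟨y, hy⟩, hy', rfl⟩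
  · rintro ⟨⟨z, hz⟩, hz', rfl⟩
    exact ⟨hz, hz'⟩

theorem aemeasurable_extChartAt_symm [MeasurableSpace M] [BorelSpace M] (p : M) :
    AEMeasurable (extChartAt (𝓡 m) p).symm
      (((volume : Measure (EuclideanSpace ℝ (Fin m))).restrict (extChartAt (𝓡 m) p).target).withDensity
      (fun y => ENNReal.ofReal (volumeDensity p y))) :=
  ((continuousOn_extChartAt_symm p).aemeasurable
    (isOpen_extChartAt_target p).measurableSet).mono_ac (withDensity_absolutelyContinuous _ _)

theorem chartVolume_apply [MeasurableSpace M] [BorelSpace M] (p : M) {B : Set M}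
    (hB : MeasurableSet B) :
    chartVolume (m := m) p B =
      ∫⁻ y in (extChartAt (𝓡 m) p).target ∩ (extChartAt (𝓡 m) p).symm ⁻¹' B,
        ENNReal.ofReal (volumeDensity p y) := by
  rw [chartVolume, Measure.map_apply_of_aemeasurable (aemeasurable_extChartAt_symm p) hB,
    withDensity_apply', Measure.restrict_restrict' (isOpen_extChartAt_target p).measurableSet,
    inter_comm]

variable [IsManifold (𝓡 m) ∞ M]
  [IsContMDiffRiemannianBundle (𝓡 m) ∞ (EuclideanSpace ℝ (Fin m))
    (fun x : M => TangentSpace (𝓡 m) x)] [MeasurableSpace M] [BorelSpace M]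

theorem volumeDensity_transition (q p : M) {y : EuclideanSpace ℝ (Fin m)}
    (hy : y ∈ paramDomain (E := EuclideanSpace ℝ (Fin m)) (extChartAt (𝓡 m) q).symm
      (extChartAt (𝓡 m) q).target p) :
    volumeDensity (m := m) q y =
      |(fderiv ℝ (transition (EuclideanSpace ℝ (Fin m)) q p) y).det| *
        volumeDensity (m := m) p (transition (EuclideanSpace ℝ (Fin m)) q p y) :=
  gramDensity_comp _ ((isMetricMap_transition (E := EuclideanSpace ℝ (Fin m)) q p).eq y hy)

/-- Change of variables along the transition map. Only an inequality can hold, since the part of `B`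
outside the chart at `q` is not seen on the left. -/
theorem chartVolume_le (q p : M) {B : Set M} (hB : MeasurableSet B)
    (hBp : B ⊆ (chartAt (EuclideanSpace ℝ (Fin m)) p).source) :
    chartVolume (m := m) q B ≤ chartVolume (m := m) p B := by
  rw [chartVolume_apply q hB, chartVolume_apply p hB]
  set S := (extChartAt (𝓡 m) q).target ∩ (extChartAt (𝓡 m) q).symm ⁻¹' B
  have hS : S ⊆ paramDomain (E := EuclideanSpace ℝ (Fin m)) (extChartAt (𝓡 m) q).symm
      (extChartAt (𝓡 m) q).target p := fun y hy => ⟨hy.1, hBp hy.2⟩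
  have hT := isMetricMap_transition (E := EuclideanSpace ℝ (Fin m)) q p
  have hinv : ∀ y ∈ S, (extChartAt (𝓡 m) p).symm (transition (EuclideanSpace ℝ (Fin m)) q p y) =
      (extChartAt (𝓡 m) q).symm y := fun y hy =>
    (extChartAt (𝓡 m) p).left_inv (by rw [extChartAt_source]; exact hBp hy.2)
  have hinj : InjOn (transition (EuclideanSpace ℝ (Fin m)) q p) S := by
    intro y hy z hz hyz
    have h1 : (extChartAt (𝓡 m) q).symm y = (extChartAt (𝓡 m) q).symm z := by
      rw [← hinv y hy, hyz, hinv z hz]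
    exact (extChartAt (𝓡 m) q).symm.injOn hy.1 hz.1 h1
  have h2 := lintegral_image_eq_lintegral_abs_det_fderiv_mul
    (volume : Measure (EuclideanSpace ℝ (Fin m))) (measurableSet_target_inter_preimage q hB)
    (fun y hy => (hT.differentiableAt (hS hy)).hasFDerivAt.hasFDerivWithinAt) hinj
    (fun y => ENNReal.ofReal (volumeDensity (m := m) p y))
  calc ∫⁻ y in S, ENNReal.ofReal (volumeDensity (m := m) q y)
      = ∫⁻ y in S, ENNReal.ofReal |(fderiv ℝ (transition (EuclideanSpace ℝ (Fin m)) q p) y).det| *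
        ENNReal.ofReal (volumeDensity (m := m) p
          (transition (EuclideanSpace ℝ (Fin m)) q p y)) := by
        refine setLIntegral_congr_fun (measurableSet_target_inter_preimage q hB) fun y hy => ?_
        rw [volumeDensity_transition q p (hS hy), ENNReal.ofReal_mul (abs_nonneg _)]
    _ = _ := h2.symm
    _ ≤ _ := by
        refine lintegral_mono_set ?_
        rintro _ ⟨y, hy, rfl⟩
        refine ⟨hT.mapsTo (hS hy), ?_⟩
        rw [mem_preimage, hinv y hy]
        exact hy.2

theorem riemVolume_apply_of_subset (p : M) {B : Set M} (hB : MeasurableSet B)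
    (hBp : B ⊆ (chartAt (EuclideanSpace ℝ (Fin m)) p).source) :
    riemVolume m M B = chartVolume (m := m) p B := by
  refine le_antisymm ?_ (Measure.le_iff'.1 (le_iSup (fun p : M => chartVolume (m := m) p) p) B)
  have hs := (chartAt (EuclideanSpace ℝ (Fin m)) p).open_source.measurableSet
  -- A supremum of measures is not computed set by set, so it is bounded by one measure that
  -- dominates every `chartVolume q` and equals `chartVolume p` inside the chart at `p`.
  have h1 : riemVolume m M ≤ chartVolume (m := m) p +
      (riemVolume m M).restrict (chartAt (EuclideanSpace ℝ (Fin m)) p).sourceᶜ := by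
    refine iSup_le fun q => Measure.le_iff.2 fun C hC => ?_
    rw [← measure_inter_add_sdiff C hs, Measure.add_apply, Measure.restrict_apply hC]
    refine add_le_add ((chartVolume_le q p (hC.inter hs) inter_subset_right).trans
      (measure_mono inter_subset_left)) ?_
    exact Measure.le_iff'.1 (le_iSup (fun p : M => chartVolume (m := m) p) q) _
  refine (Measure.le_iff'.1 h1 B).trans ?_
  rw [Measure.add_apply, Measure.restrict_apply hB, (disjoint_compl_right_iff_subset.2 hBp).inter_eq,
    measure_empty, add_zero]

theorem riemVolume_restrict_source (p : M) :
    (riemVolume m M).restrict (chartAt (EuclideanSpace ℝ (Fin m)) p).source =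
      chartVolume (m := m) p := by
  have hs := (chartAt (EuclideanSpace ℝ (Fin m)) p).open_source.measurableSet
  ext B hB
  rw [Measure.restrict_apply hB, riemVolume_apply_of_subset p (hB.inter hs) inter_subset_right,
    chartVolume_apply p hB, chartVolume_apply p (hB.inter hs)]
  congr 2
  ext y
  constructor
  · exact fun hy => ⟨hy.1, hy.2.1⟩
  · refine fun hy => ⟨hy.1, hy.2, ?_⟩
    have := (extChartAt (𝓡 m) p).map_target hy.1
    rwa [extChartAt_source] at this

theorem continuousOn_volumeDensity (p : M) :
    ContinuousOn (volumeDensity (m := m) p) (extChartAt (𝓡 m) p).target :=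
  (isMetricOn_chartMetric (E := EuclideanSpace ℝ (Fin m)) p).contDiffOn_gramDensity.continuousOn

theorem volumeDensity_pos (p : M) {y : EuclideanSpace ℝ (Fin m)}
    (hy : y ∈ (extChartAt (𝓡 m) p).target) : 0 < volumeDensity (m := m) p y :=
  (isMetricOn_chartMetric (E := EuclideanSpace ℝ (Fin m)) p).gramDensity_pos hy

/-- The density is continuous, hence bounded near each point. Local finiteness makes continuous
functions with compact support integrable. -/
instance isLocallyFiniteMeasure_riemVolume : IsLocallyFiniteMeasure (riemVolume m M) := by
  refine ⟨fun p => ?_⟩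
  have htn := (isOpen_extChartAt_target (I := 𝓡 m) p).mem_nhds (mem_extChartAt_target p)
  have h1 : ∀ᶠ y in 𝓝 (extChartAt (𝓡 m) p p),
      volumeDensity (m := m) p y < volumeDensity (m := m) p (extChartAt (𝓡 m) p p) + 1 :=
    ((continuousOn_volumeDensity p).continuousAt htn).eventually_lt continuousAt_const (by simp)
  obtain ⟨W, hW, hWo, hpW⟩ := mem_nhds_iff.1
    (inter_mem (inter_mem h1 htn) (Metric.ball_mem_nhds (extChartAt (𝓡 m) p p) one_pos))
  have hU : IsOpen ((extChartAt (𝓡 m) p).source ∩ extChartAt (𝓡 m) p ⁻¹' W) :=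
    (continuousOn_extChartAt p).isOpen_inter_preimage (isOpen_extChartAt_source p) hWo
  refine ⟨_, hU.mem_nhds ⟨mem_extChartAt_source p, hpW⟩, ?_⟩
  rw [riemVolume_apply_of_subset p hU.measurableSet
    (fun x hx => by rw [← extChartAt_source (𝓡 m)]; exact hx.1), chartVolume_apply p hU.measurableSet]
  refine (setLIntegral_mono' (measurableSet_target_inter_preimage p hU.measurableSet)
    (g := fun _ => ENNReal.ofReal (volumeDensity (m := m) p (extChartAt (𝓡 m) p p) + 1))
    fun y hy => ?_).trans_lt ?_
  · have h3 := hy.2.2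
    rw [mem_preimage, (extChartAt (𝓡 m) p).right_inv hy.1] at h3
    exact ENNReal.ofReal_le_ofReal (hW h3).1.1.le
  · rw [setLIntegral_const]
    refine ENNReal.mul_lt_top ENNReal.ofReal_lt_top ((measure_mono (t :=
      Metric.ball (extChartAt (𝓡 m) p p) 1) fun y hy => ?_).trans_lt measure_ball_lt_top)
    have h3 := hy.2.2
    rw [mem_preimage, (extChartAt (𝓡 m) p).right_inv hy.1] at h3
    exact (hW h3).2

end Volume

/-! ### Gradient, Laplacian and Green's formula in a chart. -/

section ChartFormulas

variable {D : Type*} [NormedAddCommGroup D] [NormedSpace ℝ D] [FiniteDimensional ℝ D]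
  {M : Type*} [TopologicalSpace M] [ChartedSpace D M] [IsManifold 𝓘(ℝ, D) ∞ M]
  [RiemannianBundle (fun x : M => TangentSpace 𝓘(ℝ, D) x)]
  [IsContMDiffRiemannianBundle 𝓘(ℝ, D) ∞ D (fun x : M => TangentSpace 𝓘(ℝ, D) x)]

/-- `lapM` uses a chart that varies with the point, whereas integration needs one fixed chart; the
two agree by invariance of the Laplacian. -/
theorem lapM_eq_lapG {U : M → ℝ} {x p : M} (hU : ContMDiffAt 𝓘(ℝ, D) 𝓘(ℝ, ℝ) ∞ U x)
    (hx : x ∈ (chartAt D p).source) :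
    lapM D U x = lapG (chartMetric (riemMetric 𝓘(ℝ, D) M) p)
      (fun y => U ((extChartAt 𝓘(ℝ, D) p).symm y)) (extChartAt 𝓘(ℝ, D) p x) := by
  have hT := isMetricMap_transition (E := D) x p
  have hm := extChartAt_mem_paramDomain (E := D) (mem_chart_source D x) hx
  have hxT := transition_extChartAt (E := D) (p := p) (mem_chart_source D x)
  have h1 := hT.lapG_comp (fun y hy => bijective_fderiv_transition x p hy) hm
    (f := fun y => U ((extChartAt 𝓘(ℝ, D) p).symm y))
    (by rw [hxT]; exact contDiffAt_comp_extChartAt_symm hU hx)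
  rw [hxT] at h1
  rw [← h1, lapM]
  refine lapG_congr ?_
  filter_upwards [hT.metric_source.mem_nhds hm] with y hy
  rw [transition, (extChartAt 𝓘(ℝ, D) p).left_inv (by rw [extChartAt_source]; exact hy.2)]

theorem mvfderiv_eq_fderiv_chart {U : M → ℝ} {x p : M} (hU : ContMDiffAt 𝓘(ℝ, D) 𝓘(ℝ, ℝ) ∞ U x)
    (hx : x ∈ (chartAt D p).source) (X : TangentSpace 𝓘(ℝ, D) x) :
    mvfderiv 𝓘(ℝ, D) U x X = fderiv ℝ (fun y => U ((extChartAt 𝓘(ℝ, D) p).symm y))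
      (extChartAt 𝓘(ℝ, D) p x)
      (mfderiv 𝓘(ℝ, D) 𝓘(ℝ, D) (extChartAt 𝓘(ℝ, D) p) x X) := by
  have hd := (contDiffAt_comp_extChartAt_symm hU hx).differentiableAt (by simp)
  have he : U =ᶠ[𝓝 x] (fun y => U ((extChartAt 𝓘(ℝ, D) p).symm y)) ∘ extChartAt 𝓘(ℝ, D) p := by
    filter_upwards [(chartAt D p).open_source.mem_nhds hx] with z hz
    rw [Function.comp_apply, (extChartAt 𝓘(ℝ, D) p).left_inv (by rwa [extChartAt_source])]
  have h1 := mfderiv_comp x hd.mdifferentiableAt (mdifferentiableAt_extChartAt (I := 𝓘(ℝ, D)) hx)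
  have h2 : mfderiv 𝓘(ℝ, D) 𝓘(ℝ, ℝ) U x X = mfderiv 𝓘(ℝ, D) 𝓘(ℝ, ℝ)
      ((fun y => U ((extChartAt 𝓘(ℝ, D) p).symm y)) ∘ extChartAt 𝓘(ℝ, D) p) x X := by
    have := he.mfderiv_eq (I := 𝓘(ℝ, D)) (I' := 𝓘(ℝ, ℝ))
    exact DFunLike.congr_fun this X
  refine h2.trans ((DFunLike.congr_fun h1 X).trans ?_)
  rw [mfderiv_eq_fderiv]
  rfl

end ChartFormulas

section Grad

variable {m : ℕ} {M : Type*} [TopologicalSpace M] [ChartedSpace (EuclideanSpace ℝ (Fin m)) M]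
  [RiemannianBundle (fun x : M => TangentSpace (𝓡 m) x)]

theorem inner_grad (U : M → ℝ) (x : M) (X : TangentSpace (𝓡 m) x) :
    inner ℝ (grad m U x) X = mvfderiv (𝓡 m) U x X := by
  rw [grad]
  exact InnerProductSpace.toDual_symm_apply

variable [IsManifold (𝓡 m) ∞ M]
  [IsContMDiffRiemannianBundle (𝓡 m) ∞ (EuclideanSpace ℝ (Fin m))
    (fun x : M => TangentSpace (𝓡 m) x)]

theorem mfderiv_extChartAt_grad {U : M → ℝ} {x p : M}
    (hU : ContMDiffAt (𝓡 m) 𝓘(ℝ, ℝ) ∞ U x)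
    (hx : x ∈ (chartAt (EuclideanSpace ℝ (Fin m)) p).source) :
    (mfderiv (𝓡 m) (𝓡 m) (extChartAt (𝓡 m) p) x (grad m U x) : EuclideanSpace ℝ (Fin m)) =
      gradG (chartMetric (riemMetric (𝓡 m) M) p)
        (fun y => U ((extChartAt (𝓡 m) p).symm y)) (extChartAt (𝓡 m) p x) := by
  have hm := isMetricOn_chartMetric (E := EuclideanSpace ℝ (Fin m)) p
  have ht : extChartAt (𝓡 m) p x ∈ (extChartAt (𝓡 m) p).target :=
    (extChartAt (𝓡 m) p).map_source (by rwa [extChartAt_source])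
  refine hm.ext_left ht fun w => ?_
  have h1 : (mfderiv (𝓡 m) (𝓡 m) (extChartAt (𝓡 m) p) x).IsInvertible :=
    isInvertible_mfderiv_extChartAt (by rwa [extChartAt_source])
  obtain ⟨X, rfl⟩ := h1.bijective.2 w
  refine (chartMetric_extChartAt (E := EuclideanSpace ℝ (Fin m)) hx (grad m U x) X).trans ?_
  rw [gradG]
  refine Eq.trans ?_ (DFunLike.congr_fun (hm.apply_inverse ht _) _).symm
  exact (inner_grad U x X).trans (mvfderiv_eq_fderiv_chart hU hx X)

theorem mvfderiv_grad_eq {U ψ : M → ℝ} {x p : M}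
    (hψ : ContMDiffAt (𝓡 m) 𝓘(ℝ, ℝ) ∞ ψ x) (hU : ContMDiffAt (𝓡 m) 𝓘(ℝ, ℝ) ∞ U x)
    (hx : x ∈ (chartAt (EuclideanSpace ℝ (Fin m)) p).source) :
    mvfderiv (𝓡 m) ψ x (grad m U x) =
      fderiv ℝ (fun y => ψ ((extChartAt (𝓡 m) p).symm y)) (extChartAt (𝓡 m) p x)
        (gradG (chartMetric (riemMetric (𝓡 m) M) p)
          (fun y => U ((extChartAt (𝓡 m) p).symm y)) (extChartAt (𝓡 m) p x)) :=
  (mvfderiv_eq_fderiv_chart hψ hx _).trans (congrArg _ (mfderiv_extChartAt_grad hU hx))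

theorem continuous_mvfderiv_grad {F : M → ℝ} (hF : ContMDiff (𝓡 m) 𝓘(ℝ, ℝ) ∞ F) :
    Continuous fun x => mvfderiv (𝓡 m) F x (grad m F x) := by
  rw [continuous_iff_continuousAt]
  intro p
  have hm := isMetricOn_chartMetric (E := EuclideanSpace ℝ (Fin m)) p
  have hs := mem_chart_source (EuclideanSpace ℝ (Fin m)) p
  have h1 := ((contDiffAt_comp_extChartAt_symm (E := EuclideanSpace ℝ (Fin m)) hF.contMDiffAt
    hs).fderiv_right (m := ∞) (by simp)).continuousAt
  have h2 : ContinuousAt (fun y => fderiv ℝ (fun y => F ((extChartAt (𝓡 m) p).symm y)) y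
      (gradG (chartMetric (riemMetric (𝓡 m) M) p)
        (fun y => F ((extChartAt (𝓡 m) p).symm y)) y)) (extChartAt (𝓡 m) p p) :=
    h1.clm_apply ((hm.contDiffOn_inverse.continuousOn.continuousAt
      (hm.mem_nhds (mem_extChartAt_target p))).clm_apply h1)
  refine (ContinuousAt.comp (f := extChartAt (𝓡 m) p) h2
    (continuousAt_extChartAt p)).congr_of_eventuallyEq ?_
  filter_upwards [(chartAt (EuclideanSpace ℝ (Fin m)) p).open_source.mem_nhds hs] with x hx
  exact mvfderiv_grad_eq hF.contMDiffAt hF.contMDiffAt hx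

/-- The divergence of `ψ grad U`. -/
def greenIntegrand (m : ℕ) {M : Type*} [TopologicalSpace M]
    [ChartedSpace (EuclideanSpace ℝ (Fin m)) M]
    [RiemannianBundle (fun x : M => TangentSpace (𝓡 m) x)] (ψ U : M → ℝ) (x : M) : ℝ :=
  ψ x * lapM (EuclideanSpace ℝ (Fin m)) U x + mvfderiv (𝓡 m) ψ x (grad m U x)

omit [IsManifold (𝓡 m) ∞ M] [IsContMDiffRiemannianBundle (𝓡 m) ∞ (EuclideanSpace ℝ (Fin m))
    (fun x : M => TangentSpace (𝓡 m) x)] in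
theorem mvfderiv_eq_zero_of_notMem_tsupport {ψ : M → ℝ} {x : M} (hx : x ∉ tsupport ψ)
    (X : TangentSpace (𝓡 m) x) : mvfderiv (𝓡 m) ψ x X = 0 := by
  have h0 : ψ =ᶠ[𝓝 x] fun _ => 0 := notMem_tsupport_iff_eventuallyEq.1 hx
  have h1 := h0.mfderiv_eq (I := 𝓡 m) (I' := 𝓘(ℝ, ℝ))
  have h2 : mfderiv (𝓡 m) 𝓘(ℝ, ℝ) ψ x X = 0 := by
    refine (DFunLike.congr_fun h1 X).trans ?_
    rw [mfderiv_const]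
    rfl
  exact h2

omit [IsManifold (𝓡 m) ∞ M] [IsContMDiffRiemannianBundle (𝓡 m) ∞ (EuclideanSpace ℝ (Fin m))
    (fun x : M => TangentSpace (𝓡 m) x)] in
theorem greenIntegrand_eq_zero {ψ : M → ℝ} (U : M → ℝ) {x : M} (hx : x ∉ tsupport ψ) :
    greenIntegrand m ψ U x = 0 := by
  rw [greenIntegrand, image_eq_zero_of_notMem_tsupport hx, zero_mul, zero_add,
    mvfderiv_eq_zero_of_notMem_tsupport hx]

section LocalGreen

variable [T2Space M] {ψ U : M → ℝ} {p : M}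

/-- A function supported in the chart at `p`, read in this chart. -/
def chartRead (m : ℕ) {M : Type*} [TopologicalSpace M]
    [ChartedSpace (EuclideanSpace ℝ (Fin m)) M] (p : M) (ψ : M → ℝ) :
    EuclideanSpace ℝ (Fin m) → ℝ :=
  (extChartAt (𝓡 m) p).target.indicator fun y => ψ ((extChartAt (𝓡 m) p).symm y)

omit [IsManifold (𝓡 m) ∞ M] [RiemannianBundle (fun x : M => TangentSpace (𝓡 m) x)]
  [IsContMDiffRiemannianBundle (𝓡 m) ∞ (EuclideanSpace ℝ (Fin m))
    (fun x : M => TangentSpace (𝓡 m) x)] [T2Space M] in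
theorem chartRead_eventuallyEq (ψ : M → ℝ) {y : EuclideanSpace ℝ (Fin m)}
    (hy : y ∈ (extChartAt (𝓡 m) p).target) :
    chartRead m p ψ =ᶠ[𝓝 y] fun y => ψ ((extChartAt (𝓡 m) p).symm y) := by
  filter_upwards [(isOpen_extChartAt_target (I := 𝓡 m) p).mem_nhds hy] with z hz
  exact indicator_of_mem hz _

omit [IsManifold (𝓡 m) ∞ M] [RiemannianBundle (fun x : M => TangentSpace (𝓡 m) x)]
  [IsContMDiffRiemannianBundle (𝓡 m) ∞ (EuclideanSpace ℝ (Fin m))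
    (fun x : M => TangentSpace (𝓡 m) x)] [T2Space M] in
theorem isCompact_image_tsupport (hc : HasCompactSupport ψ)
    (hs : tsupport ψ ⊆ (chartAt (EuclideanSpace ℝ (Fin m)) p).source) :
    IsCompact (extChartAt (𝓡 m) p '' tsupport ψ) :=
  hc.isCompact.image_of_continuousOn ((continuousOn_extChartAt p).mono
    (by rwa [extChartAt_source]))

omit [IsManifold (𝓡 m) ∞ M] [RiemannianBundle (fun x : M => TangentSpace (𝓡 m) x)]
  [IsContMDiffRiemannianBundle (𝓡 m) ∞ (EuclideanSpace ℝ (Fin m))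
    (fun x : M => TangentSpace (𝓡 m) x)] [T2Space M] in
theorem tsupport_chartRead_subset (hc : HasCompactSupport ψ)
    (hs : tsupport ψ ⊆ (chartAt (EuclideanSpace ℝ (Fin m)) p).source) :
    tsupport (chartRead m p ψ) ⊆ extChartAt (𝓡 m) p '' tsupport ψ := by
  refine closure_minimal (fun y hy => ?_) (isCompact_image_tsupport hc hs).isClosed
  have hyt : y ∈ (extChartAt (𝓡 m) p).target := by
    by_contra h
    exact hy (indicator_of_notMem h _)
  refine ⟨(extChartAt (𝓡 m) p).symm y, subset_tsupport _ ?_, (extChartAt (𝓡 m) p).right_inv hyt⟩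
  have h1 : chartRead m p ψ y ≠ 0 := hy
  rwa [(chartRead_eventuallyEq ψ hyt).eq_of_nhds] at h1

omit [IsManifold (𝓡 m) ∞ M] [RiemannianBundle (fun x : M => TangentSpace (𝓡 m) x)]
  [IsContMDiffRiemannianBundle (𝓡 m) ∞ (EuclideanSpace ℝ (Fin m))
    (fun x : M => TangentSpace (𝓡 m) x)] [T2Space M] in
theorem image_tsupport_subset_target
    (hs : tsupport ψ ⊆ (chartAt (EuclideanSpace ℝ (Fin m)) p).source) :
    extChartAt (𝓡 m) p '' tsupport ψ ⊆ (extChartAt (𝓡 m) p).target := by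
  rintro _ ⟨x, hx, rfl⟩
  exact (extChartAt (𝓡 m) p).map_source (by rw [extChartAt_source]; exact hs hx)

theorem contDiff_chartRead (hψ : ContMDiff (𝓡 m) 𝓘(ℝ, ℝ) ∞ ψ) (hc : HasCompactSupport ψ)
    (hs : tsupport ψ ⊆ (chartAt (EuclideanSpace ℝ (Fin m)) p).source) :
    ContDiff ℝ ∞ (chartRead m p ψ) := by
  rw [contDiff_iff_contDiffAt]
  intro y
  by_cases hy : y ∈ tsupport (chartRead m p ψ)
  · obtain ⟨x, hx, rfl⟩ := tsupport_chartRead_subset hc hs hy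
    exact (contDiffAt_comp_extChartAt_symm (E := EuclideanSpace ℝ (Fin m)) hψ.contMDiffAt
      (hs hx)).congr_of_eventuallyEq (chartRead_eventuallyEq ψ
        (image_tsupport_subset_target hs ⟨x, hx, rfl⟩))
  · exact contDiffAt_const.congr_of_eventuallyEq (notMem_tsupport_iff_eventuallyEq.1 hy)

theorem greenIntegrand_eq_chart (hψ : ContMDiff (𝓡 m) 𝓘(ℝ, ℝ) ∞ ψ)
    (hs : tsupport ψ ⊆ (chartAt (EuclideanSpace ℝ (Fin m)) p).source)
    (hc : HasCompactSupport ψ)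
    (hU : ∀ x ∈ tsupport ψ, ContMDiffAt (𝓡 m) 𝓘(ℝ, ℝ) ∞ U x) {x : M}
    (hx : x ∈ (chartAt (EuclideanSpace ℝ (Fin m)) p).source) :
    greenIntegrand m ψ U x =
      chartRead m p ψ (extChartAt (𝓡 m) p x) * lapG (chartMetric (riemMetric (𝓡 m) M) p)
        (fun y => U ((extChartAt (𝓡 m) p).symm y)) (extChartAt (𝓡 m) p x) +
      fderiv ℝ (chartRead m p ψ) (extChartAt (𝓡 m) p x)
        (gradG (chartMetric (riemMetric (𝓡 m) M) p)
          (fun y => U ((extChartAt (𝓡 m) p).symm y)) (extChartAt (𝓡 m) p x)) := by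
  have hx' : x ∈ (extChartAt (𝓡 m) p).source := by rwa [extChartAt_source]
  have ht := (extChartAt (𝓡 m) p).map_source hx'
  have he := chartRead_eventuallyEq ψ ht
  by_cases hxs : x ∈ tsupport ψ
  · rw [greenIntegrand, lapM_eq_lapG (hU x hxs) hx, mvfderiv_grad_eq hψ.contMDiffAt (hU x hxs) hx,
      he.eq_of_nhds, he.fderiv_eq, (extChartAt (𝓡 m) p).left_inv hx']
  · have hn : extChartAt (𝓡 m) p x ∉ tsupport (chartRead m p ψ) := by
      intro h
      obtain ⟨z, hz, hzx⟩ := tsupport_chartRead_subset hc hs h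
      have : z = x := (extChartAt (𝓡 m) p).injOn (by rw [extChartAt_source]; exact hs hz) hx' hzx
      exact hxs (this ▸ hz)
    have h0 := notMem_tsupport_iff_eventuallyEq.1 hn
    rw [greenIntegrand_eq_zero U hxs, h0.eq_of_nhds, h0.fderiv_eq]
    simp

/-- In the chart the volume is Lebesgue measure with density `gramDensity`, so the statement reduces
to `IsMetricOn.integral_green`. -/
theorem green_of_tsupport_subset_chart [MeasurableSpace M] [BorelSpace M]
    (hψ : ContMDiff (𝓡 m) 𝓘(ℝ, ℝ) ∞ ψ)
    (hs : tsupport ψ ⊆ (chartAt (EuclideanSpace ℝ (Fin m)) p).source)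
    (hc : HasCompactSupport ψ) (hU : ∀ x ∈ tsupport ψ, ContMDiffAt (𝓡 m) 𝓘(ℝ, ℝ) ∞ U x) :
    Continuous (greenIntegrand m ψ U) ∧ ∫ x, greenIntegrand m ψ U x ∂(riemVolume m M) = 0 := by
  have hm := isMetricOn_chartMetric (E := EuclideanSpace ℝ (Fin m)) p
  have hsub := tsupport_chartRead_subset hc hs
  obtain ⟨hcont, hint⟩ := hm.integral_green (contDiff_chartRead hψ hc hs)
    ((isCompact_image_tsupport hc hs).of_isClosed_subset (isClosed_tsupport _) hsub)
    (hsub.trans (image_tsupport_subset_target hs))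
    (U := fun y => U ((extChartAt (𝓡 m) p).symm y)) (by
      intro y hy
      obtain ⟨x, hx, rfl⟩ := hsub hy
      exact contDiffAt_comp_extChartAt_symm (E := EuclideanSpace ℝ (Fin m)) (hU x hx) (hs hx))
  set L : EuclideanSpace ℝ (Fin m) → ℝ := fun y => chartRead m p ψ y *
      lapG (chartMetric (riemMetric (𝓡 m) M) p) (fun y => U ((extChartAt (𝓡 m) p).symm y)) y +
      fderiv ℝ (chartRead m p ψ) y (gradG (chartMetric (riemMetric (𝓡 m) M) p)
          (fun y => U ((extChartAt (𝓡 m) p).symm y)) y) with hL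
  have heq : ∀ x ∈ (chartAt (EuclideanSpace ℝ (Fin m)) p).source,
      greenIntegrand m ψ U x = L (extChartAt (𝓡 m) p x) :=
    fun x hx => greenIntegrand_eq_chart hψ hs hc hU hx
  -- Continuity is already known for the product of `L` with the density, and the density is
  -- continuous and positive.
  have hLc : ContinuousOn L (extChartAt (𝓡 m) p).target := by
    have h1 := hcont.continuousOn (s := (extChartAt (𝓡 m) p).target).div
      (continuousOn_volumeDensity p) (fun y hy => (volumeDensity_pos p hy).ne')
    refine h1.congr fun y hy => ?_
    exact (mul_div_cancel_left₀ (L y) (volumeDensity_pos p hy).ne').symm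
  have hgc : Continuous (greenIntegrand m ψ U) := by
    rw [continuous_iff_continuousAt]
    intro x
    by_cases hx : x ∈ tsupport ψ
    · have hx' : x ∈ (extChartAt (𝓡 m) p).source := by rw [extChartAt_source]; exact hs hx
      refine (ContinuousAt.comp (f := extChartAt (𝓡 m) p) (g := L)
        (hLc.continuousAt (hm.mem_nhds ((extChartAt (𝓡 m) p).map_source hx')))
        (continuousAt_extChartAt' hx')).congr_of_eventuallyEq ?_
      filter_upwards [(chartAt (EuclideanSpace ℝ (Fin m)) p).open_source.mem_nhds (hs hx)]
        with z hz using heq z hz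
    · refine continuousAt_const (y := (0 : ℝ)) |>.congr_of_eventuallyEq ?_
      filter_upwards [(isClosed_tsupport ψ).isOpen_compl.mem_nhds hx] with z hz
        using greenIntegrand_eq_zero U hz
  refine ⟨hgc, ?_⟩
  have hsm := (chartAt (EuclideanSpace ℝ (Fin m)) p).open_source.measurableSet
  have htm := (isOpen_extChartAt_target (I := 𝓡 m) p).measurableSet
  rw [← setIntegral_eq_integral_of_forall_compl_eq_zero
    (s := (chartAt (EuclideanSpace ℝ (Fin m)) p).source)
    (fun x hx => greenIntegrand_eq_zero U fun h => hx (hs h)), riemVolume_restrict_source p,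
    chartVolume, integral_map (aemeasurable_extChartAt_symm p)
      hgc.aestronglyMeasurable]
  have hdm : AEMeasurable (fun y => (volumeDensity (m := m) p y).toNNReal)
      ((volume : Measure (EuclideanSpace ℝ (Fin m))).restrict (extChartAt (𝓡 m) p).target) :=
    ((continuousOn_volumeDensity p).aemeasurable htm).real_toNNReal
  refine (integral_withDensity_eq_integral_smul₀ hdm _).trans ?_
  rw [← hint]
  have h3 : ∀ y ∈ (extChartAt (𝓡 m) p).target, (volumeDensity (m := m) p y).toNNReal •
      greenIntegrand m ψ U ((extChartAt (𝓡 m) p).symm y) =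
      gramDensity (chartMetric (riemMetric (𝓡 m) M) p) y * L y := by
    intro y hy
    have hx := (extChartAt (𝓡 m) p).map_target hy
    rw [heq _ (by rwa [extChartAt_source] at hx), (extChartAt (𝓡 m) p).right_inv hy,
      NNReal.smul_def, Real.coe_toNNReal _ (volumeDensity_pos p hy).le]
    rfl
  rw [setIntegral_congr_fun htm h3]
  refine setIntegral_eq_integral_of_forall_compl_eq_zero fun y hy => ?_
  have hn : y ∉ tsupport (chartRead m p ψ) := fun h =>
    hy (image_tsupport_subset_target hs (hsub h))
  have h0 := notMem_tsupport_iff_eventuallyEq.1 hn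
  simp only [hL]
  rw [h0.eq_of_nhds, h0.fderiv_eq]
  simp

end LocalGreen

end Grad

/-! ### Green's formula on the manifold. -/

section Green

variable {m : ℕ} {M : Type*} [TopologicalSpace M] [ChartedSpace (EuclideanSpace ℝ (Fin m)) M]
  [RiemannianBundle (fun x : M => TangentSpace (𝓡 m) x)] [IsManifold (𝓡 m) ∞ M]
  [IsContMDiffRiemannianBundle (𝓡 m) ∞ (EuclideanSpace ℝ (Fin m))
    (fun x : M => TangentSpace (𝓡 m) x)] [T2Space M] [MeasurableSpace M] [BorelSpace M]

theorem greenIntegrand_add {ψ₁ ψ₂ : M → ℝ} (U : M → ℝ) {x : M}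
    (h₁ : MDifferentiableAt (𝓡 m) 𝓘(ℝ, ℝ) ψ₁ x) (h₂ : MDifferentiableAt (𝓡 m) 𝓘(ℝ, ℝ) ψ₂ x) :
    greenIntegrand m (fun x => ψ₁ x + ψ₂ x) U x =
      greenIntegrand m ψ₁ U x + greenIntegrand m ψ₂ U x := by
  rw [greenIntegrand, greenIntegrand, greenIntegrand, mvfderiv_fun_add h₁ h₂, add_apply]
  ring

theorem integrable_greenIntegrand {ψ U : M → ℝ} (hc : HasCompactSupport ψ)
    (h : Continuous (greenIntegrand m ψ U)) :
    Integrable (greenIntegrand m ψ U) (riemVolume m M) :=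
  h.integrable_of_hasCompactSupport (hc.mono' (by
    intro x hx
    by_contra hn
    exact hx (greenIntegrand_eq_zero U hn)))

/-- Replaces a partition of unity. Writing `ψ = ψ χ + ψ (1 - χ)`, the first summand is supported in
one chart, and the support of the second avoids the points near which `χ = 1`, so the remaining bump
functions suffice for it. -/
theorem green_of_list (l : List ((c : M) × SmoothBumpFunction (𝓡 m) c)) {ψ U : M → ℝ}
    (hψ : ContMDiff (𝓡 m) 𝓘(ℝ, ℝ) ∞ ψ) (hc : HasCompactSupport ψ)
    (hU : ∀ x ∈ tsupport ψ, ContMDiffAt (𝓡 m) 𝓘(ℝ, ℝ) ∞ U x)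
    (hl : ∀ x ∈ tsupport ψ, ∃ χ ∈ l, χ.2 =ᶠ[𝓝 x] 1) :
    Continuous (greenIntegrand m ψ U) ∧ ∫ x, greenIntegrand m ψ U x ∂(riemVolume m M) = 0 := by
  induction l generalizing ψ with
  | nil =>
    have h0 : greenIntegrand m ψ U = fun _ => 0 := by
      funext x
      exact greenIntegrand_eq_zero U fun h => by simpa using hl x h
    rw [h0]
    exact ⟨continuous_const, by simp⟩
  | cons χ l ih =>
    have hχ : ContMDiff (𝓡 m) 𝓘(ℝ, ℝ) ∞ χ.2 := χ.2.contMDiff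
    have hχ' : ContMDiff (𝓡 m) 𝓘(ℝ, ℝ) ∞ (fun x => 1 - χ.2 x) := contMDiff_const.sub hχ
    have s1 : tsupport (fun x => ψ x * χ.2 x) ⊆ tsupport ψ := tsupport_mul_subset_left
    have s2 : tsupport (fun x => ψ x * (1 - χ.2 x)) ⊆ tsupport ψ := tsupport_mul_subset_left
    have c1 : HasCompactSupport (fun x => ψ x * χ.2 x) := hc.mul_right
    have c2 : HasCompactSupport (fun x => ψ x * (1 - χ.2 x)) := hc.mul_right
    have m1 : ContMDiff (𝓡 m) 𝓘(ℝ, ℝ) ∞ (fun x => ψ x * χ.2 x) := hψ.mul hχ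
    have m2 : ContMDiff (𝓡 m) 𝓘(ℝ, ℝ) ∞ (fun x => ψ x * (1 - χ.2 x)) := hψ.mul hχ'
    obtain ⟨k1, i1⟩ := green_of_tsupport_subset_chart (U := U) m1
      ((tsupport_mul_subset_right (f := ψ) (g := χ.2)).trans χ.2.tsupport_subset_chartAt_source)
      c1 (fun x hx => hU x (s1 hx))
    obtain ⟨k2, i2⟩ := ih m2 c2 (fun x hx => hU x (s2 hx)) (by
      intro x hx
      obtain ⟨ξ, hξ, hx1⟩ := hl x (s2 hx)
      rcases List.mem_cons.1 hξ with rfl | h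
      · refine absurd hx (notMem_tsupport_iff_eventuallyEq.2 ?_)
        filter_upwards [hx1] with z hz
        simp [hz]
      · exact ⟨ξ, h, hx1⟩)
    have hadd : greenIntegrand m ψ U = fun x => greenIntegrand m (fun x => ψ x * χ.2 x) U x +
        greenIntegrand m (fun x => ψ x * (1 - χ.2 x)) U x := by
      funext x
      rw [← greenIntegrand_add U (m1.contMDiffAt.mdifferentiableAt (by simp))
        (m2.contMDiffAt.mdifferentiableAt (by simp))]
      congr 1
      funext x
      ring
    rw [hadd]
    refine ⟨k1.add k2, ?_⟩
    rw [integral_add (integrable_greenIntegrand c1 k1) (integrable_greenIntegrand c2 k2), i1, i2,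
      add_zero]

/-- Green's formula on a Riemannian manifold. -/
theorem green {ψ U : M → ℝ} (hψ : ContMDiff (𝓡 m) 𝓘(ℝ, ℝ) ∞ ψ) (hc : HasCompactSupport ψ)
    (hU : ∀ x ∈ tsupport ψ, ContMDiffAt (𝓡 m) 𝓘(ℝ, ℝ) ∞ U x) :
    Continuous (greenIntegrand m ψ U) ∧ ∫ x, greenIntegrand m ψ U x ∂(riemVolume m M) = 0 := by
  have hχ : ∀ x : M, ∃ χ : SmoothBumpFunction (𝓡 m) x, True := fun x => ⟨Classical.arbitrary _, trivial⟩
  choose χ _ using hχ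
  obtain ⟨t, ht, hcov⟩ := hc.isCompact.elim_nhds_subcover (fun x => {z | χ x =ᶠ[𝓝 z] 1})
    (fun x _ => (χ x).eventuallyEq_one.eventually_nhds)
  refine green_of_list (t.toList.map fun x => ⟨x, χ x⟩) hψ hc hU fun z hz => ?_
  obtain ⟨x, hx, hxz⟩ := mem_iUnion₂.1 (hcov hz)
  exact ⟨⟨x, χ x⟩, List.mem_map.2 ⟨x, by simpa using hx, rfl⟩, hxz⟩


end Green

/-- Young's inequality with a weight. The coefficient of `y` can be taken as close to `1` as
desired, so approximation in `L²` does not worsen the constant in the bound for the tone. -/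
theorem enorm_sq_le {F : Type*} [NormedAddCommGroup F] (x y : F) {δ : ℝ} (hδ : 0 < δ) :
    ‖x‖ₑ ^ 2 ≤ ENNReal.ofReal (1 + δ) * ‖y‖ₑ ^ 2 + ENNReal.ofReal (1 + δ⁻¹) * ‖x - y‖ₑ ^ 2 := by
  have hδ' := inv_pos.2 hδ
  rw [← ofReal_norm, ← ofReal_norm, ← ofReal_norm, ← ENNReal.ofReal_pow (norm_nonneg _),
    ← ENNReal.ofReal_pow (norm_nonneg _), ← ENNReal.ofReal_pow (norm_nonneg _),
    ← ENNReal.ofReal_mul (by positivity), ← ENNReal.ofReal_mul (by positivity),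
    ← ENNReal.ofReal_add (by positivity) (by positivity)]
  refine ENNReal.ofReal_le_ofReal ?_
  have h1 : ‖x‖ ≤ ‖y‖ + ‖x - y‖ := by
    simpa using norm_add_le y (x - y)
  have h2 : ‖x‖ ^ 2 ≤ (‖y‖ + ‖x - y‖) ^ 2 := by gcongr
  have h3 : (1 + δ) * ‖y‖ ^ 2 + (1 + δ⁻¹) * ‖x - y‖ ^ 2 - (‖y‖ + ‖x - y‖) ^ 2 =
      δ⁻¹ * (δ * ‖y‖ - ‖x - y‖) ^ 2 := by
    field_simp
    ring
  have h4 : 0 ≤ δ⁻¹ * (δ * ‖y‖ - ‖x - y‖) ^ 2 := by positivity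
  linarith

/-! ### Barta's inequality for test functions. -/

section Tone

variable {m : ℕ} {M : Type*} [TopologicalSpace M] [ChartedSpace (EuclideanSpace ℝ (Fin m)) M]
  [RiemannianBundle (fun x : M => TangentSpace (𝓡 m) x)] [IsManifold (𝓡 m) ∞ M]
  [IsContMDiffRiemannianBundle (𝓡 m) ∞ (EuclideanSpace ℝ (Fin m))
    (fun x : M => TangentSpace (𝓡 m) x)] [T2Space M] [MeasurableSpace M] [BorelSpace M]

theorem mvfderiv_grad_self (F : M → ℝ) (x : M) :
    mvfderiv (𝓡 m) F x (grad m F x) = ‖grad m F x‖ ^ 2 := by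
  rw [← inner_grad, real_inner_self_eq_norm_sq]

theorem mvfderiv_sq {F : M → ℝ} {x : M} (hF : MDifferentiableAt (𝓡 m) 𝓘(ℝ, ℝ) F x)
    (X : TangentSpace (𝓡 m) x) :
    mvfderiv (𝓡 m) (fun x => F x * F x) x X = 2 * F x * mvfderiv (𝓡 m) F x X := by
  have h := mvfderiv_mul hF hF
  have h1 : mvfderiv (𝓡 m) (fun x => F x * F x) x X =
      (F x • mvfderiv (𝓡 m) F x + F x • mvfderiv (𝓡 m) F x) X := DFunLike.congr_fun h X
  rw [h1, add_apply, smul_apply, smul_eq_mul]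
  ring

/-- In the divergence of `F² grad U` the mixed term `2 F ⟨grad U, grad F⟩` is bounded by completing
a square. The weights `c/2` and `2/c` lead to the constant `(c/2)²`. -/
theorem greenIntegrand_sq_ge {F U : M → ℝ} {x : M} {c : ℝ} (hc : 0 < c)
    (hF : MDifferentiableAt (𝓡 m) 𝓘(ℝ, ℝ) F x)
    (hlap : c ≤ lapM (EuclideanSpace ℝ (Fin m)) U x)
    (hgrad : ∀ X : TangentSpace (𝓡 m) x, |mvfderiv (𝓡 m) U x X| ≤ ‖X‖) :
    c / 2 * (F x * F x) - 2 / c * mvfderiv (𝓡 m) F x (grad m F x) ≤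
      greenIntegrand m (fun x => F x * F x) U x := by
  have h1 : mvfderiv (𝓡 m) F x (grad m U x) = mvfderiv (𝓡 m) U x (grad m F x) := by
    rw [← inner_grad, ← inner_grad, real_inner_comm]
  rw [greenIntegrand, mvfderiv_sq hF, h1, mvfderiv_grad_self]
  have h2 := hgrad (grad m F x)
  generalize mvfderiv (𝓡 m) U x (grad m F x) = d at h2
  have h3 := norm_nonneg (grad m F x)
  generalize ‖grad m F x‖ = g at h2 h3
  generalize F x = a
  have h4 : c * (a * a) ≤ a * a * lapM (EuclideanSpace ℝ (Fin m)) U x := by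
    nlinarith [mul_self_nonneg a]
  have h5 : d ^ 2 ≤ g ^ 2 := sq_le_sq' (by linarith [(abs_le.1 h2).1]) (abs_le.1 h2).2
  have h6 : c / 2 * (a * a) + 2 * a * d + 2 / c * d ^ 2 = 2 / c * (d + c / 2 * a) ^ 2 := by
    field_simp
    ring
  have h7 : 0 ≤ 2 / c * (d + c / 2 * a) ^ 2 := by positivity
  have h8 : 2 / c * d ^ 2 ≤ 2 / c * g ^ 2 := by gcongr
  linarith

theorem hasCompactSupport_mvfderiv_grad {F : M → ℝ} (hc : HasCompactSupport F) :
    HasCompactSupport fun x => mvfderiv (𝓡 m) F x (grad m F x) :=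
  hc.mono' (by
    intro x hx
    by_contra hn
    exact hx (mvfderiv_eq_zero_of_notMem_tsupport hn _))

/-- The pointwise bound is integrated against the vanishing of the integral of the divergence, then
multiplied by `c/2`. -/
theorem integral_sq_le {Ω : Set M} {F U : M → ℝ} {c : ℝ} (hc : 0 < c)
    (hF : IsTestFunction m Ω F) (hU : ∀ x ∈ Ω, ContMDiffAt (𝓡 m) 𝓘(ℝ, ℝ) ∞ U x)
    (hlap : ∀ x ∈ Ω, c ≤ lapM (EuclideanSpace ℝ (Fin m)) U x)
    (hgrad : ∀ x ∈ Ω, ∀ X : TangentSpace (𝓡 m) x, |mvfderiv (𝓡 m) U x X| ≤ ‖X‖) :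
    (c / 2) ^ 2 * ∫ x, F x * F x ∂(riemVolume m M) ≤
      ∫ x, mvfderiv (𝓡 m) F x (grad m F x) ∂(riemVolume m M) := by
  obtain ⟨hFs, hFc, hFΩ⟩ := hF
  have hs : tsupport (fun x => F x * F x) ⊆ tsupport F := tsupport_mul_subset_left
  have hcs : HasCompactSupport (fun x => F x * F x) := hFc.mul_right
  obtain ⟨hcont, hint⟩ := green (U := U) (hFs.mul hFs) hcs fun x hx => hU x (hFΩ (hs hx))
  have i1 : Integrable (fun x => F x * F x) (riemVolume m M) :=
    (hFs.continuous.mul hFs.continuous).integrable_of_hasCompactSupport hcs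
  have i2 : Integrable (fun x => mvfderiv (𝓡 m) F x (grad m F x)) (riemVolume m M) :=
    (continuous_mvfderiv_grad hFs).integrable_of_hasCompactSupport
      (hasCompactSupport_mvfderiv_grad hFc)
  have hpt : ∀ x, c / 2 * (F x * F x) - 2 / c * mvfderiv (𝓡 m) F x (grad m F x) ≤
      greenIntegrand m (fun x => F x * F x) U x := by
    intro x
    by_cases hx : x ∈ tsupport F
    · exact greenIntegrand_sq_ge hc (hFs.contMDiffAt.mdifferentiableAt (by simp))
        (hlap x (hFΩ hx)) (hgrad x (hFΩ hx))
    · rw [greenIntegrand_eq_zero U fun h => hx (hs h), mvfderiv_eq_zero_of_notMem_tsupport hx,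
        image_eq_zero_of_notMem_tsupport hx]
      simp
  have h1 := integral_mono ((i1.const_mul (c / 2)).sub (i2.const_mul (2 / c)))
    (integrable_greenIntegrand hcs hcont) hpt
  have h2 : ∫ x, (c / 2 * (F x * F x) - 2 / c * mvfderiv (𝓡 m) F x (grad m F x)) ∂(riemVolume m M) =
      c / 2 * ∫ x, F x * F x ∂(riemVolume m M) -
        2 / c * ∫ x, mvfderiv (𝓡 m) F x (grad m F x) ∂(riemVolume m M) := by
    rw [integral_sub (i1.const_mul _) (i2.const_mul _), integral_const_mul, integral_const_mul]
  have h3 := h2.symm.le.trans (h1.trans hint.le)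
  generalize ∫ x, F x * F x ∂(riemVolume m M) = A at h3 ⊢
  generalize ∫ x, mvfderiv (𝓡 m) F x (grad m F x) ∂(riemVolume m M) = B at h3 ⊢
  have h4 : c / 2 * (c / 2 * A - 2 / c * B) = (c / 2) ^ 2 * A - B := by
    field_simp
  nlinarith

theorem lintegral_sq_le {Ω : Set M} {F U : M → ℝ} {c : ℝ} (hc : 0 < c)
    (hF : IsTestFunction m Ω F) (hU : ∀ x ∈ Ω, ContMDiffAt (𝓡 m) 𝓘(ℝ, ℝ) ∞ U x)
    (hlap : ∀ x ∈ Ω, c ≤ lapM (EuclideanSpace ℝ (Fin m)) U x)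
    (hgrad : ∀ x ∈ Ω, ∀ X : TangentSpace (𝓡 m) x, |mvfderiv (𝓡 m) U x X| ≤ ‖X‖) :
    ENNReal.ofReal ((c / 2) ^ 2) * ∫⁻ x in Ω, ‖F x‖ₑ ^ 2 ∂(riemVolume m M) ≤
      ∫⁻ x in Ω, ‖grad m F x‖ₑ ^ 2 ∂(riemVolume m M) := by
  have h1 := integral_sq_le hc hF hU hlap hgrad
  obtain ⟨hFs, hFc, hFΩ⟩ := hF
  have i1 : Integrable (fun x => F x * F x) (riemVolume m M) :=
    (hFs.continuous.mul hFs.continuous).integrable_of_hasCompactSupport hFc.mul_right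
  have i2 : Integrable (fun x => mvfderiv (𝓡 m) F x (grad m F x)) (riemVolume m M) :=
    (continuous_mvfderiv_grad hFs).integrable_of_hasCompactSupport
      (hasCompactSupport_mvfderiv_grad hFc)
  have e1 : ∫⁻ x in Ω, ‖F x‖ₑ ^ 2 ∂(riemVolume m M) ≤
      ENNReal.ofReal (∫ x, F x * F x ∂(riemVolume m M)) := by
    rw [ofReal_integral_eq_lintegral_ofReal i1 (ae_of_all _ fun x => mul_self_nonneg _)]
    refine (setLIntegral_le_lintegral _ _).trans (lintegral_mono fun x => ?_)
    rw [← ofReal_norm, ← ENNReal.ofReal_pow (norm_nonneg _), Real.norm_eq_abs, sq_abs, sq]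
  have e2 : ENNReal.ofReal (∫ x, mvfderiv (𝓡 m) F x (grad m F x) ∂(riemVolume m M)) ≤
      ∫⁻ x in Ω, ‖grad m F x‖ₑ ^ 2 ∂(riemVolume m M) := by
    rw [ofReal_integral_eq_lintegral_ofReal i2 (ae_of_all _ fun x => by
      change 0 ≤ mvfderiv (𝓡 m) F x (grad m F x)
      rw [mvfderiv_grad_self]; positivity)]
    refine le_trans (le_of_eq ?_) (lintegral_mono_set hFΩ)
    rw [← lintegral_indicator (isClosed_tsupport F).measurableSet]
    refine lintegral_congr fun x => ?_
    by_cases hx : x ∈ tsupport F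
    · rw [indicator_of_mem hx, mvfderiv_grad_self, ← ofReal_norm,
        ← ENNReal.ofReal_pow (norm_nonneg _)]
    · rw [indicator_of_notMem hx, mvfderiv_eq_zero_of_notMem_tsupport hx, ENNReal.ofReal_zero]
  calc _ ≤ ENNReal.ofReal ((c / 2) ^ 2) * ENNReal.ofReal (∫ x, F x * F x ∂(riemVolume m M)) := by
        gcongr
    _ = ENNReal.ofReal ((c / 2) ^ 2 * ∫ x, F x * F x ∂(riemVolume m M)) :=
        (ENNReal.ofReal_mul (sq_nonneg _)).symm
    _ ≤ _ := (ENNReal.ofReal_le_ofReal h1).trans e2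

end Tone

/-! ### From test functions to `H₀¹` and the fundamental tone. -/

section Tone

variable {m : ℕ} {M : Type*} [TopologicalSpace M] [ChartedSpace (EuclideanSpace ℝ (Fin m)) M]
  [RiemannianBundle (fun x : M => TangentSpace (𝓡 m) x)] [IsManifold (𝓡 m) ∞ M]
  [IsContMDiffRiemannianBundle (𝓡 m) ∞ (EuclideanSpace ℝ (Fin m))
    (fun x : M => TangentSpace (𝓡 m) x)] [T2Space M] [MeasurableSpace M] [BorelSpace M]

omit [T2Space M] [MeasurableSpace M] [BorelSpace M] in
theorem continuous_inner_self_tangentBundle :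
    Continuous fun z : TangentBundle (𝓡 m) M => inner ℝ z.2 z.2 := by
  have h : ContMDiff (𝓡 m).tangent (𝓡 m).tangent ∞
      (fun z : TangentBundle (𝓡 m) M => (⟨z.1, z.2⟩ : TangentBundle (𝓡 m) M)) := contMDiff_id
  exact (ContMDiff.inner_bundle (IB := 𝓡 m) (F := EuclideanSpace ℝ (Fin m))
    (E := fun x : M => TangentSpace (𝓡 m) x) h h).continuous

-- The squared length is a continuous function on the tangent bundle, so it is measurable along a
-- section measurable into that bundle.
omit [T2Space M] [BorelSpace M] in
theorem measurable_enorm_sq {V : Π x : M, TangentSpace (𝓡 m) x}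
    (hV : Measurable[_, borel (TangentBundle (𝓡 m) M)]
      (fun x => (⟨x, V x⟩ : TangentBundle (𝓡 m) M))) :
    Measurable fun x => ‖V x‖ₑ ^ 2 := by
  let _ : MeasurableSpace (TangentBundle (𝓡 m) M) := borel _
  have : BorelSpace (TangentBundle (𝓡 m) M) := ⟨rfl⟩
  have h1 := (continuous_inner_self_tangentBundle (m := m) (M := M)).measurable.comp hV
  have h2 := h1.ennreal_ofReal
  convert h2 using 2 with x
  rw [← ofReal_norm, ← ENNReal.ofReal_pow (norm_nonneg _), ← real_inner_self_eq_norm_sq]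
  rfl

theorem lintegral_sq_lt_top {Ω : Set M} {F : M → ℝ} (hF : IsTestFunction m Ω F) :
    ∫⁻ x in Ω, ‖F x‖ₑ ^ 2 ∂(riemVolume m M) < ⊤ := by
  have i1 : Integrable (fun x => F x * F x) (riemVolume m M) :=
    (hF.1.continuous.mul hF.1.continuous).integrable_of_hasCompactSupport hF.2.1.mul_right
  refine ((setLIntegral_le_lintegral _ _).trans (le_of_eq (lintegral_congr fun x => ?_))).trans_lt
    i1.hasFiniteIntegral
  rw [enorm_mul, sq]

theorem IsH01.mul_lintegral_le {Ω : Set M} {f : M → ℝ} {V : Π x : M, TangentSpace (𝓡 m) x}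
    (h : IsH01 Ω f V) {C : ℝ≥0∞} (hC : C ≠ ⊤)
    (hle : ∀ F : M → ℝ, IsTestFunction m Ω F → C * ∫⁻ x in Ω, ‖F x‖ₑ ^ 2 ∂(riemVolume m M) ≤
      ∫⁻ x in Ω, ‖grad m F x‖ₑ ^ 2 ∂(riemVolume m M)) :
    C * ∫⁻ x in Ω, ‖f x‖ₑ ^ 2 ∂(riemVolume m M) ≤ ∫⁻ x in Ω, ‖V x‖ₑ ^ 2 ∂(riemVolume m M) := by
  obtain ⟨-, hV, F, hF, hlim, hlim'⟩ := h
  have hVm := measurable_enorm_sq hV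
  set a := ∫⁻ x in Ω, ‖f x‖ₑ ^ 2 ∂(riemVolume m M)
  set b := ∫⁻ x in Ω, ‖V x‖ₑ ^ 2 ∂(riemVolume m M)
  set e : ℕ → ℝ≥0∞ := fun k => ∫⁻ x in Ω, ‖F k x - f x‖ₑ ^ 2 ∂(riemVolume m M)
  set e' : ℕ → ℝ≥0∞ := fun k => ∫⁻ x in Ω, ‖grad m (F k) x - V x‖ₑ ^ 2 ∂(riemVolume m M)
  -- Two limits: first `k → ∞` for fixed `δ`, where the error terms vanish, then `δ → 0`. One factor
  -- `1 + δ` comes from the approximation of `f`, the other from that of `V`.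
  have key : ∀ δ : ℝ, 0 < δ → C * a ≤ ENNReal.ofReal (1 + δ) * (ENNReal.ofReal (1 + δ) * b) := by
    intro δ hδ
    set s := ENNReal.ofReal (1 + δ)
    set t := ENNReal.ofReal (1 + δ⁻¹)
    have hk : ∀ k, C * a ≤ s * (s * b + t * e' k) + C * (t * e k) := by
      intro k
      have h1 : a ≤ s * (∫⁻ x in Ω, ‖F k x‖ₑ ^ 2 ∂(riemVolume m M)) + t * e k := by
        have hm : Measurable fun x => ‖F k x‖ₑ ^ 2 :=
          ((hF k).1.continuous.measurable.enorm).pow_const 2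
        refine (lintegral_mono fun x => enorm_sq_le (f x) (F k x) hδ).trans ?_
        rw [lintegral_add_left (hm.const_mul _), lintegral_const_mul _ hm,
          lintegral_const_mul' _ _ ENNReal.ofReal_ne_top]
        simp only [e]
        gcongr with x
        exact (enorm_sub_rev _ _).le
      have h2 : (∫⁻ x in Ω, ‖grad m (F k) x‖ₑ ^ 2 ∂(riemVolume m M)) ≤ s * b + t * e' k := by
        refine (lintegral_mono fun x => enorm_sq_le (grad m (F k) x) (V x) hδ).trans ?_
        rw [lintegral_add_left (hVm.const_mul _), lintegral_const_mul _ hVm,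
          lintegral_const_mul' _ _ ENNReal.ofReal_ne_top]
      calc C * a ≤ C * (s * (∫⁻ x in Ω, ‖F k x‖ₑ ^ 2 ∂(riemVolume m M)) + t * e k) := by gcongr
        _ = s * (C * ∫⁻ x in Ω, ‖F k x‖ₑ ^ 2 ∂(riemVolume m M)) + C * (t * e k) := by ring
        _ ≤ _ := by gcongr; exact (hle _ (hF k)).trans h2
    have hl : Tendsto (fun k => s * (s * b + t * e' k) + C * (t * e k)) atTop
        (𝓝 (s * (s * b + t * 0) + C * (t * 0))) := by
      refine Tendsto.add (ENNReal.Tendsto.const_mul (Tendsto.add tendsto_const_nhds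
        (ENNReal.Tendsto.const_mul hlim' (Or.inr ENNReal.ofReal_ne_top)))
          (Or.inr ENNReal.ofReal_ne_top)) ?_
      exact ENNReal.Tendsto.const_mul
        (ENNReal.Tendsto.const_mul hlim (Or.inr ENNReal.ofReal_ne_top)) (Or.inr hC)
    have := ge_of_tendsto' hl hk
    simpa using this
  have h3 : Tendsto (fun δ : ℝ => ENNReal.ofReal (1 + δ)) (𝓝[>] 0) (𝓝 1) := by
    have : Tendsto (fun δ : ℝ => ENNReal.ofReal (1 + δ)) (𝓝 0) (𝓝 (ENNReal.ofReal (1 + 0))) :=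
      ENNReal.tendsto_ofReal (tendsto_const_nhds.add tendsto_id)
    simpa using this.mono_left nhdsWithin_le_nhds
  have h4 : Tendsto (fun δ : ℝ => ENNReal.ofReal (1 + δ) * (ENNReal.ofReal (1 + δ) * b)) (𝓝[>] 0)
      (𝓝 (1 * 1 * b)) := by
    simp_rw [← mul_assoc]
    exact ENNReal.Tendsto.mul_const (ENNReal.Tendsto.mul h3 (Or.inl one_ne_zero) h3
      (Or.inl one_ne_zero)) (Or.inl (by simp))
  have h5 := ge_of_tendsto h4 (eventually_nhdsWithin_of_forall key)
  simpa using h5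

/-- A quotient in `ℝ≥0∞` with infinite denominator is zero, so finiteness is needed for the Rayleigh
quotient to be meaningful. -/
theorem IsH01.lintegral_sq_lt_top {Ω : Set M} {f : M → ℝ} {V : Π x : M, TangentSpace (𝓡 m) x}
    (h : IsH01 Ω f V) : ∫⁻ x in Ω, ‖f x‖ₑ ^ 2 ∂(riemVolume m M) < ⊤ := by
  obtain ⟨-, -, F, hF, hlim, -⟩ := h
  obtain ⟨k, hk⟩ := (hlim.eventually_lt_const (show (0 : ℝ≥0∞) < 1 by simp)).exists
  have hm : Measurable fun x => ‖F k x‖ₑ ^ 2 :=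
    ((hF k).1.continuous.measurable.enorm).pow_const 2
  refine (lintegral_mono fun x => enorm_sq_le (f x) (F k x) one_pos).trans_lt ?_
  rw [lintegral_add_left (hm.const_mul _), lintegral_const_mul _ hm,
    lintegral_const_mul' _ _ ENNReal.ofReal_ne_top]
  refine ENNReal.add_lt_top.2 ⟨ENNReal.mul_lt_top ENNReal.ofReal_lt_top
    (CylTone.lintegral_sq_lt_top (hF k)), ENNReal.mul_lt_top ENNReal.ofReal_lt_top ?_⟩
  refine (le_of_eq (lintegral_congr fun x => ?_)).trans_lt (hk.trans (by simp))
  rw [enorm_sub_rev]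

theorem le_fundamentalTone {Ω : Set M} {C : ℝ≥0∞} (hC : C ≠ ⊤)
    (hle : ∀ F : M → ℝ, IsTestFunction m Ω F → C * ∫⁻ x in Ω, ‖F x‖ₑ ^ 2 ∂(riemVolume m M) ≤
      ∫⁻ x in Ω, ‖grad m F x‖ₑ ^ 2 ∂(riemVolume m M)) :
    C ≤ fundamentalTone m Ω := by
  refine le_iInf fun f => le_iInf fun V => le_iInf fun h => ?_
  rw [ENNReal.le_div_iff_mul_le (Or.inl h.2) (Or.inl h.1.lintegral_sq_lt_top.ne)]
  exact h.1.mul_lintegral_le hC hle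

/-- Barta's criterion: a function with Laplacian at least `c'` for every `c' < c` and gradient of
length at most one bounds the fundamental tone below by `(c / 2) ^ 2`. -/
theorem le_fundamentalTone_of_lapM {Ω : Set M} {c : ℝ} (hc : 0 < c)
    (h : ∀ c' : ℝ, 0 < c' → c' < c → ∃ U : M → ℝ,
      (∀ x ∈ Ω, ContMDiffAt (𝓡 m) 𝓘(ℝ, ℝ) ∞ U x) ∧
      (∀ x ∈ Ω, c' ≤ lapM (EuclideanSpace ℝ (Fin m)) U x) ∧
      ∀ x ∈ Ω, ∀ X : TangentSpace (𝓡 m) x, |mvfderiv (𝓡 m) U x X| ≤ ‖X‖) :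
    ENNReal.ofReal ((c / 2) ^ 2) ≤ fundamentalTone m Ω := by
  have h1 : ∀ᶠ c' in 𝓝[<] c, ENNReal.ofReal ((c' / 2) ^ 2) ≤ fundamentalTone m Ω := by
    filter_upwards [Ioo_mem_nhdsLT hc] with c' hc'
    obtain ⟨U, h1, h2, h3⟩ := h c' hc'.1 hc'.2
    exact le_fundamentalTone ENNReal.ofReal_ne_top fun F hF => lintegral_sq_le hc'.1 hF h1 h2 h3
  have h2 : Continuous fun c' : ℝ => ENNReal.ofReal ((c' / 2) ^ 2) :=
    ENNReal.continuous_ofReal.comp (by fun_prop)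
  exact le_of_tendsto ((h2.tendsto c).mono_left nhdsWithin_le_nhds) h1

end Tone

/-! ### Choice of the smoothing scale, and the inverse of `C_κ/S_κ`. -/

section Comparison

/-- Monotonicity of `C_κ/S_κ` gives `Q(ρ) ≥ c ρ`, which is useless near `ρ = 0`. There `Q` is
bounded below by its positive minimum `d` on the compact interval, and the two bounds are combined.
-/
theorem exists_smoothing_scale {κ r a b : ℝ} (hr : 0 < r) (hκ : 0 < κ → r ≤ Real.pi / (2 * √κ))
    (ha : 0 < a) {c' : ℝ} (hc' : 0 < c') (hlt : c' < a * (compC κ r / compS κ r) - b) :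
    ∃ ε : ℝ, 0 < ε ∧ ∀ ρ ∈ Ico 0 r, c' * √(ρ ^ 2 + ε ^ 2) ≤ a * radialCoeff κ ρ - ρ * b := by
  set c := a * (compC κ r / compS κ r) - b with hc
  set Q : ℝ → ℝ := fun ρ => a * radialCoeff κ ρ - ρ * b with hQ
  have hcpos : 0 < c := hc'.trans hlt
  have h1 : ∀ ρ ∈ Icc 0 r, c * ρ ≤ Q ρ := by
    intro ρ hρ
    rcases eq_or_lt_of_le hρ.1 with h0 | h0
    · subst h0
      simp [hQ, radialCoeff, ha.le]
    · have h2 : compC κ r / compS κ r ≤ compC κ ρ / compS κ ρ := by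
        rcases eq_or_lt_of_le hρ.2 with h3 | h3
        · rw [h3]
        · exact (compRatio_lt h0 h3 (mem_compDomain_of_le_half hr hκ)).le
      simp only [hQ, hc, radialCoeff, if_neg h0.ne']
      have h4 := mul_le_mul_of_nonneg_left h2 (mul_pos ha h0).le
      linarith
  have hpos : ∀ ρ ∈ Icc 0 r, 0 < Q ρ := by
    intro ρ hρ
    rcases eq_or_lt_of_le hρ.1 with h0 | h0
    · subst h0
      simp [hQ, radialCoeff, ha]
    · exact (mul_pos hcpos h0).trans_le (h1 ρ hρ)
  have hQc : ContinuousOn Q (Icc 0 r) :=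
    (continuousOn_const.mul (continuousOn_radialCoeff hκ)).sub (continuousOn_id.mul continuousOn_const)
  obtain ⟨ρ₀, hρ₀, hmin⟩ := isCompact_Icc.exists_isMinOn (nonempty_Icc.2 hr.le) hQc
  set d := Q ρ₀
  have hd : 0 < d := hpos ρ₀ hρ₀
  have hs : 0 < 1 - (c' / c) ^ 2 := by
    have : c' / c < 1 := (div_lt_one hcpos).2 hlt
    have h0 : 0 < c' / c := div_pos hc' hcpos
    nlinarith
  -- With this `ε`, the number `c'² (ρ² + ε²)` is the convex combination of `(c ρ)²` and `d²` with
  -- weights `(c'/c)²` and `1 - (c'/c)²`; both are at most `Q(ρ)²`.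
  refine ⟨√(1 - (c' / c) ^ 2) * d / c', by positivity, fun ρ hρ => ?_⟩
  have hρ' := Ico_subset_Icc_self hρ
  have h2 : d ≤ Q ρ := hmin hρ'
  have h3 := h1 ρ hρ'
  have h4 : (c * ρ) ^ 2 ≤ Q ρ ^ 2 := by
    have := mul_nonneg hcpos.le hρ.1
    gcongr
  have h5 : d ^ 2 ≤ Q ρ ^ 2 := by gcongr
  have h6 : c' * √(ρ ^ 2 + (√(1 - (c' / c) ^ 2) * d / c') ^ 2) =
      √((c' / c) ^ 2 * (c * ρ) ^ 2 + (1 - (c' / c) ^ 2) * d ^ 2) := by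
    rw [← Real.sqrt_sq hc'.le, ← Real.sqrt_mul (sq_nonneg _), Real.sqrt_sq hc'.le]
    congr 1
    rw [div_pow, mul_pow, Real.sq_sqrt hs.le]
    field_simp
  rw [h6]
  refine Real.sqrt_le_iff.2 ⟨(hpos ρ hρ').le, ?_⟩
  calc _ ≤ (c' / c) ^ 2 * Q ρ ^ 2 + (1 - (c' / c) ^ 2) * Q ρ ^ 2 := by gcongr
    _ = Q ρ ^ 2 := by ring

/-- The supremum may not be attained, so the inequality is obtained for every `t < r` and extended
to `r` by continuity. -/
theorem le_compRatio_of_le_compRatioInv {κ r s : ℝ} (hr : r ∈ compDomain κ)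
    (h : ENNReal.ofReal r ≤ compRatioInv κ s) : s ≤ compC κ r / compS κ r := by
  have h1 : ∀ᶠ t in 𝓝[<] r, s ≤ compC κ t / compS κ t := by
    filter_upwards [Ioo_mem_nhdsLT hr.1] with t ht
    have h2 : ENNReal.ofReal t < compRatioInv κ s :=
      ((ENNReal.ofReal_lt_ofReal_iff hr.1).2 ht.2).trans_le h
    rw [compRatioInv] at h2
    obtain ⟨u, hu⟩ := lt_iSup_iff.1 h2
    obtain ⟨⟨hud, hus⟩, hu⟩ := lt_iSup_iff.1 hu
    have htu : t < u := (ENNReal.ofReal_lt_ofReal_iff hud.1).1 hu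
    exact hus.trans (compRatio_lt ht.1 htu hud).le
  exact ge_of_tendsto ((hasDerivAt_compRatio hr).continuousAt.tendsto.mono_left
    nhdsWithin_le_nhds) h1

theorem lt_compRatio_of_lt_compRatioInv {κ r s : ℝ} (hr : 0 < r)
    (h : ENNReal.ofReal r < compRatioInv κ s) : s < compC κ r / compS κ r := by
  rw [compRatioInv] at h
  obtain ⟨u, hu⟩ := lt_iSup_iff.1 h
  obtain ⟨⟨hud, hus⟩, hu⟩ := lt_iSup_iff.1 hu
  exact hus.trans_lt (compRatio_lt hr ((ENNReal.ofReal_lt_ofReal_iff hud.1).1 hu) hud)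

theorem lt_of_compRatio_lt {κ s t : ℝ} (hs : 0 < s) (ht : t ∈ compDomain κ)
    (h : compC κ s / compS κ s < compC κ t / compS κ t) : t < s := by
  by_contra! hst
  rcases eq_or_lt_of_le hst with h1 | h1
  · rw [h1] at h
    exact lt_irrefl _ h
  · exact lt_asymm h (compRatio_lt hs h1 ht)

end Comparison

/-! ### The estimate on cylinders. -/

section Cylinder

variable {m n : ℕ} {M : Type*} [TopologicalSpace M] [ChartedSpace (EuclideanSpace ℝ (Fin m)) M]
  [RiemannianBundle (fun x : M => TangentSpace (𝓡 m) x)] [IsManifold (𝓡 m) ∞ M]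
  [IsContMDiffRiemannianBundle (𝓡 m) ∞ (EuclideanSpace ℝ (Fin m))
    (fun x : M => TangentSpace (𝓡 m) x)]
  {N : Type*} [MetricSpace N] [ChartedSpace (EuclideanSpace ℝ (Fin n)) N]
  [RiemannianBundle (fun x : N => TangentSpace (𝓡 n) x)] [IsManifold (𝓡 n) ∞ N]
  [IsContMDiffRiemannianBundle (𝓡 n) ∞ (EuclideanSpace ℝ (Fin n))
    (fun x : N => TangentSpace (𝓡 n) x)]
  {φ : M → N × ℝ}

theorem norm_mfderiv_fst_le
    (hφ : IsIsometricImmersion (riemMetric (𝓡 m) M) (cylMetric (𝓡 n) N) φ) (x : M)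
    (X : TangentSpace (𝓡 m) x) :
    ‖mfderiv (𝓡 m) (𝓡 n) (fun x => (φ x).1) x X‖ ≤ ‖X‖ := by
  have hd : MDifferentiableAt (𝓡 m) ((𝓡 n).prod 𝓘(ℝ, ℝ)) φ x :=
    hφ.1.contMDiffAt.mdifferentiableAt (by simp)
  have h1 : (mfderiv (𝓡 m) (𝓡 n) (fun x => (φ x).1) x X : EuclideanSpace ℝ (Fin n)) =
      horizontalDeriv (n := n) φ x X := by
    have h2 := mfderiv_comp (I'' := 𝓡 n) x (mdifferentiableAt_fst (I := 𝓡 n) (I' := 𝓘(ℝ, ℝ))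
      (x := φ x)) hd
    rw [mfderiv_fst] at h2
    exact DFunLike.congr_fun h2 X
  have h3 := hφ.inner_eq x X
  have h4 := chartMetric_self_apply (D := EuclideanSpace ℝ (Fin n)) (φ x).1
    (mfderiv (𝓡 m) (𝓡 n) (fun x => (φ x).1) x X) (mfderiv (𝓡 m) (𝓡 n) (fun x => (φ x).1) x X)
  have h5 : chartMetric (riemMetric (𝓡 n) N) (φ x).1 (extChartAt (𝓡 n) (φ x).1 (φ x).1)
      (horizontalDeriv (n := n) φ x X) (horizontalDeriv (n := n) φ x X) =
      ‖mfderiv (𝓡 m) (𝓡 n) (fun x => (φ x).1) x X‖ ^ 2 := by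
    rw [← real_inner_self_eq_norm_sq, ← h1]
    exact h4
  rw [h5, real_inner_self_eq_norm_sq] at h3
  exact le_of_sq_le_sq (by nlinarith [sq_nonneg (verticalDeriv (n := n) φ x X)]) (norm_nonneg _)

variable {V : Type*} [NormedAddCommGroup V] [InnerProductSpace ℝ V] [FiniteDimensional ℝ V]
  {A : V → N} {r : ℝ}

/-- The projection to `N` shortens vectors, and the gradient of `√(ρ² + ε²)` has length at most `ρ /
√(ρ² + ε²) ≤ 1`. -/
theorem IsNormalParam.abs_mvfderiv_smoothRadius_le
    (h : IsNormalParam (E := EuclideanSpace ℝ (Fin n)) A r)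
    (hφ : IsIsometricImmersion (riemMetric (𝓡 m) M) (cylMetric (𝓡 n) N) φ) {ε : ℝ}
    (hε : 0 < ε) {x : M} (hx : (φ x).1 ∈ A '' Metric.ball (0 : V) r)
    (X : TangentSpace (𝓡 m) x) :
    |mvfderiv (𝓡 m) (fun x => smoothRadius A r ε (φ x).1) x X| ≤ ‖X‖ := by
  have hd : MDifferentiableAt (𝓡 m) (𝓡 n) (fun x => (φ x).1) x :=
    (contMDiff_fst.comp hφ.1).contMDiffAt.mdifferentiableAt (by simp)
  have hu := (h.contMDiffAt_radialEnergy hx).mdifferentiableAt (by simp)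
  have hpos := smoothRadius_pos A r hε (φ x).1
  have hg : HasFDerivAt (fun t : ℝ => √(2 * t + ε ^ 2))
      ((1 / (2 * √(2 * radialEnergy A r (φ x).1 + ε ^ 2))) • ((2 : ℝ) •
        ContinuousLinearMap.id ℝ ℝ)) (radialEnergy A r (φ x).1) :=
    (((hasFDerivAt_id _).const_mul 2).add_const _).sqrt hpos.ne'
  have h1 : mvfderiv (𝓡 m) (fun x => radialEnergy A r (φ x).1) x X =
      mvfderiv (𝓡 n) (radialEnergy A r) (φ x).1 (mfderiv (𝓡 m) (𝓡 n) (fun x => (φ x).1) x X) :=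
    mvfderiv_comp_apply (g := radialEnergy A r) (f := fun x => (φ x).1) x hu hd X
  have h2 : mvfderiv (𝓡 m) (fun x => smoothRadius A r ε (φ x).1) x X =
      mvfderiv (𝓡 m) (fun x => radialEnergy A r (φ x).1) x X / smoothRadius A r ε (φ x).1 := by
    have h3 := HasMFDerivAt.comp x hg.hasMFDerivAt
      (MDifferentiableAt.comp (f := fun x => (φ x).1) x hu hd).hasMFDerivAt
    have h4 := DFunLike.congr_fun h3.mfderiv X
    refine h4.trans ?_
    change (1 / (2 * √(2 * radialEnergy A r (φ x).1 + ε ^ 2))) * (2 *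
      mvfderiv (𝓡 m) (fun x => radialEnergy A r (φ x).1) x X) = _
    rw [smoothRadius]
    field_simp
  have h3 := h.abs_mvfderiv_radialEnergy_le hx (mfderiv (𝓡 m) (𝓡 n) (fun x => (φ x).1) x X)
  have h4 := norm_mfderiv_fst_le hφ x X
  have h5 : 0 < smoothRadius A r ε (φ x).1 := Real.sqrt_pos.2 hpos
  have h6 : ‖paramInv A r (φ x).1‖ ≤ smoothRadius A r ε (φ x).1 := by
    refine Real.le_sqrt_of_sq_le ?_
    rw [two_mul_radialEnergy]
    linarith [sq_nonneg ε]
  rw [h2, abs_div, abs_of_pos h5, div_le_iff₀ h5, h1, mul_comm ‖X‖]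
  exact h3.trans (mul_le_mul h6 h4 (norm_nonneg _) h5.le)

/-- Barta's criterion with `U` the smoothed radius along `φ`. On the cylinder `|H|` is at most its
supremum, and `exists_smoothing_scale` provides `ε` for each `c'` below the limiting constant. -/
theorem IsNormalParam.le_fundamentalTone [IsRiemannianManifold (𝓡 n) N] [T2Space M]
    [MeasurableSpace M] [BorelSpace M]
    (h : IsNormalParam (E := EuclideanSpace ℝ (Fin n)) A r) (hm : 3 ≤ m)
    (hφ : IsIsometricImmersion (riemMetric (𝓡 m) M) (cylMetric (𝓡 n) N) φ) {κ : ℝ}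
    (hr : 0 < κ → r ≤ Real.pi / (2 * √κ)) (hκ : RadialCurvatureLE (𝓡 n) (A 0) κ)
    (hbdd : BddAbove (meanCurvatureValues m n φ (A 0) r)) {Ω : Set M}
    (hΩ : Ω ⊆ cylPreimage φ (A 0) r)
    (hc : 0 < ((m : ℝ) - 2) * (compC κ r / compS κ r) - meanCurvatureSup m n φ (A 0) r) :
    ENNReal.ofReal (((((m : ℝ) - 2) * (compC κ r / compS κ r)
      - meanCurvatureSup m n φ (A 0) r) / 2) ^ 2) ≤ fundamentalTone m Ω := by
  have hm' : (0 : ℝ) < (m : ℝ) - 2 := by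
    have : (3 : ℝ) ≤ m := by exact_mod_cast hm
    linarith
  refine le_fundamentalTone_of_lapM hc fun c' hc' hlt => ?_
  obtain ⟨ε, hε, hρ⟩ := exists_smoothing_scale h.pos hr hm' hc' hlt
  have hmem : ∀ x ∈ Ω, (φ x).1 ∈ A '' Metric.ball (0 : V) r := fun x hx =>
    h.ball_subset_image (hΩ hx).1
  refine ⟨fun x => smoothRadius A r ε (φ x).1, fun x hx => ?_, fun x hx => ?_,
    fun x hx X => h.abs_mvfderiv_smoothRadius_le hφ hε (hmem x hx) X⟩
  · exact ContMDiffAt.comp (g := smoothRadius A r ε) (f := fun x => (φ x).1) x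
      (h.contMDiffAt_smoothRadius hε (hmem x hx)) (contMDiff_fst.comp hφ.1).contMDiffAt
  · refine le_trans ?_ (h.le_lapM_smoothRadius hφ hr hκ hε (hmem x hx))
    have hσ : 0 < smoothRadius A r ε (φ x).1 := Real.sqrt_pos.2 (smoothRadius_pos A r hε _)
    have hball : ‖paramInv A r (φ x).1‖ ∈ Ico 0 r := by
      obtain ⟨v, hv, hvx⟩ := hmem x hx
      rw [← hvx, h.paramInv_apply hv]
      exact ⟨norm_nonneg _, by simpa using hv⟩
    have hH : meanCurvatureNorm m n φ x ≤ meanCurvatureSup m n φ (A 0) r :=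
      le_csSup hbdd ⟨x, hΩ hx, rfl⟩
    have h1 := hρ _ hball
    rw [le_div_iff₀ hσ, smoothRadius, two_mul_radialEnergy]
    have h2 := mul_le_mul_of_nonneg_left hH (norm_nonneg (paramInv A r (φ x).1))
    linarith

theorem meanCurvatureSup_mono (hH : LocallyBoundedMeanCurvature m n φ) {p : N} {s t : ℝ}
    (hs : 0 < s) (hst : s ≤ t) (hne : (cylPreimage φ p s).Nonempty) :
    meanCurvatureSup m n φ p s ≤ meanCurvatureSup m n φ p t :=
  csSup_le_csSup (hH p t (hs.trans_le hst)) (hne.image _) (image_mono fun _ hx =>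
    ⟨Metric.ball_subset_ball hst hx.1, hx.2⟩)

end Cylinder

/-- In the first case `h(x₀, r) < Λ² ≤ (m-2)(C_κ/S_κ)(r)`. In the second, `(C_κ/S_κ)(r₀) = h(x₀,
r₀)/(m-2) < (C_κ/S_κ)(r)` forces `r < r₀`, so that `h(x₀, r) ≤ h(x₀, r₀) < (m-2)(C_κ/S_κ)(r)`. -/
theorem drift_pos {m n : ℕ} (hm : 3 ≤ m)
    {M : Type*} [TopologicalSpace M] [ChartedSpace (EuclideanSpace ℝ (Fin m)) M]
    [RiemannianBundle (fun x : M => TangentSpace (𝓡 m) x)]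
    {N : Type*} [MetricSpace N] [ChartedSpace (EuclideanSpace ℝ (Fin n)) N]
    [RiemannianBundle (fun x : N => TangentSpace (𝓡 n) x)] [IsManifold (𝓡 m) ∞ M]
    [IsContMDiffRiemannianBundle (𝓡 m) ∞ (EuclideanSpace ℝ (Fin m))
      (fun x : M => TangentSpace (𝓡 m) x)] [IsManifold (𝓡 n) ∞ N]
    [IsContMDiffRiemannianBundle (𝓡 n) ∞ (EuclideanSpace ℝ (Fin n))
      (fun x : N => TangentSpace (𝓡 n) x)] {φ : M → N × ℝ}
    (hH : LocallyBoundedMeanCurvature m n φ) {x₀ : N} {κ r : ℝ} (hr0 : 0 < r)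
    (hr_pi : 0 < κ → r ≤ Real.pi / (2 * √κ))
    (hr : (∃ Λ : ℝ, meanCurvatureSup m n φ x₀ r < Λ ^ 2 ∧
            ENNReal.ofReal r ≤ compRatioInv κ (Λ ^ 2 / ((m : ℝ) - 2))) ∨
          (Tendsto (fun t => meanCurvatureSup m n φ x₀ t) atTop atTop ∧
            ∃ r₀ ∈ compDomain κ,
              ((m : ℝ) - 2) * (compC κ r₀ / compS κ r₀) - meanCurvatureSup m n φ x₀ r₀ = 0 ∧
              ENNReal.ofReal r < compRatioInv κ (meanCurvatureSup m n φ x₀ r₀ / ((m : ℝ) - 2))))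
    (hne : (cylPreimage φ x₀ r).Nonempty) :
    0 < ((m : ℝ) - 2) * (compC κ r / compS κ r) - meanCurvatureSup m n φ x₀ r := by
  have hm' : (0 : ℝ) < (m : ℝ) - 2 := by
    have : (3 : ℝ) ≤ m := by exact_mod_cast hm
    linarith
  have hdom := mem_compDomain_of_le_half hr0 hr_pi
  rcases hr with ⟨Λ, hΛ, hle⟩ | ⟨-, r₀, hr₀, h0, hlt⟩
  · have h1 := (div_le_iff₀' hm').1 (le_compRatio_of_le_compRatioInv hdom hle)
    linarith
  · have h1 := lt_compRatio_of_lt_compRatioInv hr0 hlt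
    have h2 : compC κ r₀ / compS κ r₀ < compC κ r / compS κ r := by
      refine lt_of_eq_of_lt ?_ h1
      rw [eq_div_iff hm'.ne']
      linarith
    have h3 := meanCurvatureSup_mono hH hr0 (lt_of_compRatio_lt hr₀.1 hdom h2).le hne
    have h4 := (div_lt_iff₀' hm').1 h1
    linarith

end CylTone

end

theorem mainTheorem3 (m n : ℕ) (hm : 3 ≤ m)
    {N : Type*} [MetricSpace N] [ChartedSpace (EuclideanSpace ℝ (Fin n)) N]
    [IsManifold (𝓡 n) ∞ N] [RiemannianBundle (fun x : N => TangentSpace (𝓡 n) x)]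
    [IsContMDiffRiemannianBundle (𝓡 n) ∞ (EuclideanSpace ℝ (Fin n))
      (fun x : N => TangentSpace (𝓡 n) x)]
    [IsRiemannianManifold (𝓡 n) N] [CompleteSpace N]
    {M : Type*} [MetricSpace M] [ChartedSpace (EuclideanSpace ℝ (Fin m)) M]
    [IsManifold (𝓡 m) ∞ M] [RiemannianBundle (fun x : M => TangentSpace (𝓡 m) x)]
    [IsContMDiffRiemannianBundle (𝓡 m) ∞ (EuclideanSpace ℝ (Fin m))
      (fun x : M => TangentSpace (𝓡 m) x)]
    [IsRiemannianManifold (𝓡 m) M] [CompleteSpace M] [MeasurableSpace M] [BorelSpace M]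
    (φ : M → N × ℝ)
    (hφ : CylTone.IsIsometricImmersion (CylTone.riemMetric (𝓡 m) M)
      (CylTone.cylMetric (𝓡 n) N) φ)
    (hH : CylTone.LocallyBoundedMeanCurvature m n φ)
    (x₀ : N) (κ : ℝ) (hκ : CylTone.RadialCurvatureLE (𝓡 n) x₀ κ)
    (r : ℝ) (hr_inj : ENNReal.ofReal r ≤ CylTone.injRadius (𝓡 n) x₀)
    (hr_pi : 0 < κ → r ≤ Real.pi / (2 * √κ))
    (hr : (∃ Λ : ℝ, CylTone.meanCurvatureSup m n φ x₀ r < Λ ^ 2 ∧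
            ENNReal.ofReal r ≤ CylTone.compRatioInv κ (Λ ^ 2 / ((m : ℝ) - 2))) ∨
          (Tendsto (fun t => CylTone.meanCurvatureSup m n φ x₀ t) atTop atTop ∧
            ∃ r₀ ∈ CylTone.compDomain κ,
              ((m : ℝ) - 2) * (CylTone.compC κ r₀ / CylTone.compS κ r₀)
                - CylTone.meanCurvatureSup m n φ x₀ r₀ = 0 ∧
              ENNReal.ofReal r < CylTone.compRatioInv κ
                (CylTone.meanCurvatureSup m n φ x₀ r₀ / ((m : ℝ) - 2))))
    (q : M) (hq : q ∈ CylTone.cylPreimage φ x₀ r) :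
    ENNReal.ofReal (((((m : ℝ) - 2) * (CylTone.compC κ r / CylTone.compS κ r)
        - CylTone.meanCurvatureSup m n φ x₀ r) / 2) ^ 2)
      ≤ CylTone.fundamentalTone m (connectedComponentIn (CylTone.cylPreimage φ x₀ r) q) ∧
    0 < ((((m : ℝ) - 2) * (CylTone.compC κ r / CylTone.compS κ r)
        - CylTone.meanCurvatureSup m n φ x₀ r) / 2) ^ 2 := by
  have hr0 : 0 < r := Metric.pos_of_mem_ball hq.1
  have hinj := CylTone.isInjRadius_of_le (E := EuclideanSpace ℝ (Fin n)) hr0 hr_inj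
  have hA := hinj.isNormalParam
  have hA0 := hinj.expMap_zero
  have hc := CylTone.drift_pos hm hH hr0 hr_pi hr ⟨q, hq⟩
  -- The bound holds for every subset of the preimage of the cylinder; the component enters only
  -- through that inclusion. The normal coordinates are centred at `exp 0`, which `hA0` identifies
  -- with `x₀`.
  have h := hA.le_fundamentalTone hm hφ hr_pi (by rw [hA0]; exact hκ) (by rw [hA0]; exact hH x₀ r hr0)
    (Ω := connectedComponentIn (CylTone.cylPreimage φ x₀ r) q)
    (by rw [hA0]; exact connectedComponentIn_subset _ _) (by rw [hA0]; exact hc)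
  rw [hA0] at h
  exact ⟨h, by positivity⟩
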